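/- Work over $\mathbb{C}$. Let $0\le r\le n$ be integers and let $\mathcal{Q}$ be the tautological quotient bundle on $\mathbb{P}^{n-r}$, i.e. $\mathcal{Q}=\mathcal{O}^{\oplus (n-r+1)}/\mathcal{O}(-1)$, where the fibre of $\mathcal{O}(-1)$ at a point $[y]$ is the line spanned by $y$. Let $\mathcal{Q}(0,1)=\mathcal{Q}\boxtimes\mathcal{O}_{\mathbb{P}^n}(1)$ on $\mathbb{P}^{n-r}\times\mathbb{P}^n$. Then there is a non-empty Zariski open subset $U\subset H^0(\mathbb{P}^{n-r}\times\mathbb{P}^n,\mathcal{Q}(0,1))$ such that for every $s\in U$ and every linear subspace $\mathbb{P}^{r-1}\subset\mathbb{P}^n$ (with $\mathbb{P}^{-1}=\emptyset$) the blow-up of $\mathbb{P}^n$ along $\mathbb{P}^{r-1}$ exists and is isomorphic, as a scheme over $\mathbb{C}$, to the zero scheme of $s$: \[ \mathrm{Bl}_{\mathbb{P}^{r-1}}\mathbb{P}^n\;\cong\;\mathscr{Z}(s)\subset\mathbb{P}^{n-r}\times\mathbb{P}^n . \] -/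

import Mathlib

open CategoryTheory AlgebraicGeometry
open scoped Kronecker

noncomputable section

namespace BlowUpLinear

/-! ### Restriction of functions -/

/-- Restriction of functions from an open subset `U` to a smaller open subset `V`. -/
def res {X : Scheme.{0}} {U V : X.Opens} (h : V ≤ U) : Γ(X, U) →+* Γ(X, V) :=
  (X.presheaf.map (homOfLE h).op).hom

theorem res_comp {X : Scheme.{0}} {U V W : X.Opens} (h : V ≤ U) (h' : W ≤ V) :
    (res h').comp (res h) = res (h'.trans h) := by
  unfold res
  rw [← CommRingCat.hom_comp, ← Functor.map_comp]
  rfl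

theorem res_res {X : Scheme.{0}} {U V W : X.Opens} (h : V ≤ U) (h' : W ≤ V) (a : Γ(X, U)) :
    res h' (res h a) = res (h'.trans h) a :=
  RingHom.congr_fun (res_comp h h') a

theorem map_res_res {X : Scheme.{0}} {U V W : X.Opens} (h : V ≤ U) (h' : W ≤ V)
    {m n : Type} (M : Matrix m n Γ(X, U)) :
    (M.map (res h)).map (res h') = M.map (res (h'.trans h)) := by
  ext; simp [res_res]

/-- Pull-back of functions along a morphism of schemes. -/
def pull {X Y : Scheme.{0}} (f : X ⟶ Y) {U : Y.Opens} {V : X.Opens} (h : V ≤ f ⁻¹ᵁ U) :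
    Γ(Y, U) →+* Γ(X, V) :=
  (f.appLE U V h).hom

theorem res_pull {X Y : Scheme.{0}} (f : X ⟶ Y) {U : Y.Opens} {V V' : X.Opens}
    (h : V ≤ f ⁻¹ᵁ U) (h' : V' ≤ V) (a : Γ(Y, U)) :
    res h' (pull f h a) = pull f (h'.trans h) a := by
  unfold res pull
  rw [← Scheme.Hom.appLE_map f h (homOfLE h').op]
  rfl

theorem pull_res {X Y : Scheme.{0}} (f : X ⟶ Y) {U U' : Y.Opens} {V : X.Opens}
    (hU : U ≤ U') (h : V ≤ f ⁻¹ᵁ U) (a : Γ(Y, U')) :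
    pull f h (res hU a) = pull f (h.trans (Scheme.Hom.preimage_mono f hU)) a := by
  unfold res pull
  rw [← Scheme.Hom.map_appLE f h (homOfLE hU).op]
  rfl

theorem le_preimage_inf {X Y : Scheme.{0}} (f : X ⟶ Y) {U V : Y.Opens} :
    f ⁻¹ᵁ U ⊓ f ⁻¹ᵁ V ≤ f ⁻¹ᵁ (U ⊓ V) :=
  fun _ hx => hx

theorem le_preimage_inf₃ {X Y : Scheme.{0}} (f : X ⟶ Y) {U V W : Y.Opens} :
    f ⁻¹ᵁ U ⊓ f ⁻¹ᵁ V ⊓ f ⁻¹ᵁ W ≤ f ⁻¹ᵁ (U ⊓ V ⊓ W) :=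
  fun _ hx => hx

/-- The functions on a scheme over `Spec ℂ` form `ℂ`-algebras. -/
instance {X : Scheme.{0}} [X.Over (Spec (.of ℂ))] (U : X.Opens) : Algebra ℂ Γ(X, U) :=
  ((pull (X ↘ Spec (.of ℂ)) (U := ⊤) (V := U) le_top).comp
    (Scheme.ΓSpecIso (.of ℂ)).inv.hom).toAlgebra

/-! ### Ideal sheaves given by local generators -/

/-- The smallest quasi-coherent ideal sheaf that contains the sections in `S i` over the open
sets `U i`. Its closed subscheme is the largest one on which all these sections vanish. -/
def idealGeneratedBy {X : Scheme.{0}} {ι : Type} (U : ι → X.Opens)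
    (S : ∀ i, Set Γ(X, U i)) : X.IdealSheafData :=
  sInf {I | ∀ (i : ι) (V : X.affineOpens) (h : V.1 ≤ U i), ∀ a ∈ S i, res h a ∈ I.ideal V}

/-! ### Vector bundles, their sections and zero loci -/

/-- A vector bundle on `X`, given by a trivializing open cover `U i`, a finite local frame over
each `U i`, and transition matrices `g i j` on `U i ⊓ U j` subject to the cocycle condition.
The matrix `g i j` turns coordinates with respect to the frame `j` into coordinates with respect
to the frame `i`. -/
structure VecBundle (X : Scheme.{0}) where
  Idx : Type
  U : Idx → X.Opens
  cover : ⨆ i, U i = ⊤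
  Frame : Idx → Type
  [fintypeFrame : ∀ i, Fintype (Frame i)]
  [decEqFrame : ∀ i, DecidableEq (Frame i)]
  g : ∀ i j, Matrix (Frame i) (Frame j) Γ(X, U i ⊓ U j)
  g_self : ∀ i, g i i = 1
  g_comp : ∀ i j k,
    (g i j).map (res (inf_le_left : U i ⊓ U j ⊓ U k ≤ U i ⊓ U j)) *
      (g j k).map (res (inf_le_inf_right _ inf_le_right : U i ⊓ U j ⊓ U k ≤ U j ⊓ U k)) =
    (g i k).map (res (inf_le_inf_right _ inf_le_left : U i ⊓ U j ⊓ U k ≤ U i ⊓ U k))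

attribute [instance] VecBundle.fintypeFrame VecBundle.decEqFrame

namespace VecBundle

/-- The pull-back `f^* E`. -/
def pullback {X Y : Scheme.{0}} (f : X ⟶ Y) (E : VecBundle Y) : VecBundle X where
  Idx := E.Idx
  U i := f ⁻¹ᵁ E.U i
  cover := by rw [← Scheme.Hom.preimage_iSup, E.cover]; rfl
  Frame := E.Frame
  g i j := (E.g i j).map (pull f (V := f ⁻¹ᵁ E.U i ⊓ f ⁻¹ᵁ E.U j) (le_preimage_inf f))
  g_self i := by rw [E.g_self]; simp
  g_comp i j k := by
    have h := congrArg (fun M => M.map (pull f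
      (V := f ⁻¹ᵁ E.U i ⊓ f ⁻¹ᵁ E.U j ⊓ f ⁻¹ᵁ E.U k) (le_preimage_inf₃ f))) (E.g_comp i j k)
    simp only [Matrix.map_mul] at h
    have key : ∀ {m n : Type} {A : Y.Opens} {B C : X.Opens} (M : Matrix m n Γ(Y, A))
        (h₁ : B ≤ f ⁻¹ᵁ A) (h₂ : C ≤ B), (M.map (pull f h₁)).map (res h₂) =
          M.map (pull f (h₂.trans h₁)) := by
      intros; ext; simp [res_pull]
    have key' : ∀ {m n : Type} {A A' : Y.Opens} {B : X.Opens} (M : Matrix m n Γ(Y, A'))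
        (h₁ : A ≤ A') (h₂ : B ≤ f ⁻¹ᵁ A), (M.map (res h₁)).map (pull f h₂) =
          M.map (pull f (h₂.trans (Scheme.Hom.preimage_mono f h₁))) := by
      intros; ext; simp [pull_res]
    simp only [key'] at h
    simp only [key]
    exact h

/-- The tensor product `E ⊗ F`. -/
def tensor {X : Scheme.{0}} (E F : VecBundle X) : VecBundle X where
  Idx := E.Idx × F.Idx
  U a := E.U a.1 ⊓ F.U a.2
  cover := by
    rw [iSup_prod]
    simp_rw [← inf_iSup_eq, F.cover, inf_top_eq, E.cover]
  Frame a := E.Frame a.1 × F.Frame a.2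
  g a b :=
    (E.g a.1 b.1).map (res (inf_le_inf inf_le_left inf_le_left)) ⊗ₖ
      (F.g a.2 b.2).map (res (inf_le_inf inf_le_right inf_le_right))
  g_self a := by
    rw [E.g_self, F.g_self]
    simp
  g_comp a b c := by
    have hE := congrArg (fun M => M.map (res (V := E.U a.1 ⊓ F.U a.2 ⊓ (E.U b.1 ⊓ F.U b.2) ⊓
      (E.U c.1 ⊓ F.U c.2)) (inf_le_inf (inf_le_inf inf_le_left inf_le_left) inf_le_left)))
      (E.g_comp a.1 b.1 c.1)
    have hF := congrArg (fun M => M.map (res (V := E.U a.1 ⊓ F.U a.2 ⊓ (E.U b.1 ⊓ F.U b.2) ⊓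
      (E.U c.1 ⊓ F.U c.2)) (inf_le_inf (inf_le_inf inf_le_right inf_le_right) inf_le_right)))
      (F.g_comp a.2 b.2 c.2)
    simp only [Matrix.map_mul, map_res_res] at hE hF
    have key : ∀ {m n m' n' : Type} {A B : X.Opens} (M : Matrix m n Γ(X, A))
        (N : Matrix m' n' Γ(X, A)) (h : B ≤ A),
        (M ⊗ₖ N).map (res h) = M.map (res h) ⊗ₖ N.map (res h) := by
      intros; ext; simp
    simp only [key, map_res_res, ← Matrix.mul_kronecker_mul]
    rw [hE, hF]

/-- The complex vector space `H⁰(X, E)` of global sections: families of coordinate vectors over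
the trivializing open sets that are matched by the transition matrices. -/
def globalSections {X : Scheme.{0}} [X.Over (Spec (.of ℂ))] (E : VecBundle X) :
    Submodule ℂ (∀ i, E.Frame i → Γ(X, E.U i)) where
  carrier := {s | ∀ i j,
    (fun a => res (inf_le_left : E.U i ⊓ E.U j ≤ E.U i) (s i a)) =
      (E.g i j).mulVec (fun b => res (inf_le_right : E.U i ⊓ E.U j ≤ E.U j) (s j b))}
  add_mem' := by
    intro s t hs ht i j
    have := congrArg₂ (· + ·) (hs i j) (ht i j)
    simp only [← Matrix.mulVec_add] at this
    convert this using 1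
    · ext; simp
    · congr 1; ext; simp
  zero_mem' := by
    intro i j
    ext
    simp [Matrix.mulVec, dotProduct]
  smul_mem' := by
    intro c s hs i j
    have hres : ∀ {U V : X.Opens} (h : V ≤ U) (a : Γ(X, U)), res h (c • a) = c • res h a := by
      intro U V h a
      rw [Algebra.smul_def, Algebra.smul_def, map_mul]
      congr 1
      exact res_pull (X ↘ Spec (.of ℂ)) (U := ⊤) le_top h ((Scheme.ΓSpecIso (.of ℂ)).inv.hom c)
    have := congrArg (c • ·) (hs i j)
    simp only [← Matrix.mulVec_smul] at this
    convert this using 1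
    · ext; simp [hres]
    · congr 1; ext; simp [hres]

/-- The ideal sheaf of the zero scheme of a section: locally generated by the coordinates of the
section. -/
def zeroIdeal {X : Scheme.{0}} [X.Over (Spec (.of ℂ))] (E : VecBundle X)
    (s : E.globalSections) : X.IdealSheafData :=
  idealGeneratedBy E.U fun i => Set.range (s.1 i)

/-- The zero locus `Z(s)` of a section `s`, as a closed subscheme. -/
def zeroLocus {X : Scheme.{0}} [X.Over (Spec (.of ℂ))] (E : VecBundle X)
    (s : E.globalSections) : Scheme.{0} :=
  (E.zeroIdeal s).subscheme

/-- The closed immersion of `Z(s)`. -/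
def zeroLocusι {X : Scheme.{0}} [X.Over (Spec (.of ℂ))] (E : VecBundle X)
    (s : E.globalSections) : E.zeroLocus s ⟶ X :=
  (E.zeroIdeal s).subschemeι

end VecBundle

/-- A property holds for the general element of a complex vector space `H` if it holds on the
non-empty complement of the zero set of a polynomial function on `H`, that is, of a polynomial
expression in linear forms on `H`. -/
def HoldsForGeneral {H : Type} [AddCommGroup H] [Module ℂ H] (P : H → Prop) : Prop :=
  ∃ p : MvPolynomial (Module.Dual ℂ H) ℂ,
    (∃ s : H, MvPolynomial.eval (fun φ => φ s) p ≠ 0) ∧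
      ∀ s : H, MvPolynomial.eval (fun φ => φ s) p ≠ 0 → P s

/-! ### Blow-ups -/

/-- The ideal sheaf of an effective Cartier divisor: locally generated by one nonzerodivisor. -/
def IsCartier {X : Scheme.{0}} (I : X.IdealSheafData) : Prop :=
  ∀ x : X, ∃ U : X.affineOpens, x ∈ U.1 ∧
    ∃ a ∈ nonZeroDivisors Γ(X, U.1), I.ideal U = Ideal.span {a}

/-- `π : B ⟶ X` is the blow-up of `X` along the closed subscheme with ideal sheaf `I`: the inverse
image of that subscheme in `B` is an effective Cartier divisor, and `π` is universal with this
property. (`I.comap f` is the inverse image ideal sheaf `f⁻¹I · 𝒪`.) -/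
structure IsBlowUp {X B : Scheme.{0}} (I : X.IdealSheafData) (π : B ⟶ X) : Prop where
  cartier : IsCartier (I.comap π)
  universal : ∀ (T : Scheme.{0}) (f : T ⟶ X), IsCartier (I.comap f) →
    ∃! g : T ⟶ B, g ≫ π = f

/-! ### Projective space -/

/-- The grading of `ℂ[x₀, …, xₙ]` by degree. -/
abbrev grading (n : ℕ) : ℕ → Submodule ℂ (MvPolynomial (Fin (n + 1)) ℂ) :=
  MvPolynomial.homogeneousSubmodule (Fin (n + 1)) ℂ

instance (n : ℕ) : GradedAlgebra (grading n) := MvPolynomial.gradedAlgebra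

/-- `ℙⁿ = Proj ℂ[x₀, …, xₙ]`. -/
abbrev PP (n : ℕ) : Scheme.{0} := Proj (grading n)

instance (n : ℕ) : (PP n).Over (Spec (.of ℂ)) where
  hom := Proj.toSpecZero (grading n) ≫ Spec.map (CommRingCat.ofHom (algebraMap ℂ (grading n 0)))

/-- The chart `xᵢ ≠ 0`. -/
abbrev chart (n : ℕ) (i : Fin (n + 1)) : (PP n).Opens :=
  Proj.basicOpen (grading n) (MvPolynomial.X i)

theorem X_mem (n : ℕ) (i : Fin (n + 1)) :
    (MvPolynomial.X i : MvPolynomial (Fin (n + 1)) ℂ) ∈ grading n 1 :=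
  MvPolynomial.isHomogeneous_X ℂ i

/-- The function `xⱼ / xᵢ` on the chart `xᵢ ≠ 0`. -/
def ratio (n : ℕ) (j i : Fin (n + 1)) : Γ(PP n, chart n i) :=
  (Proj.awayToSection (grading n) (MvPolynomial.X i)).hom
    (HomogeneousLocalization.Away.mk (grading n) (X_mem n i) 1 (MvPolynomial.X j) (X_mem n j))

theorem iSup_chart (n : ℕ) : ⨆ i, chart n i = ⊤ := by
  refine Proj.iSup_basicOpen_eq_top' (grading n) _ (fun i => ⟨1, X_mem n i⟩) ?_
  rw [eq_top_iff]
  intro p _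
  induction p using MvPolynomial.induction_on with
  | C a => exact Subalgebra.algebraMap_mem _ (⟨MvPolynomial.C a, MvPolynomial.isHomogeneous_C _ a⟩ :
      grading n 0)
  | add p q hp hq => exact add_mem (hp trivial) (hq trivial)
  | mul_X p i hp => exact mul_mem (hp trivial) (Algebra.subset_adjoin ⟨i, rfl⟩)

theorem ratio_self (n : ℕ) (i : Fin (n + 1)) : ratio n i i = 1 := by
  unfold ratio
  rw [← map_one (Proj.awayToSection (grading n) (MvPolynomial.X i)).hom]
  congr 1
  apply HomogeneousLocalization.val_injective
  rw [HomogeneousLocalization.Away.val_mk, HomogeneousLocalization.val_one]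
  convert Localization.mk_self _ using 2
  simp

theorem ratio_mul_ratio (n : ℕ) (i j k : Fin (n + 1)) {V : (PP n).Opens}
    (hi : V ≤ chart n i) (hj : V ≤ chart n j) :
    res hi (ratio n j i) * res hj (ratio n k j) = res hi (ratio n k i) := by
  refine Subtype.ext (funext fun x => HomogeneousLocalization.val_injective _ ?_)
  have := x.1.isPrime
  have key : ∀ (a b : Fin (n + 1)) (h : V ≤ chart n b),
      (((res h (ratio n a b)).1 x).val : Localization x.1.asHomogeneousIdeal.toIdeal.primeCompl) =
        Localization.mk (MvPolynomial.X a) (⟨MvPolynomial.X b ^ 1,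
          fun hb => h x.2 (by simpa using hb)⟩ : x.1.asHomogeneousIdeal.toIdeal.primeCompl) := by
    intro a b h
    rfl
  have hmul : ∀ a b : Γ(PP n, V), ((a * b).1 x).val = (a.1 x).val * (b.1 x).val := by
    intro a b
    rw [← HomogeneousLocalization.val_mul]
    rfl
  rw [hmul, key, key, key, Localization.mk_mul, Localization.mk_eq_mk_iff, Localization.r_iff_exists]
  refine ⟨1, ?_⟩
  simp
  ring

/-- The line bundle `𝒪(1)` on `ℙⁿ`: a linear form `ℓ` has the coordinate `ℓ / xᵢ` on the chart
`xᵢ ≠ 0`. -/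
def hyperplaneBundle (n : ℕ) : VecBundle (PP n) where
  Idx := Fin (n + 1)
  U := chart n
  cover := iSup_chart n
  Frame _ := Unit
  g i j := Matrix.of fun _ _ => res inf_le_left (ratio n j i)
  g_self i := by ext; simp [ratio_self]
  g_comp i j k := by
    ext
    simp only [Matrix.mul_apply, Matrix.map_apply, Matrix.of_apply, res_res,
      Finset.univ_unique, Finset.sum_singleton]
    exact ratio_mul_ratio n i j k _ _

theorem quotient_cocycle {R : Type} [CommRing R] {m : ℕ} (q i j p : Fin (m + 1))
    (t u : Fin (m + 1) → R) (hj : u j = 1) (h : ∀ x, u x = t x * u i) :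
    ∑ x : {x : Fin (m + 1) // x ≠ j},
      ((if q = x.1 then 1 else 0) - t q * (if i = x.1 then 1 else 0)) *
        ((if x.1 = p then 1 else 0) - u x.1 * (if j = p then 1 else 0)) =
      (if q = p then 1 else 0) - t q * (if i = p then 1 else 0) := by
  let F : Fin (m + 1) → R := fun x =>
    ((if q = x then 1 else 0) - t q * (if i = x then 1 else 0)) *
      ((if x = p then 1 else 0) - u x * (if j = p then 1 else 0))
  have hF : F j = 0 := by simp [F, hj]
  have h1 : ∑ x : {x : Fin (m + 1) // x ≠ j}, F x.1 = ∑ x, F x := by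
    rw [← Finset.sum_erase Finset.univ hF]
    exact (Finset.sum_subtype _ (by simp) F).symm
  refine h1.trans ?_
  simp only [F, sub_mul, mul_sub, Finset.sum_sub_distrib, mul_assoc, ← Finset.mul_sum, ite_mul,
    one_mul, zero_mul, Finset.sum_ite_eq, Finset.mem_univ, if_true]
  rw [h q]
  ring

/-- The tautological quotient bundle `Q = 𝒪ᵐ⁺¹ / 𝒪(-1)` on `ℙᵐ`, where the fibre of `𝒪(-1)` at
`[y]` is the line spanned by `y = (y₀, …, yₘ)`. Over the chart `yᵢ ≠ 0` the images of the standard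
basis vectors `e_p` with `p ≠ i` are a frame of `Q`; the image of any vector `v` has the coordinates
`v_q - (y_q / yᵢ) vᵢ`, `q ≠ i`, with respect to this frame. The entries of the transition matrix
are these coordinates for `v = e_p`. -/
def quotientBundle (m : ℕ) : VecBundle (PP m) where
  Idx := Fin (m + 1)
  U := chart m
  cover := iSup_chart m
  Frame i := {q : Fin (m + 1) // q ≠ i}
  g i j := Matrix.of fun q p =>
    (Pi.single p.1 1 : Fin (m + 1) → Γ(PP m, chart m i ⊓ chart m j)) q.1 -
      res inf_le_left (ratio m q.1 i) *
        (Pi.single p.1 1 : Fin (m + 1) → Γ(PP m, chart m i ⊓ chart m j)) i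
  g_self i := by
    ext q p
    have hp : i ≠ p.1 := p.2.symm
    simp [Matrix.one_apply, Pi.single_apply, hp, Subtype.ext_iff]
  g_comp i j k := by
    ext q p
    simp only [Matrix.mul_apply, Matrix.map_apply, Matrix.of_apply, map_sub, map_mul, res_res,
      Pi.single_apply, apply_ite (res _), map_one, map_zero]
    have hi : chart m i ⊓ chart m j ⊓ chart m k ≤ chart m i := inf_le_left.trans inf_le_left
    have hj : chart m i ⊓ chart m j ⊓ chart m k ≤ chart m j := inf_le_left.trans inf_le_right
    exact quotient_cocycle q.1 i j p.1 (fun x => res hi (ratio m x i))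
      (fun x => res hj (ratio m x j)) (by rw [ratio_self, map_one])
      (fun x => (ratio_mul_ratio m j i x hj hi).symm.trans (mul_comm _ _))

/-- The ideal sheaf of the linear subspace `ℙ(L) ⊆ ℙⁿ`, for a vector subspace `L` of `ℂⁿ⁺¹`: on the
chart `xᵢ ≠ 0` it is generated by the functions `ℓ / xᵢ`, where `ℓ` runs through the linear forms
that vanish on `L`. -/
def linearSubspaceIdeal (n : ℕ) (L : Submodule ℂ (Fin (n + 1) → ℂ)) :
    (PP n).IdealSheafData :=
  idealGeneratedBy (chart n) fun i =>
    {a | ∃ ℓ ∈ L.dualAnnihilator, a = ∑ j, ℓ (Pi.single j 1) • ratio n j i}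

/-! ### The bundle `Q(0,1)` on `ℙᵐ × ℙⁿ` -/

/-- The product `ℙᵐ × ℙⁿ` over `Spec ℂ`. -/
abbrev PPprod (m n : ℕ) : Scheme.{0} :=
  Limits.pullback (PP m ↘ Spec (.of ℂ)) (PP n ↘ Spec (.of ℂ))

/-- The projection `ℙᵐ × ℙⁿ ⟶ ℙᵐ`. -/
abbrev pr₁ (m n : ℕ) : PPprod m n ⟶ PP m := Limits.pullback.fst _ _

/-- The projection `ℙᵐ × ℙⁿ ⟶ ℙⁿ`. -/
abbrev pr₂ (m n : ℕ) : PPprod m n ⟶ PP n := Limits.pullback.snd _ _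

instance (m n : ℕ) : (PPprod m n).Over (Spec (.of ℂ)) where
  hom := pr₁ m n ≫ (PP m ↘ Spec (.of ℂ))

/-- The bundle `Q(0,1) = Q ⊠ 𝒪(1)` on `ℙᵐ × ℙⁿ`, where `Q` is the tautological quotient bundle
of `ℙᵐ`. -/
def Q01 (m n : ℕ) : VecBundle (PPprod m n) :=
  ((quotientBundle m).pullback (pr₁ m n)).tensor ((hyperplaneBundle n).pullback (pr₂ m n))

end BlowUpLinear

end

open BlowUpLinear

/-!
A matrix `A` with `n - r + 1` rows defines the section of `Q(0,1)` that sends `(y, x)` to the class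
of `A x` modulo `y`. It vanishes where `A x` is proportional to `y`, that is, where the ideal
generated by the entries of `A x` is generated by a single function, with quotients the coordinates
of `y`. If `A` has a right inverse then this is the universal property of the blow-up of `ℙⁿ` along
`ℙ(ker A)`.

Every section is of this form if `r < n`: on a chart its coordinates are Laurent polynomials in `y`
and `x`, and comparing the supports on different charts leaves only the matrix entries. So for a
general section `A` has a non-vanishing maximal minor, hence a right inverse, and a linear
automorphism of `ℙⁿ` moves `ker A` to any given subspace of dimension `r`.
-/

noncomputable section

namespace BlowUpLinear

/-! ### Functions on schemes -/

section Functions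

variable {X Y Z : Scheme.{0}}

theorem res_self {U : X.Opens} (h : U ≤ U) (a : Γ(X, U)) : res h a = a :=
  congrArg (fun φ => φ.hom a) (X.presheaf.map_id (.op U))

theorem pull_pull (f : X ⟶ Y) (g : Y ⟶ Z) {U : Z.Opens} {V : Y.Opens} {W : X.Opens}
    (h : V ≤ g ⁻¹ᵁ U) (h' : W ≤ f ⁻¹ᵁ V) (a : Γ(Z, U)) :
    pull f h' (pull g h a) = pull (f ≫ g) (h'.trans (Scheme.Hom.preimage_mono f h)) a :=
  congrArg (fun φ => φ.hom a) (Scheme.Hom.appLE_comp_appLE f g U V W h h')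

theorem pull_congr {f g : X ⟶ Y} (e : f = g) {U : Y.Opens} {V : X.Opens}
    (h : V ≤ f ⁻¹ᵁ U) (h' : V ≤ g ⁻¹ᵁ U) (a : Γ(Y, U)) : pull f h a = pull g h' a := by
  subst e
  rfl

theorem pull_id {U V : X.Opens} (h : V ≤ (𝟙 X : X ⟶ X) ⁻¹ᵁ U) (a : Γ(X, U)) :
    pull (𝟙 X) h a = res (show V ≤ U from h) a := by
  refine congrArg (fun φ => φ.hom a) (?_ : (𝟙 X : X ⟶ X).appLE U V h = X.presheaf.map _)
  rw [Scheme.Hom.appLE, Scheme.Hom.id_app]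
  exact Category.id_comp _

theorem pull_bijective (j : X ⟶ Y) [IsOpenImmersion j] {V : Y.Opens} {W : X.Opens}
    (hV : V ≤ j.opensRange) (h : W ≤ j ⁻¹ᵁ V) (h' : j ⁻¹ᵁ V ≤ W) :
    Function.Bijective (pull j h) := by
  obtain rfl := le_antisymm h h'
  have := j.isIso_app V hV
  rw [pull, Scheme.Hom.appLE_eq_app]
  exact ConcreteCategory.bijective_of_isIso (j.app V)

theorem le_ι_preimage (U : X.Opens) : (⊤ : U.toScheme.Opens) ≤ U.ι ⁻¹ᵁ U :=
  U.ι_preimage_self.ge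

theorem pull_ι_bijective (U : X.Opens) : Function.Bijective (pull U.ι (le_ι_preimage U)) :=
  pull_bijective U.ι U.opensRange_ι.ge _ le_top

theorem pull_injective_of_factor {U : X.Opens} (e : Y ⟶ X) {V : Y.Opens} (h : V ≤ e ⁻¹ᵁ U)
    (b : U.toScheme ⟶ Y) (hb : ⊤ ≤ b ⁻¹ᵁ V) (hbe : b ≫ e = U.ι) :
    Function.Injective (pull e h) := by
  have key (a : Γ(X, U)) : pull b hb (pull e h a) = pull U.ι (le_ι_preimage U) a :=
    (pull_pull b e h hb a).trans (pull_congr hbe _ _ a)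
  refine fun a a' haa => (pull_ι_bijective U).1 ?_
  rw [← key, ← key, haa]

theorem section_ext {U : X.Opens} {a b : Γ(X, U)}
    (h : ∀ x ∈ U, ∃ (V : X.Opens) (hV : V ≤ U), x ∈ V ∧ res hV a = res hV b) : a = b :=
  X.IsSheaf.section_ext fun x hx =>
    let ⟨V, hV, hxV, e⟩ := h x hx
    ⟨V, hV, hxV, e⟩

theorem le_preimage_top (f : X ⟶ Y) (V : X.Opens) : V ≤ f ⁻¹ᵁ ⊤ :=
  le_top

/-- The scalars `ℂ → Γ(X, U)` of a scheme over `Spec ℂ`. The structure morphism is an explicit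
argument, so that it can be changed along an equation of morphisms. -/
def scalar (τ : X ⟶ Spec (.of ℂ)) (U : X.Opens) : ℂ →+* Γ(X, U) :=
  (pull τ (le_preimage_top τ U)).comp (Scheme.ΓSpecIso (.of ℂ)).inv.hom

theorem smul_eq_scalar_mul [X.Over (Spec (.of ℂ))] {U : X.Opens} (c : ℂ) (a : Γ(X, U)) :
    c • a = scalar (X ↘ Spec (.of ℂ)) U c * a :=
  Algebra.smul_def c a

theorem res_scalar (τ : X ⟶ Spec (.of ℂ)) {U V : X.Opens} (h : V ≤ U) (c : ℂ) :
    res h (scalar τ U c) = scalar τ V c :=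
  res_pull τ (le_preimage_top τ U) h _

theorem pull_scalar (f : X ⟶ Y) (τ : Y ⟶ Spec (.of ℂ)) {U : Y.Opens} {V : X.Opens}
    (h : V ≤ f ⁻¹ᵁ U) (c : ℂ) : pull f h (scalar τ U c) = scalar (f ≫ τ) V c :=
  pull_pull f τ (le_preimage_top τ U) h _

end Functions

/-! ### Morphisms of schemes -/

section Morphisms

variable {T X B : Scheme.{0}} {R : CommRingCat.{0}}

/-- The elements of `R` as functions on `Spec R`. -/
def specFun (R : CommRingCat.{0}) : R →+* Γ(Spec R, ⊤) := (Scheme.ΓSpecIso R).inv.hom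

theorem specFun_bijective (R : CommRingCat.{0}) : Function.Bijective (specFun R) :=
  ConcreteCategory.bijective_of_isIso (Scheme.ΓSpecIso R).inv

theorem appLE_top (f : T ⟶ X) : f.appLE ⊤ ⊤ (le_preimage_top f ⊤) = f.appTop :=
  f.appLE_eq_app

theorem exists_hom_Spec (φ : R →+* Γ(T, ⊤)) :
    ∃ f : T ⟶ Spec R, ∀ r, pull f (le_preimage_top f ⊤) (specFun R r) = φ r := by
  refine ⟨T.toSpecΓ ≫ Spec.map (CommRingCat.ofHom φ), fun r => ?_⟩
  refine congrArg (fun ψ => ψ.hom r)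
    (?_ : (Scheme.ΓSpecIso R).inv ≫ Scheme.Hom.appLE _ ⊤ ⊤ _ = CommRingCat.ofHom φ)
  rw [appLE_top, Scheme.Hom.comp_appTop, Scheme.toSpecΓ_appTop, Scheme.ΓSpecIso_naturality,
    Iso.inv_hom_id_assoc]

theorem hom_Spec_ext {f g : T ⟶ Spec R}
    (h : ∀ r : R, pull f (le_preimage_top f ⊤) (specFun R r) =
      pull g (le_preimage_top g ⊤) (specFun R r)) : f = g := by
  refine ext_to_Spec (CommRingCat.hom_ext (RingHom.ext fun r => ?_))
  have hr := h r
  rw [pull, pull, appLE_top, appLE_top] at hr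
  exact hr

theorem hom_Spec_complex_ext {σ τ : T ⟶ Spec (.of ℂ)}
    (h : ∀ c, scalar σ ⊤ c = scalar τ ⊤ c) : σ = τ :=
  hom_Spec_ext h

theorem pull_specMap {S : CommRingCat.{0}} (φ : R →+* S) (r : R) :
    pull (Spec.map (CommRingCat.ofHom φ)) (le_preimage_top _ ⊤) (specFun R r) = specFun S (φ r) :=
  congrArg (fun ψ => ψ.hom r) (Scheme.ΓSpecIso_inv_naturality (CommRingCat.ofHom φ)).symm

theorem scalar_specMap (φ : ℂ →+* R) (c : ℂ) :
    scalar (Spec.map (CommRingCat.ofHom φ)) ⊤ c = specFun R (φ c) :=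
  pull_specMap (R := .of ℂ) φ c

theorem isOpenCover_of_forall_mem {U : T → T.Opens} (hU : ∀ t, t ∈ U t) :
    TopologicalSpace.IsOpenCover U :=
  eq_top_iff.mpr fun t _ => TopologicalSpace.Opens.mem_iSup.mpr ⟨t, hU t⟩

theorem hom_ext_of_locally {f g : T ⟶ X}
    (h : ∀ t : T, ∃ V : T.Opens, t ∈ V ∧ V.ι ≫ f = V.ι ≫ g) : f = g := by
  choose V hV hfg using h
  exact (T.openCoverOfIsOpenCover V (isOpenCover_of_forall_mem hV)).hom_ext _ _ hfg

theorem exists_lift_of_locally {f : T ⟶ X} {π : B ⟶ X}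
    (hex : ∀ t : T, ∃ (W : T.Opens) (_ : t ∈ W) (z : W.toScheme ⟶ B), z ≫ π = W.ι ≫ f)
    (huniq : ∀ (S : Scheme.{0}) (j : S ⟶ T) [IsOpenImmersion j] (z z' : S ⟶ B),
      z ≫ π = j ≫ f → z' ≫ π = j ≫ f → z = z') : ∃ g : T ⟶ B, g ≫ π = f := by
  choose W hW z hz using hex
  let 𝒰 := T.openCoverOfIsOpenCover W (isOpenCover_of_forall_mem hW)
  let z' (x : 𝒰.I₀) : 𝒰.X x ⟶ B := z x
  have hz' (x : 𝒰.I₀) : z' x ≫ π = 𝒰.f x ≫ f := hz x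
  have hcompat (x y : 𝒰.I₀) : Limits.pullback.fst (𝒰.f x) (𝒰.f y) ≫ z' x =
      Limits.pullback.snd (𝒰.f x) (𝒰.f y) ≫ z' y := by
    apply huniq _ (Limits.pullback.fst (𝒰.f x) (𝒰.f y) ≫ 𝒰.f x)
    · rw [Category.assoc, Category.assoc, hz']
    · rw [Category.assoc, Category.assoc, hz', Limits.pullback.condition_assoc]
  refine ⟨𝒰.glueMorphisms z' hcompat, 𝒰.hom_ext _ _ fun x => ?_⟩
  rw [← Category.assoc, Scheme.Cover.ι_glueMorphisms, hz']

end Morphisms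

/-! ### Ideal sheaves -/

section IdealSheaves

variable {X Y : Scheme.{0}}

theorem res_mem_ideal (K : X.IdealSheafData) {U V : X.affineOpens} (h : V.1 ≤ U.1) {a : Γ(X, U.1)}
    (ha : a ∈ K.ideal U) : res h a ∈ K.ideal V :=
  K.ideal_le_comap_ideal (U := V) (V := U) h ha

theorem ideal_eq_map_res (K : X.IdealSheafData) {U V : X.affineOpens} (h : V.1 ≤ U.1) :
    K.ideal V = (K.ideal U).map (res h) :=
  (K.map_ideal (U := V) (V := U) h).symm

theorem isAffineOpen_top_toScheme {V : X.Opens} (hV : IsAffineOpen V) :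
    IsAffineOpen (⊤ : V.toScheme.Opens) :=
  have : IsAffine V.toScheme := hV
  isAffineOpen_top _

theorem mem_map_iff_of_bijective {R S : Type*} [CommRing R] [CommRing S] {φ : R →+* S}
    (hφ : Function.Bijective φ) {I : Ideal R} {a : R} : φ a ∈ I.map φ ↔ a ∈ I :=
  ⟨fun h => by
    obtain ⟨x, hx, hxa⟩ := (Ideal.mem_map_iff_of_surjective _ hφ.2).mp h
    rwa [← hφ.1 hxa], Ideal.mem_map_of_mem φ⟩

theorem ideal_comap_ι (K : X.IdealSheafData) {V : X.Opens} (hV : IsAffineOpen V) :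
    (K.comap V.ι).ideal ⟨⊤, isAffineOpen_top_toScheme hV⟩ =
      (K.ideal ⟨V, hV⟩).map (pull V.ι (le_ι_preimage V)) := by
  have e : V.ι ''ᵁ ⊤ = V := V.ι_image_top
  have hA : IsAffineOpen (V.ι ''ᵁ ⊤) := by rwa [e]
  have hres : pull V.ι (le_ι_preimage V) = res e.le := by
    simp only [pull, res, Scheme.Hom.appLE, Scheme.Opens.ι_app]
    exact congrArg CommRingCat.Hom.hom (X.presheaf.map_comp _ _).symm
  rw [Scheme.IdealSheafData.ideal_comap_of_isOpenImmersion, hres]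
  refine Eq.trans ?_ (ideal_eq_map_res K (U := ⟨V, hV⟩) (V := ⟨V.ι ''ᵁ ⊤, hA⟩) e.le)
  have hid : (V.ι.appIso ⊤).inv.hom = RingHom.id _ := by
    rw [Scheme.Opens.ι_appIso]
    rfl
  rw [hid]
  exact Ideal.comap_id _

theorem ideal_comap_top [IsAffine X] [IsAffine Y] (K : Y.IdealSheafData) (f : X ⟶ Y) :
    (K.comap f).ideal ⟨⊤, isAffineOpen_top X⟩ =
      (K.ideal ⟨⊤, isAffineOpen_top Y⟩).map (pull f (le_preimage_top f ⊤)) := by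
  set I := (K.ideal ⟨⊤, isAffineOpen_top Y⟩).map (pull f (le_preimage_top f ⊤))
  have hp : pull f (le_preimage_top f ⊤) = (f.app ⊤).hom :=
    congrArg CommRingCat.Hom.hom (Scheme.Hom.appLE_eq_app f)
  have le_iff (J : X.IdealSheafData) : K.comap f ≤ J ↔ I ≤ J.ideal ⟨⊤, isAffineOpen_top X⟩ := by
    rw [← Scheme.IdealSheafData.le_map_iff_comap_le, Ideal.map_le_iff_le_comap, hp]
    have hJ := J.ideal_map_of_isAffineHom f ⟨⊤, isAffineOpen_top Y⟩
    exact ⟨fun h => (h _).trans hJ.le,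
      fun h => Scheme.IdealSheafData.le_of_isAffine (h.trans hJ.ge)⟩
  have hI : (Scheme.IdealSheafData.ofIdealTop I).ideal ⟨⊤, isAffineOpen_top X⟩ = I :=
    Scheme.IdealSheafData.equivOfIsAffine.apply_symm_apply I
  exact le_antisymm (((le_iff _).mpr hI.ge _).trans hI.le) ((le_iff _).mp le_rfl)

theorem ideal_comap (K : Y.IdealSheafData) (f : X ⟶ Y) {V : X.Opens} {U : Y.Opens}
    (hV : IsAffineOpen V) (hU : IsAffineOpen U) (h : V ≤ f ⁻¹ᵁ U) :
    (K.comap f).ideal ⟨V, hV⟩ = (K.ideal ⟨U, hU⟩).map (pull f h) := by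
  have : IsAffine V.toScheme := hV
  have : IsAffine U.toScheme := hU
  let g := f.resLE U V h
  have hg : g ≫ U.ι = V.ι ≫ f := Scheme.Hom.resLE_comp_ι f h
  have hsheaf : (K.comap f).comap V.ι = (K.comap U.ι).comap g := by
    rw [← Scheme.IdealSheafData.comap_comp, ← Scheme.IdealSheafData.comap_comp, hg]
  have hfun : (pull g (le_preimage_top g ⊤)).comp (pull U.ι (le_ι_preimage U)) =
      (pull V.ι (le_ι_preimage V)).comp (pull f h) :=
    RingHom.ext fun a => (pull_pull g U.ι _ _ a).trans
      ((pull_congr hg _ _ a).trans (pull_pull V.ι f _ _ a).symm)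
  have key : ((K.comap f).ideal ⟨V, hV⟩).map (pull V.ι (le_ι_preimage V)) =
      ((K.ideal ⟨U, hU⟩).map (pull f h)).map (pull V.ι (le_ι_preimage V)) :=
    calc
      _ = ((K.comap f).comap V.ι).ideal ⟨⊤, isAffineOpen_top_toScheme hV⟩ :=
        (ideal_comap_ι (K.comap f) hV).symm
      _ = ((K.comap U.ι).comap g).ideal ⟨⊤, isAffineOpen_top_toScheme hV⟩ := by rw [hsheaf]
      _ = ((K.ideal ⟨U, hU⟩).map (pull U.ι (le_ι_preimage U))).map
          (pull g (le_preimage_top g ⊤)) := by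
        rw [← ideal_comap_ι K hU]
        exact ideal_comap_top _ g
      _ = _ := by rw [Ideal.map_map, hfun, Ideal.map_map]
  ext a
  rw [← mem_map_iff_of_bijective (pull_ι_bijective V), key,
    mem_map_iff_of_bijective (pull_ι_bijective V)]

/-- The largest quasi-coherent ideal sheaf on `X` whose restriction to the affine open subset `U`
is generated by `S`. -/
def idealExtension (U : X.Opens) (S : Set Γ(X, U)) : X.IdealSheafData :=
  (Scheme.IdealSheafData.ofIdealTop
    ((Ideal.span S).map (pull U.ι (le_ι_preimage U)))).map U.ι

theorem mem_ideal_idealExtension [X.IsSeparated] {U : X.Opens} (hU : IsAffineOpen U)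
    (S : Set Γ(X, U)) (V : X.affineOpens) (a : Γ(X, V.1)) :
    a ∈ (idealExtension U S).ideal V ↔ res (inf_le_right : U ⊓ V.1 ≤ V.1) a ∈
      Ideal.span (res (inf_le_left : U ⊓ V.1 ≤ U) '' S) := by
  have : IsAffine U.toScheme := hU
  have : IsAffineHom U.ι := by
    have : IsAffineHom (U.ι ≫ Limits.terminal.from X) := inferInstance
    exact IsAffineHom.of_comp U.ι (Limits.terminal.from X)
  have hle : U.ι ⁻¹ᵁ V.1 ≤ U.ι ⁻¹ᵁ (U ⊓ V.1) := fun x hx => ⟨x.2, hx⟩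
  have hbij : Function.Bijective (pull U.ι hle) :=
    pull_bijective U.ι (inf_le_left.trans U.opensRange_ι.ge) hle
      (Scheme.Hom.preimage_mono _ inf_le_right)
  have happ : (U.ι.app V.1).hom a = pull U.ι hle (res inf_le_right a) := by
    rw [pull_res, pull, Scheme.Hom.appLE_eq_app]
  have hideal : (Scheme.IdealSheafData.ofIdealTop
        ((Ideal.span S).map (pull U.ι (le_ι_preimage U)))).ideal
          ⟨U.ι ⁻¹ᵁ V.1, V.2.preimage U.ι⟩ =
      (Ideal.span (res (inf_le_left : U ⊓ V.1 ≤ U) '' S)).map (pull U.ι hle) := by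
    rw [Scheme.IdealSheafData.ofIdealTop_ideal, Ideal.map_map, Ideal.map_span, Ideal.map_span,
      ← Set.image_comp]
    congr 1
    exact Set.image_congr fun a _ => (res_pull _ _ le_top a).trans (pull_res _ _ _ _).symm
  rw [idealExtension, Scheme.IdealSheafData.ideal_map_of_isAffineHom, Ideal.mem_comap, hideal,
    happ, mem_map_iff_of_bijective hbij]

theorem mem_iInf_idealExtension [X.IsSeparated] {ι : Type} [Finite ι] {U : ι → X.Opens}
    (hU : ∀ i, IsAffineOpen (U i)) (S : ∀ i, Set Γ(X, U i)) (V : X.affineOpens) (a : Γ(X, V.1)) :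
    a ∈ (⨅ i, idealExtension (U i) (S i)).ideal V ↔
      ∀ i, res (inf_le_right : U i ⊓ V.1 ≤ V.1) a ∈
        Ideal.span (res (inf_le_left : U i ⊓ V.1 ≤ U i) '' S i) := by
  rw [Scheme.IdealSheafData.ideal_iInf, iInf_apply, Ideal.mem_iInf]
  exact forall_congr' fun i => mem_ideal_idealExtension (hU i) (S i) V a

theorem res_mem_span {U V : X.Opens} (h : V ≤ U) {S : Set Γ(X, U)} {a : Γ(X, U)}
    (ha : a ∈ Ideal.span S) : res h a ∈ Ideal.span (res h '' S) :=
  Ideal.map_span (res h) S ▸ Ideal.mem_map_of_mem (res h) ha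

theorem res_image_res_image {U V W : X.Opens} (h : V ≤ U) (h' : W ≤ V) (S : Set Γ(X, U)) :
    res h' '' (res h '' S) = res (h'.trans h) '' S := by
  rw [← Set.image_comp, ← RingHom.coe_comp, res_comp]

theorem res_image_self {U : X.Opens} (h : U ≤ U) (S : Set Γ(X, U)) : res h '' S = S :=
  (Set.image_congr fun a _ => res_self h a).trans (Set.image_id S)

theorem ideal_idealGeneratedBy [X.IsSeparated] {ι : Type} [Finite ι] {U : ι → X.Opens}
    (hU : ∀ i, IsAffineOpen (U i)) (hcover : ⨆ i, U i = ⊤) {S : ∀ i, Set Γ(X, U i)}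
    (hcompat : ∀ i k, ∀ a ∈ S k, res (inf_le_right : U i ⊓ U k ≤ U k) a ∈
      Ideal.span (res (inf_le_left : U i ⊓ U k ≤ U i) '' S i)) (i : ι) :
    (idealGeneratedBy U S).ideal ⟨U i, hU i⟩ = Ideal.span (S i) := by
  set J : X.IdealSheafData := ⨅ i, idealExtension (U i) (S i)
  have generators_mem (k : ι) (V : X.affineOpens) (h : V.1 ≤ U k) (a) (ha : a ∈ S k) :
      res h a ∈ J.ideal V := by
    refine (mem_iInf_idealExtension hU S V _).mpr fun i => ?_
    have := res_mem_span (inf_le_inf_left (U i) h) (hcompat i k a ha)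
    rwa [res_image_res_image, res_res, ← res_res h inf_le_right] at this
  have ideal_le_span (i : ι) : J.ideal ⟨U i, hU i⟩ ≤ Ideal.span (S i) := fun a ha => by
    have := res_mem_span (le_inf le_rfl le_rfl) ((mem_iInf_idealExtension hU S _ a).mp ha i)
    rwa [res_image_res_image, res_image_self, res_res, res_self] at this
  have span_le_ideal (I : X.IdealSheafData)
      (hI : ∀ (k : ι) (V : X.affineOpens) (h : V.1 ≤ U k), ∀ a ∈ S k, res h a ∈ I.ideal V)
      (i : ι) : Ideal.span (S i) ≤ I.ideal ⟨U i, hU i⟩ :=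
    Ideal.span_le.mpr fun a ha => res_self (le_refl (U i)) a ▸ hI i ⟨U i, hU i⟩ le_rfl a ha
  have hJ : idealGeneratedBy U S = J :=
    le_antisymm (sInf_le generators_mem) <| le_sInf fun I hI =>
      Scheme.IdealSheafData.le_of_iSup_eq_top (fun i => ⟨U i, hU i⟩) hcover
        fun i => (ideal_le_span i).trans (span_le_ideal I hI i)
  rw [hJ]
  exact le_antisymm (ideal_le_span i) (span_le_ideal J generators_mem i)

end IdealSheaves

/-! ### Cartier divisors and blow-ups -/

section BlowUps

variable {X X' Y B B' : Scheme.{0}}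

theorem res_mem_nonZeroDivisors {U : X.Opens} (hU : IsAffineOpen U) (b : Γ(X, U)) {a : Γ(X, U)}
    (ha : a ∈ nonZeroDivisors Γ(X, U)) :
    res (X.basicOpen_le b) a ∈ nonZeroDivisors Γ(X, X.basicOpen b) := by
  have := hU.isLocalization_basicOpen b
  exact IsLocalization.map_nonZeroDivisors_le (Submonoid.powers b) Γ(X, X.basicOpen b)
    (Submonoid.mem_map_of_mem _ ha)

theorem map_mem_nonZeroDivisors_of_bijective {R S : Type*} [CommRing R] [CommRing S]
    {φ : R →+* S} (hφ : Function.Bijective φ) {a : R} (ha : a ∈ nonZeroDivisors R) :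
    φ a ∈ nonZeroDivisors S :=
  let e := RingEquiv.ofBijective φ hφ
  mem_nonZeroDivisors_of_injective e.symm.injective ((e.symm_apply_apply a).symm ▸ ha)

theorem IsCartier.exists_le {K : X.IdealSheafData} (hK : IsCartier K) {x : X} {W : X.Opens}
    (hx : x ∈ W) :
    ∃ (V : X.Opens) (hV : IsAffineOpen V), x ∈ V ∧ V ≤ W ∧
      ∃ a ∈ nonZeroDivisors Γ(X, V), K.ideal ⟨V, hV⟩ = Ideal.span {a} := by
  obtain ⟨⟨U, hU⟩, hxU, a, ha, hKa⟩ := hK x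
  obtain ⟨b, hb, hxb⟩ := hU.exists_basicOpen_le ⟨x, hx⟩ hxU
  refine ⟨X.basicOpen b, hU.basicOpen b, hxb, hb, res (X.basicOpen_le b) a,
    res_mem_nonZeroDivisors hU b ha, ?_⟩
  rw [ideal_eq_map_res K (U := ⟨U, hU⟩) (V := ⟨X.basicOpen b, hU.basicOpen b⟩)
    (X.basicOpen_le b), hKa, Ideal.map_span, Set.image_singleton]

theorem IsCartier.comap_isOpenImmersion {K : X.IdealSheafData} (hK : IsCartier K) (j : Y ⟶ X)
    [IsOpenImmersion j] : IsCartier (K.comap j) := fun y => by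
  obtain ⟨V, hV, hyV, hVj, a, ha, hKa⟩ := hK.exists_le (W := j.opensRange) ⟨y, rfl⟩
  have hA : IsAffineOpen (j ⁻¹ᵁ V) := hV.preimage_of_isOpenImmersion j hVj
  refine ⟨⟨_, hA⟩, hyV, pull j le_rfl a,
    map_mem_nonZeroDivisors_of_bijective (pull_bijective j hVj le_rfl le_rfl) ha, ?_⟩
  rw [ideal_comap K j hA hV le_rfl, hKa, Ideal.map_span, Set.image_singleton]

theorem IsBlowUp.of_locally {I : X.IdealSheafData} {π : B ⟶ X} (hcartier : IsCartier (I.comap π))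
    (hunique : ∀ (T : Scheme.{0}) (f : T ⟶ X), IsCartier (I.comap f) →
      ∀ g g' : T ⟶ B, g ≫ π = f → g' ≫ π = f → g = g')
    (hexists : ∀ (T : Scheme.{0}) (f : T ⟶ X), IsCartier (I.comap f) → ∀ t : T,
      ∃ (W : T.Opens) (_ : t ∈ W) (z : W.toScheme ⟶ B), z ≫ π = W.ι ≫ f) : IsBlowUp I π where
  cartier := hcartier
  universal T f hf := by
    obtain ⟨g, hg⟩ := exists_lift_of_locally (hexists T f hf) fun S j _ z z' hz hz' =>
      hunique S (j ≫ f)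
        (I.comap_comp j f ▸ hf.comap_isOpenImmersion j) z z' hz hz'
    exact ⟨g, hg, fun g' hg' => hunique T f hf g' g hg' hg⟩

theorem IsBlowUp.comp_iso {I : X.IdealSheafData} {π : B ⟶ X} (h : IsBlowUp I π) (e : X ≅ X') :
    IsBlowUp (I.comap e.inv) (π ≫ e.hom) where
  cartier := by
    rw [← Scheme.IdealSheafData.comap_comp, Category.assoc, e.hom_inv_id, Category.comp_id]
    exact h.cartier
  universal T f hf := by
    rw [← Scheme.IdealSheafData.comap_comp] at hf
    simpa only [← Category.assoc, ← Iso.eq_comp_inv] using h.universal T (f ≫ e.inv) hf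

theorem IsBlowUp.exists_iso {I : X.IdealSheafData} {π : B ⟶ X} {π' : B' ⟶ X}
    (h : IsBlowUp I π) (h' : IsBlowUp I π') : ∃ e : B ≅ B', e.hom ≫ π' = π := by
  obtain ⟨a, ha, -⟩ := h'.universal B π h.cartier
  obtain ⟨b, hb, -⟩ := h.universal B' π' h'.cartier
  refine ⟨⟨a, b, ?_, ?_⟩, ha⟩
  · exact (h.universal B π h.cartier).unique (by rw [Category.assoc, hb, ha])
      (Category.id_comp _)
  · exact (h'.universal B' π' h'.cartier).unique (by rw [Category.assoc, ha, hb])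
      (Category.id_comp _)

end BlowUps

/-! ### Points of projective space -/

section Charts

variable {n : ℕ} {T : Scheme.{0}}

/-- The ring of functions on the chart `xⱼ ≠ 0`, that is, the homogeneous localization of
`ℂ[x₀, …, xₙ]` at `xⱼ`. -/
abbrev ChartRing (n : ℕ) (j : Fin (n + 1)) : Type :=
  HomogeneousLocalization.Away (grading n) (MvPolynomial.X j)

/-- The localization `ℂ[x₀, …, xₙ]` at `xⱼ`, of which `ChartRing n j` is the part of degree `0`. -/
abbrev ChartLocalization (n : ℕ) (j : Fin (n + 1)) : Type :=
  Localization.Away (MvPolynomial.X j : MvPolynomial (Fin (n + 1)) ℂ)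

/-- The open immersion of the chart `xⱼ ≠ 0`, as an affine scheme. -/
def chartι (n : ℕ) (j : Fin (n + 1)) : Spec (.of (ChartRing n j)) ⟶ PP n :=
  Proj.awayι (grading n) (MvPolynomial.X j) (X_mem n j) one_pos

instance (n : ℕ) (j : Fin (n + 1)) : IsOpenImmersion (chartι n j) :=
  inferInstanceAs (IsOpenImmersion (Proj.awayι _ _ _ _))

theorem opensRange_chartι (n : ℕ) (j : Fin (n + 1)) : (chartι n j).opensRange = chart n j :=
  Proj.opensRange_awayι _ _ _ _

theorem isAffineOpen_chart (n : ℕ) (j : Fin (n + 1)) : IsAffineOpen (chart n j) :=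
  Proj.isAffineOpen_basicOpen _ _ (X_mem n j) one_pos

theorem le_chartι_preimage (n : ℕ) (j : Fin (n + 1)) : ⊤ ≤ chartι n j ⁻¹ᵁ chart n j :=
  fun x _ => opensRange_chartι n j ▸ ⟨x, rfl⟩

theorem pull_chartι (j : Fin (n + 1)) (z : ChartRing n j) :
    pull (chartι n j) (le_chartι_preimage n j) ((Proj.awayToSection (grading n) _).hom z) =
      specFun (.of (ChartRing n j)) z := by
  let e := Proj.basicOpenIsoSpec (grading n) (MvPolynomial.X j) (X_mem n j) one_pos
  have pull_specFun : pull e.hom (le_preimage_top _ ⊤) (specFun (.of (ChartRing n j)) z) =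
      pull (chart n j).ι (le_ι_preimage _) ((Proj.awayToSection (grading n) _).hom z) := by
    have hι : (chart n j).ι.appLE (chart n j) ⊤ (le_ι_preimage _) = (chart n j).topIso.inv := by
      rw [Scheme.Hom.appLE, Scheme.Opens.topIso_inv, Scheme.Opens.ι_app]
      exact ((PP n).presheaf.map_comp _ _).symm
    rw [pull, pull, hι, appLE_top]
    exact congrArg (fun φ => φ.hom z) ((Iso.inv_comp_eq _).mpr
      (Proj.basicOpenToSpec_app_top (grading n) (MvPolynomial.X j)))
  calc
    _ = pull e.inv (le_preimage_top e.inv ⊤) (pull (chart n j).ι (le_ι_preimage _)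
          ((Proj.awayToSection (grading n) _).hom z)) := (pull_pull e.inv _ _ _ _).symm
    _ = pull e.inv (le_preimage_top e.inv ⊤)
          (pull e.hom (le_preimage_top _ ⊤) (specFun (.of (ChartRing n j)) z)) := by
      rw [pull_specFun]
    _ = _ := by
      rw [pull_pull, pull_congr e.inv_hom_id _ (le_preimage_top _ ⊤), pull_id, res_self]

/-- The scalars `ℂ` in the ring of functions on the chart `xⱼ ≠ 0`. -/
def chartScalar (n : ℕ) (j : Fin (n + 1)) : ℂ →+* ChartRing n j :=
  (HomogeneousLocalization.fromZeroRingHom (grading n) _).comp (algebraMap ℂ (grading n 0))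

theorem chartι_over (j : Fin (n + 1)) :
    chartι n j ≫ (PP n ↘ Spec (.of ℂ)) = Spec.map (CommRingCat.ofHom (chartScalar n j)) := by
  change Proj.awayι _ _ _ _ ≫ Proj.toSpecZero (grading n) ≫ _ = _
  rw [Proj.awayι_toSpecZero_assoc, ← Spec.map_comp]
  rfl

theorem scalar_chartι (j : Fin (n + 1)) (c : ℂ) :
    scalar (chartι n j ≫ (PP n ↘ Spec (.of ℂ))) ⊤ c =
      specFun (.of (ChartRing n j)) (chartScalar n j c) := by
  rw [chartι_over]
  exact scalar_specMap (R := .of (ChartRing n j)) (chartScalar n j) c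

/-- The element `xₚ / xⱼ` of the ring of functions on the chart `xⱼ ≠ 0`. -/
def chartRatio (n : ℕ) (p j : Fin (n + 1)) : ChartRing n j :=
  HomogeneousLocalization.Away.mk (grading n) (X_mem n j) 1 (MvPolynomial.X p) (X_mem n p)

theorem pull_chartι_ratio (p j : Fin (n + 1)) :
    pull (chartι n j) (le_chartι_preimage n j) (ratio n p j) =
      specFun (.of (ChartRing n j)) (chartRatio n p j) :=
  pull_chartι j (chartRatio n p j)

theorem val_chartRatio_mul (p j : Fin (n + 1)) :
    (chartRatio n p j).val * algebraMap (MvPolynomial (Fin (n + 1)) ℂ) (ChartLocalization n j)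
      (MvPolynomial.X j) = algebraMap (MvPolynomial (Fin (n + 1)) ℂ) _ (MvPolynomial.X p) := by
  rw [chartRatio, HomogeneousLocalization.Away.val_mk,
    ← Localization.mk_one_eq_algebraMap, ← Localization.mk_one_eq_algebraMap, Localization.mk_mul,
    Localization.mk_eq_mk_iff, Localization.r_iff_exists]
  exact ⟨1, by simp [mul_comm]⟩

theorem val_chartScalar (j : Fin (n + 1)) (c : ℂ) :
    (chartScalar n j c).val =
      algebraMap (MvPolynomial (Fin (n + 1)) ℂ) (ChartLocalization n j) (MvPolynomial.C c) := by
  rw [← Localization.mk_one_eq_algebraMap]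
  rfl

theorem exists_chartRing_hom (j : Fin (n + 1)) {R : Type*} [CommRing R] (σ : ℂ →+* R)
    {u : Fin (n + 1) → R} (hu : u j = 1) :
    ∃ φ : ChartRing n j →+* R,
      (∀ c, φ (chartScalar n j c) = σ c) ∧ ∀ p, φ (chartRatio n p j) = u p := by
  let ψ : MvPolynomial (Fin (n + 1)) ℂ →+* R := MvPolynomial.eval₂Hom σ u
  have hψ : ψ (MvPolynomial.X j) = 1 := by simp [ψ, hu]
  let θ : ChartLocalization n j →+* R :=
    IsLocalization.Away.lift (MvPolynomial.X j) (g := ψ) (hψ ▸ isUnit_one)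
  have hθ p : θ (algebraMap _ _ p) = ψ p := IsLocalization.Away.lift_eq _ _ _
  refine ⟨θ.comp (algebraMap _ _), fun c => ?_, fun p => ?_⟩
  · rw [RingHom.comp_apply, HomogeneousLocalization.algebraMap_apply, val_chartScalar, hθ]
    exact MvPolynomial.eval₂Hom_C σ u c
  · have h := congrArg θ (val_chartRatio_mul p j)
    rw [map_mul, hθ, hθ, hψ, mul_one] at h
    exact h.trans (MvPolynomial.eval₂Hom_X' σ u p)

theorem eval₂_mul_of_isHomogeneous {σ R S : Type*} [CommSemiring R] [CommSemiring S] {d : ℕ}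
    {p : MvPolynomial σ R} (hp : p.IsHomogeneous d) (f : R →+* S) (u : σ → S) (r : S) :
    p.eval₂ f (fun i => u i * r) = p.eval₂ f u * r ^ d := by
  rw [MvPolynomial.eval₂_eq, MvPolynomial.eval₂_eq, Finset.sum_mul]
  refine Finset.sum_congr rfl fun e he => ?_
  rw [hp.degree_eq_sum_deg_support he, mul_assoc, ← Finset.prod_pow_eq_pow_sum,
    ← Finset.prod_mul_distrib]
  simp only [mul_pow]

/-- The dehomogenization `p ↦ p(x₀ / xⱼ, …, xₙ / xⱼ)`. -/
def dehomogenize (n : ℕ) (j : Fin (n + 1)) : MvPolynomial (Fin (n + 1)) ℂ →+* ChartRing n j :=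
  MvPolynomial.eval₂Hom (chartScalar n j) fun p => chartRatio n p j

theorem val_dehomogenize_mul (j : Fin (n + 1)) {d : ℕ}
    {p : MvPolynomial (Fin (n + 1)) ℂ} (hp : p.IsHomogeneous d) :
    (dehomogenize n j p).val * algebraMap (MvPolynomial (Fin (n + 1)) ℂ) (ChartLocalization n j)
      (MvPolynomial.X j ^ d) = algebraMap (MvPolynomial (Fin (n + 1)) ℂ) _ p := by
  let ι := algebraMap (MvPolynomial (Fin (n + 1)) ℂ) (ChartLocalization n j)
  let κ := algebraMap (ChartRing n j) (ChartLocalization n j)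
  have hscalar : κ.comp (chartScalar n j) = ι.comp MvPolynomial.C :=
    RingHom.ext (val_chartScalar j)
  calc
    κ (dehomogenize n j p) * ι (MvPolynomial.X j ^ d)
      = p.eval₂ (ι.comp MvPolynomial.C) (fun q => κ (chartRatio n q j)) *
          ι (MvPolynomial.X j) ^ d := by
      rw [dehomogenize, MvPolynomial.coe_eval₂Hom, MvPolynomial.hom_eval₂, hscalar, map_pow]
    _ = p.eval₂ (ι.comp MvPolynomial.C) (fun q => ι (MvPolynomial.X q)) := by
      rw [← eval₂_mul_of_isHomogeneous hp]
      exact congrArg (fun u => p.eval₂ (ι.comp MvPolynomial.C) u)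
        (funext fun q => val_chartRatio_mul q j)
    _ = ι p := by
      refine (MvPolynomial.hom_eval₂ p MvPolynomial.C ι MvPolynomial.X).symm.trans ?_
      rw [MvPolynomial.eval₂_eta]

theorem dehomogenize_surjective (j : Fin (n + 1)) : Function.Surjective (dehomogenize n j) := by
  intro z
  obtain ⟨d, p, hp, rfl⟩ := HomogeneousLocalization.Away.mk_surjective (grading n) (X_mem n j) z
  refine ⟨p, HomogeneousLocalization.val_injective _ ?_⟩
  have hunit : IsUnit (algebraMap (MvPolynomial (Fin (n + 1)) ℂ) (ChartLocalization n j)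
      (MvPolynomial.X j ^ d)) := by
    rw [map_pow]
    exact (IsLocalization.Away.algebraMap_isUnit _).pow d
  have hp' : p.IsHomogeneous d := by simpa using hp
  rw [← hunit.mul_left_inj, val_dehomogenize_mul j hp', HomogeneousLocalization.Away.val_mk,
    ← Localization.mk_one_eq_algebraMap, ← Localization.mk_one_eq_algebraMap,
    Localization.mk_mul, Localization.mk_eq_mk_iff, Localization.r_iff_exists]
  exact ⟨1, by simp [mul_comm]⟩

theorem chartRing_hom_ext {j : Fin (n + 1)} {R : Type*} [CommRing R] {φ ψ : ChartRing n j →+* R}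
    (hscalar : ∀ c, φ (chartScalar n j c) = ψ (chartScalar n j c))
    (hratio : ∀ p, φ (chartRatio n p j) = ψ (chartRatio n p j)) : φ = ψ := by
  have h : φ.comp (dehomogenize n j) = ψ.comp (dehomogenize n j) :=
    MvPolynomial.ringHom_ext (by simpa [dehomogenize] using hscalar)
      (by simpa [dehomogenize] using hratio)
  exact (RingHom.cancel_right (dehomogenize_surjective j)).mp h

theorem exists_hom_of_ratios (τ : T ⟶ Spec (.of ℂ)) (j : Fin (n + 1))
    {u : Fin (n + 1) → Γ(T, ⊤)} (hu : u j = 1) :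
    ∃ f : T ⟶ PP n, f ≫ (PP n ↘ Spec (.of ℂ)) = τ ∧
      ∃ h : ⊤ ≤ f ⁻¹ᵁ chart n j, ∀ p, pull f h (ratio n p j) = u p := by
  obtain ⟨φ, hscalar, hratio⟩ := exists_chartRing_hom j (scalar τ ⊤) hu
  obtain ⟨b, hb⟩ := exists_hom_Spec (R := .of (ChartRing n j)) φ
  have htop := le_preimage_top b ⊤
  refine ⟨b ≫ chartι n j, hom_Spec_complex_ext fun c => ?_,
    htop.trans (Scheme.Hom.preimage_mono b (le_chartι_preimage n j)), fun p => ?_⟩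
  · rw [Category.assoc, ← pull_scalar b _ htop, scalar_chartι, hb, hscalar]
  · rw [← pull_pull b (chartι n j) (le_chartι_preimage n j) htop, pull_chartι_ratio, hb, hratio]

theorem exists_chartι_factor {j : Fin (n + 1)} {f : T ⟶ PP n} (hf : ⊤ ≤ f ⁻¹ᵁ chart n j) :
    ∃ g : T ⟶ Spec (.of (ChartRing n j)), g ≫ chartι n j = f := by
  refine ⟨IsOpenImmersion.lift (chartι n j) f ?_, IsOpenImmersion.lift_fac _ _ _⟩
  rintro _ ⟨t, rfl⟩
  have ht : f t ∈ (chartι n j).opensRange := opensRange_chartι n j ▸ hf (Set.mem_univ t)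
  exact ht

theorem hom_ext_of_ratios {f g : T ⟶ PP n} (j : Fin (n + 1))
    (hover : f ≫ (PP n ↘ Spec (.of ℂ)) = g ≫ (PP n ↘ Spec (.of ℂ)))
    (hf : ⊤ ≤ f ⁻¹ᵁ chart n j) (hg : ⊤ ≤ g ⁻¹ᵁ chart n j)
    (h : ∀ p, pull f hf (ratio n p j) = pull g hg (ratio n p j)) : f = g := by
  obtain ⟨f, rfl⟩ := exists_chartι_factor hf
  obtain ⟨g, rfl⟩ := exists_chartι_factor hg
  let φ (k : T ⟶ Spec (.of (ChartRing n j))) : ChartRing n j →+* Γ(T, ⊤) :=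
    (pull k (le_preimage_top k ⊤)).comp (specFun (.of (ChartRing n j)))
  have hscalar k (c : ℂ) :
      φ k (chartScalar n j c) = scalar (k ≫ chartι n j ≫ (PP n ↘ Spec (.of ℂ))) ⊤ c :=
    (congrArg _ (scalar_chartι j c)).symm.trans (pull_scalar k _ _ c)
  have hratio k (hk : ⊤ ≤ (k ≫ chartι n j) ⁻¹ᵁ chart n j) (p : Fin (n + 1)) :
      φ k (chartRatio n p j) = pull (k ≫ chartι n j) hk (ratio n p j) :=
    (congrArg _ (pull_chartι_ratio p j)).symm.trans (pull_pull k _ _ _ _)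
  have hφ : φ f = φ g := by
    refine chartRing_hom_ext (fun c => ?_) fun p => ?_
    · rw [hscalar, hscalar, ← Category.assoc, hover, Category.assoc]
    · rw [hratio f hf, hratio g hg, h]
  exact congrArg (· ≫ chartι n j) (hom_Spec_ext (RingHom.congr_fun hφ))

theorem le_chart_of_isUnit {i j : Fin (n + 1)} {V : (PP n).Opens} (h : V ≤ chart n i)
    (hu : IsUnit (res h (ratio n j i))) : V ≤ chart n j := by
  intro x hx
  have := x.isPrime
  let r : HomogeneousLocalization.AtPrime (grading n) x.asHomogeneousIdeal.toIdeal :=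
    (res h (ratio n j i)).1 ⟨x, hx⟩
  have hr : IsUnit r := by
    obtain ⟨b, hb⟩ := hu.exists_right_inv
    exact IsUnit.of_mul_eq_one (b.1 ⟨x, hx⟩) (congrArg (fun s => s.1 ⟨x, hx⟩) hb)
  have hval : r.val = Localization.mk (MvPolynomial.X j) (⟨MvPolynomial.X i ^ 1,
      fun hb => h hx (by simpa using hb)⟩ : x.asHomogeneousIdeal.toIdeal.primeCompl) := rfl
  rwa [← HomogeneousLocalization.isUnit_iff_isUnit_val, hval, Localization.mk_eq_mk',
    IsLocalization.AtPrime.isUnit_mk'_iff _ x.asHomogeneousIdeal.toIdeal] at hr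

end Charts

/-! ### Linear forms at a point of projective space -/

/-- The coordinates `xₚ / xⱼ` of a point of `ℙⁿ` in the chart `xⱼ ≠ 0`. -/
def coord {n : ℕ} {T : Scheme.{0}} (f : T ⟶ PP n) {V : T.Opens} {j : Fin (n + 1)}
    (h : V ≤ f ⁻¹ᵁ chart n j) (p : Fin (n + 1)) : Γ(T, V) :=
  pull f h (ratio n p j)

/-- The values of the linear forms with coefficients `A` at a point of `ℙⁿ`, divided by `xⱼ`. -/
def formValues {n : ℕ} {κ : Type*} (A : Matrix κ (Fin (n + 1)) ℂ) {T : Scheme.{0}}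
    (f : T ⟶ PP n) {V : T.Opens} {j : Fin (n + 1)} (h : V ≤ f ⁻¹ᵁ chart n j) : κ → Γ(T, V) :=
  (A.map (scalar (f ≫ (PP n ↘ Spec (.of ℂ))) V)).mulVec (coord f h)

section Coordinates

variable {n : ℕ} {κ : Type*} {T T' : Scheme.{0}} (f : T ⟶ PP n) {V W : T.Opens}
  {i j : Fin (n + 1)} (A : Matrix κ (Fin (n + 1)) ℂ)

theorem coord_self (h : V ≤ f ⁻¹ᵁ chart n j) : coord f h j = 1 := by
  rw [coord, ratio_self, map_one]

theorem res_coord (h : V ≤ f ⁻¹ᵁ chart n j) (hW : W ≤ V) (p : Fin (n + 1)) :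
    res hW (coord f h p) = coord f (hW.trans h) p :=
  res_pull f h hW _

theorem pull_coord (g : T' ⟶ T) {W : T'.Opens} (h : V ≤ f ⁻¹ᵁ chart n j) (hW : W ≤ g ⁻¹ᵁ V)
    (p : Fin (n + 1)) :
    pull g hW (coord f h p) =
      coord (g ≫ f) (hW.trans (Scheme.Hom.preimage_mono g h) : W ≤ (g ≫ f) ⁻¹ᵁ chart n j) p :=
  pull_pull g f h hW _

variable {f} in
theorem coord_congr {g : T ⟶ PP n} (e : f = g) (h : V ≤ f ⁻¹ᵁ chart n j)
    (h' : V ≤ g ⁻¹ᵁ chart n j) (p : Fin (n + 1)) : coord f h p = coord g h' p :=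
  pull_congr e h h' _

theorem coord_mul_coord (hi : V ≤ f ⁻¹ᵁ chart n i) (hj : V ≤ f ⁻¹ᵁ chart n j)
    (p : Fin (n + 1)) : coord f hi j * coord f hj p = coord f hi p := by
  have h : V ≤ f ⁻¹ᵁ (chart n i ⊓ chart n j) := fun x hx => ⟨hi hx, hj hx⟩
  have hratio := congrArg (pull f h) (ratio_mul_ratio n i j p inf_le_left inf_le_right)
  rwa [map_mul, pull_res, pull_res, pull_res] at hratio

theorem le_preimage_chart_of_isUnit (h : V ≤ f ⁻¹ᵁ chart n i) (hu : IsUnit (coord f h j)) :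
    V ≤ f ⁻¹ᵁ chart n j :=
  calc
    V = T.basicOpen (coord f h j) := (T.basicOpen_of_isUnit hu).symm
    _ = V ⊓ f ⁻¹ᵁ (PP n).basicOpen (ratio n j i) := Scheme.basicOpen_appLE f V _ h _
    _ ≤ f ⁻¹ᵁ (PP n).basicOpen (ratio n j i) := inf_le_right
    _ ≤ f ⁻¹ᵁ chart n j := Scheme.Hom.preimage_mono f <|
      le_chart_of_isUnit ((PP n).basicOpen_le _) (RingedSpace.isUnit_res_basicOpen _ (ratio n j i))

variable {f} in
theorem hom_ext_of_coord {g : T ⟶ PP n}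
    (hover : f ≫ (PP n ↘ Spec (.of ℂ)) = g ≫ (PP n ↘ Spec (.of ℂ)))
    (hf : V ≤ f ⁻¹ᵁ chart n j) (hg : V ≤ g ⁻¹ᵁ chart n j)
    (h : ∀ p, coord f hf p = coord g hg p) : V.ι ≫ f = V.ι ≫ g := by
  refine hom_ext_of_ratios j (by rw [Category.assoc, Category.assoc, hover])
    ((le_ι_preimage V).trans (Scheme.Hom.preimage_mono _ hf))
    ((le_ι_preimage V).trans (Scheme.Hom.preimage_mono _ hg)) fun p => ?_
  have hp := congrArg (pull V.ι (le_ι_preimage V)) (h p)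
  rwa [pull_coord, pull_coord] at hp

theorem exists_mem_chart (t : T) : ∃ j, t ∈ f ⁻¹ᵁ chart n j :=
  TopologicalSpace.Opens.mem_iSup (x := f t).mp
    (iSup_chart n ▸ TopologicalSpace.Opens.mem_top _)

theorem res_formValues (h : V ≤ f ⁻¹ᵁ chart n j) (hW : W ≤ V) (q : κ) :
    res hW (formValues A f h q) = formValues A f (hW.trans h) q := by
  simp only [formValues, Matrix.mulVec, dotProduct, Matrix.map_apply, map_sum, map_mul, res_scalar,
    res_coord]

theorem pull_formValues (g : T' ⟶ T) {W : T'.Opens} (h : V ≤ f ⁻¹ᵁ chart n j) (hW : W ≤ g ⁻¹ᵁ V)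
    (q : κ) :
    pull g hW (formValues A f h q) = formValues A (g ≫ f)
      (hW.trans (Scheme.Hom.preimage_mono g h) : W ≤ (g ≫ f) ⁻¹ᵁ chart n j) q := by
  simp only [formValues, Matrix.mulVec, dotProduct, Matrix.map_apply, map_sum, map_mul,
    pull_scalar, pull_coord, Category.assoc]

variable {f} in
theorem formValues_congr {g : T ⟶ PP n} (e : f = g) (h : V ≤ f ⁻¹ᵁ chart n j)
    (h' : V ≤ g ⁻¹ᵁ chart n j) (q : κ) : formValues A f h q = formValues A g h' q := by
  subst e
  rfl

theorem coord_mul_formValues (hi : V ≤ f ⁻¹ᵁ chart n i) (hj : V ≤ f ⁻¹ᵁ chart n j) (q : κ) :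
    coord f hi j * formValues A f hj q = formValues A f hi q := by
  simp only [formValues, Matrix.mulVec, dotProduct, Matrix.map_apply, Finset.mul_sum]
  refine Finset.sum_congr rfl fun p _ => ?_
  rw [mul_left_comm, coord_mul_coord]

theorem formValues_one (h : V ≤ f ⁻¹ᵁ chart n j) : formValues 1 f h = coord f h := by
  rw [formValues, Matrix.map_one _ (map_zero _) (map_one _), Matrix.one_mulVec]

end Coordinates

/-! ### The ideal of a linear subspace -/

section LinearSubspaces

variable {n : ℕ} {κ : Type*}

instance : (PP n).IsSeparated := inferInstanceAs (Scheme.IsSeparated (Proj _))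

instance : IsSeparated (PP n ↘ Spec (.of ℂ)) :=
  inferInstanceAs (IsSeparated (Proj.toSpecZero (grading n) ≫ Spec.map _))

theorem sum_smul_ratio (j : Fin (n + 1)) (c : Fin (n + 1) → ℂ) :
    ∑ p, c p • ratio n p j = ∑ p, scalar (PP n ↘ Spec (.of ℂ)) (chart n j) (c p) * ratio n p j :=
  Finset.sum_congr rfl fun _ _ => smul_eq_scalar_mul _ _

theorem res_sum_smul_ratio (i k : Fin (n + 1)) (c : Fin (n + 1) → ℂ) :
    res (inf_le_right : chart n i ⊓ chart n k ≤ chart n k) (∑ p, c p • ratio n p k) =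
      res inf_le_right (ratio n i k) *
        res (inf_le_left : chart n i ⊓ chart n k ≤ chart n i) (∑ p, c p • ratio n p i) := by
  rw [sum_smul_ratio, sum_smul_ratio, map_sum, map_sum, Finset.mul_sum]
  refine Finset.sum_congr rfl fun p _ => ?_
  rw [map_mul, map_mul, res_scalar, res_scalar, mul_left_comm, ratio_mul_ratio]

theorem ideal_linearSubspaceIdeal (L : Submodule ℂ (Fin (n + 1) → ℂ)) (j : Fin (n + 1)) :
    (linearSubspaceIdeal n L).ideal ⟨chart n j, isAffineOpen_chart n j⟩ = Ideal.span
      {a | ∃ ℓ ∈ L.dualAnnihilator, a = ∑ p, ℓ (Pi.single p 1) • ratio n p j} := by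
  refine ideal_idealGeneratedBy (isAffineOpen_chart n) (iSup_chart n) ?_ j
  rintro i k _ ⟨ℓ, hℓ, rfl⟩
  rw [res_sum_smul_ratio]
  exact Ideal.mul_mem_left _ _ (Ideal.subset_span ⟨_, ⟨ℓ, hℓ, rfl⟩, rfl⟩)

theorem dualMap_mulVecLin_single {R ι : Type*} [CommRing R] [Fintype ι] [DecidableEq ι]
    [Fintype κ] [DecidableEq κ] (A : Matrix κ ι R) (ℓ : Module.Dual R (κ → R)) (p : ι) :
    A.mulVecLin.dualMap ℓ (Pi.single p 1) = ∑ q, ℓ (Pi.single q 1) * A q p := by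
  rw [LinearMap.dualMap_apply, Matrix.mulVecLin_apply, Matrix.mulVec_single_one,
    pi_eq_sum_univ' (A.col p), map_sum]
  exact Finset.sum_congr rfl fun q _ => by rw [map_smul, smul_eq_mul, mul_comm, Matrix.col_apply]

variable [Finite κ]

theorem ideal_linearSubspaceIdeal_ker (A : Matrix κ (Fin (n + 1)) ℂ) (j : Fin (n + 1)) :
    (linearSubspaceIdeal n (LinearMap.ker A.mulVecLin)).ideal
      ⟨chart n j, isAffineOpen_chart n j⟩ =
      Ideal.span (Set.range fun q => ∑ p, A q p • ratio n p j) := by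
  classical
  have := Fintype.ofFinite κ
  rw [ideal_linearSubspaceIdeal, ← LinearMap.range_dualMap_eq_dualAnnihilator_ker]
  apply le_antisymm <;> rw [Ideal.span_le]
  · rintro _ ⟨_, ⟨ℓ, rfl⟩, rfl⟩
    have hℓ : ∑ p, A.mulVecLin.dualMap ℓ (Pi.single p 1) • ratio n p j =
        ∑ q, ℓ (Pi.single q 1) • ∑ p, A q p • ratio n p j := by
      simp only [dualMap_mulVecLin_single, Finset.sum_smul, Finset.smul_sum, smul_smul]
      exact Finset.sum_comm
    rw [hℓ]
    refine Ideal.sum_mem _ fun q _ => ?_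
    rw [smul_eq_scalar_mul]
    exact Ideal.mul_mem_left _ _ (Ideal.subset_span ⟨q, rfl⟩)
  · rintro _ ⟨q, rfl⟩
    refine Ideal.subset_span ⟨_, ⟨LinearMap.proj q, rfl⟩, Finset.sum_congr rfl fun p _ => ?_⟩
    simp

theorem ideal_comap_ker (A : Matrix κ (Fin (n + 1)) ℂ) {T : Scheme.{0}}
    (f : T ⟶ PP n) {V : T.Opens} (hV : IsAffineOpen V) {j : Fin (n + 1)}
    (h : V ≤ f ⁻¹ᵁ chart n j) :
    ((linearSubspaceIdeal n (LinearMap.ker A.mulVecLin)).comap f).ideal ⟨V, hV⟩ =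
      Ideal.span (Set.range (formValues A f h)) := by
  have hforms : formValues A f h = pull f h ∘ fun q => ∑ p, A q p • ratio n p j := by
    ext q
    simp only [Function.comp_apply, sum_smul_ratio, map_sum, map_mul, pull_scalar, formValues,
      Matrix.mulVec, dotProduct, Matrix.map_apply, coord]
  rw [ideal_comap _ f hV (isAffineOpen_chart n j) h, ideal_linearSubspaceIdeal_ker,
    Ideal.map_span, ← Set.range_comp, hforms]

end LinearSubspaces

/-! ### Sections of vector bundles and their zero loci -/

theorem isAffineOpen_fst_preimage_inf_snd_preimage {X Y S : Scheme.{0}} [IsAffine S] (f : X ⟶ S)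
    (g : Y ⟶ S) {U : X.Opens} {V : Y.Opens} (hU : IsAffineOpen U) (hV : IsAffineOpen V) :
    IsAffineOpen (Limits.pullback.fst f g ⁻¹ᵁ U ⊓ Limits.pullback.snd f g ⁻¹ᵁ V) := by
  have : IsAffine U.toScheme := hU
  have : IsAffine V.toScheme := hV
  let e := Limits.pullback.map (U.ι ≫ f) (V.ι ≫ g) f g U.ι V.ι (𝟙 S) (by simp) (by simp)
  have he : e.opensRange = Limits.pullback.fst f g ⁻¹ᵁ U ⊓ Limits.pullback.snd f g ⁻¹ᵁ V :=
    TopologicalSpace.Opens.ext (by simp [e, Scheme.Pullback.range_map])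
  exact he ▸ isAffineOpen_opensRange e

section Subscheme

variable {X T : Scheme.{0}} {I : X.IdealSheafData}

theorem pull_subschemeι_eq_zero {U : X.Opens} (hU : IsAffineOpen U) {a : Γ(X, U)}
    (ha : a ∈ I.ideal ⟨U, hU⟩) : pull I.subschemeι le_rfl a = 0 := by
  rw [← I.ker_subschemeι_app, RingHom.mem_ker] at ha
  rwa [pull, Scheme.Hom.appLE_eq_app]

theorem pull_comp_subschemeι_eq_zero (z : T ⟶ I.subscheme) {U : X.Opens} (hU : IsAffineOpen U)
    {V : T.Opens} (h : V ≤ (z ≫ I.subschemeι) ⁻¹ᵁ U) {a : Γ(X, U)} (ha : a ∈ I.ideal ⟨U, hU⟩) :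
    pull (z ≫ I.subschemeι) h a = 0 := by
  rw [← pull_pull z I.subschemeι le_rfl h, pull_subschemeι_eq_zero hU ha, map_zero]

theorem exists_lift_subscheme [X.IsSeparated] (k : T ⟶ X)
    (hk : ∀ t : T, ∃ (U : X.Opens) (hU : IsAffineOpen U) (V : T.Opens) (h : V ≤ k ⁻¹ᵁ U),
      t ∈ V ∧ I.ideal ⟨U, hU⟩ ≤ RingHom.ker (pull k h)) :
    ∃ z : T ⟶ I.subscheme, z ≫ I.subschemeι = k := by
  suffices hker : I.subschemeι.ker ≤ k.ker from
    ⟨IsClosedImmersion.lift _ k hker, IsClosedImmersion.lift_fac _ _ _⟩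
  rw [I.ker_subschemeι]
  refine Scheme.IdealSheafData.le_ofIdeals_iff.mpr fun W a ha => ?_
  suffices hzero : pull k (le_refl (k ⁻¹ᵁ W.1)) a = 0 by
    rwa [pull, Scheme.Hom.appLE_eq_app] at hzero
  refine section_ext fun t ht => ?_
  obtain ⟨U, hU, V, h, htV, hUV⟩ := hk t
  have hWU : IsAffineOpen (W.1 ⊓ U) := W.2.inf hU
  have hV : V ⊓ k ⁻¹ᵁ W.1 ≤ k ⁻¹ᵁ (W.1 ⊓ U) := fun x hx => ⟨hx.2, h hx.1⟩
  have hle : I.ideal ⟨W.1 ⊓ U, hWU⟩ ≤ RingHom.ker (pull k hV) := by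
    rw [ideal_eq_map_res I (U := ⟨U, hU⟩) (V := ⟨_, hWU⟩) inf_le_right, Ideal.map_le_iff_le_comap]
    intro b hb
    rw [Ideal.mem_comap, RingHom.mem_ker, pull_res, ← res_pull k h inf_le_left, hUV hb, map_zero]
  have hres := hle (res_mem_ideal I (U := W) (V := ⟨_, hWU⟩) inf_le_left ha)
  rw [RingHom.mem_ker, pull_res] at hres
  exact ⟨_, inf_le_right, ⟨htV, ht⟩, by rw [res_pull, hres, map_zero]⟩

end Subscheme

namespace VecBundle

variable {X : Scheme.{0}} [X.Over (Spec (.of ℂ))] {E : VecBundle X}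

theorem res_globalSection (s : E.globalSections) (a b : E.Idx) (c : E.Frame a) :
    res (inf_le_left : E.U a ⊓ E.U b ≤ E.U a) (s.1 a c) =
      ∑ d, E.g a b c d * res (inf_le_right : E.U a ⊓ E.U b ≤ E.U b) (s.1 b d) :=
  congrFun (s.2 a b) c

theorem ideal_zeroIdeal [X.IsSeparated] [Finite E.Idx] (hE : ∀ a, IsAffineOpen (E.U a))
    (s : E.globalSections) (a : E.Idx) :
    (E.zeroIdeal s).ideal ⟨E.U a, hE a⟩ = Ideal.span (Set.range (s.1 a)) := by
  refine ideal_idealGeneratedBy hE E.cover ?_ a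
  rintro a b _ ⟨c, rfl⟩
  have hswap : E.U a ⊓ E.U b ≤ E.U b ⊓ E.U a := le_inf inf_le_right inf_le_left
  have hres := congrArg (res hswap) (res_globalSection s b a c)
  rw [res_res, map_sum] at hres
  rw [hres]
  refine Ideal.sum_mem _ fun d _ => ?_
  rw [map_mul, res_res]
  exact Ideal.mul_mem_left _ _ (Ideal.subset_span ⟨_, ⟨d, rfl⟩, rfl⟩)

instance (s : E.globalSections) : IsClosedImmersion (E.zeroLocusι s) :=
  inferInstanceAs (IsClosedImmersion (E.zeroIdeal s).subschemeι)

end VecBundle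

/-! ### Sections of `Q(0,1)` -/

section MatrixSections

variable {m n : ℕ}

instance : IsSeparated (pr₁ m n) :=
  inferInstanceAs (IsSeparated (Limits.pullback.fst _ _))

instance : (PPprod m n).IsSeparated where
  isSeparated_terminal_from := by
    rw [← Limits.terminal.comp_from (pr₁ m n)]
    infer_instance

/-- The chart `yᵢ ≠ 0`, `xⱼ ≠ 0` of `ℙᵐ × ℙⁿ`. -/
abbrev prodChart (m n : ℕ) (i : Fin (m + 1)) (j : Fin (n + 1)) : (PPprod m n).Opens :=
  pr₁ m n ⁻¹ᵁ chart m i ⊓ pr₂ m n ⁻¹ᵁ chart n j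

theorem isAffineOpen_prodChart (i : Fin (m + 1)) (j : Fin (n + 1)) :
    IsAffineOpen (prodChart m n i j) :=
  isAffineOpen_fst_preimage_inf_snd_preimage _ _ (isAffineOpen_chart m i) (isAffineOpen_chart n j)

/-- The coordinates of a section of `Q(0,1)` on the chart `yᵢ ≠ 0`, `xⱼ ≠ 0`. -/
def localCoord (s : (Q01 m n).globalSections) (i : Fin (m + 1)) (j : Fin (n + 1))
    (q : {q : Fin (m + 1) // q ≠ i}) : Γ(PPprod m n, prodChart m n i j) :=
  s.1 (i, j) (q, ())

/-- The local coordinates of the section of `Q(0,1)` that maps `([y], [x])` to the class of `A x`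
modulo `y`. -/
def matrixCoord (A : Matrix (Fin (m + 1)) (Fin (n + 1)) ℂ) (i : Fin (m + 1)) (j : Fin (n + 1))
    (q : Fin (m + 1)) : Γ(PPprod m n, prodChart m n i j) :=
  formValues A (pr₂ m n) inf_le_right q -
    coord (pr₁ m n) inf_le_left q * formValues A (pr₂ m n) inf_le_right i

/-- The section `s` maps `([y], [x])` to the class of `A x` modulo `y`. -/
def IsMatrixSection (A : Matrix (Fin (m + 1)) (Fin (n + 1)) ℂ) (s : (Q01 m n).globalSections) :
    Prop :=
  ∀ i j q, localCoord s i j q = matrixCoord A i j q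

variable {A : Matrix (Fin (m + 1)) (Fin (n + 1)) ℂ} {s : (Q01 m n).globalSections}
  {T : Scheme.{0}} {i : Fin (m + 1)} {j : Fin (n + 1)}

theorem pull_matrixCoord (k : T ⟶ PPprod m n) {V : T.Opens}
    (h : V ≤ k ⁻¹ᵁ prodChart m n i j) (hi : V ≤ (k ≫ pr₁ m n) ⁻¹ᵁ chart m i)
    (hj : V ≤ (k ≫ pr₂ m n) ⁻¹ᵁ chart n j) (q : Fin (m + 1)) :
    pull k h (matrixCoord A i j q) = formValues A (k ≫ pr₂ m n) hj q -
      coord (k ≫ pr₁ m n) hi q * formValues A (k ≫ pr₂ m n) hj i := by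
  rw [matrixCoord, map_sub, map_mul, pull_formValues, pull_formValues, pull_coord]

theorem ideal_zeroIdeal_prodChart (s : (Q01 m n).globalSections) (i : Fin (m + 1))
    (j : Fin (n + 1)) :
    ((Q01 m n).zeroIdeal s).ideal ⟨prodChart m n i j, isAffineOpen_prodChart i j⟩ =
      Ideal.span (Set.range (localCoord s i j)) := by
  have : Finite (Q01 m n).Idx := inferInstanceAs (Finite (Fin (m + 1) × Fin (n + 1)))
  refine (VecBundle.ideal_zeroIdeal
    (fun a : Fin (m + 1) × Fin (n + 1) => isAffineOpen_prodChart a.1 a.2) s (i, j)).trans ?_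
  exact congrArg Ideal.span
    ((Equiv.prodPUnit {q : Fin (m + 1) // q ≠ i}).symm.surjective.range_comp (s.1 (i, j))).symm

theorem formValues_eq_coord_mul (hs : IsMatrixSection A s) (z : T ⟶ (Q01 m n).zeroLocus s)
    {k : T ⟶ PPprod m n} (hk : z ≫ (Q01 m n).zeroLocusι s = k) {V : T.Opens}
    (hi : V ≤ (k ≫ pr₁ m n) ⁻¹ᵁ chart m i) (hj : V ≤ (k ≫ pr₂ m n) ⁻¹ᵁ chart n j)
    (q : Fin (m + 1)) :
    formValues A (k ≫ pr₂ m n) hj q =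
      coord (k ≫ pr₁ m n) hi q * formValues A (k ≫ pr₂ m n) hj i := by
  obtain rfl | hq := eq_or_ne q i
  · rw [coord_self, one_mul]
  subst hk
  have hV : V ≤ (z ≫ (Q01 m n).zeroLocusι s) ⁻¹ᵁ prodChart m n i j := fun x hx => ⟨hi hx, hj hx⟩
  have hmem : localCoord s i j ⟨q, hq⟩ ∈
      ((Q01 m n).zeroIdeal s).ideal ⟨prodChart m n i j, isAffineOpen_prodChart i j⟩ :=
    ideal_zeroIdeal_prodChart s i j ▸ Ideal.subset_span ⟨_, rfl⟩
  have hzero : pull (z ≫ (Q01 m n).zeroLocusι s) hV (localCoord s i j ⟨q, hq⟩) = 0 :=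
    pull_comp_subschemeι_eq_zero z (isAffineOpen_prodChart i j) hV hmem
  rwa [hs, pull_matrixCoord _ hV hi hj, sub_eq_zero] at hzero

theorem exists_lift_zeroLocus (hs : IsMatrixSection A s) (k : T ⟶ PPprod m n)
    (hk : ∀ t : T, ∃ (V : T.Opens) (i : Fin (m + 1)) (j : Fin (n + 1))
      (hi : V ≤ (k ≫ pr₁ m n) ⁻¹ᵁ chart m i) (hj : V ≤ (k ≫ pr₂ m n) ⁻¹ᵁ chart n j), t ∈ V ∧
      ∀ q, formValues A (k ≫ pr₂ m n) hj q =
        coord (k ≫ pr₁ m n) hi q * formValues A (k ≫ pr₂ m n) hj i) :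
    ∃ z : T ⟶ (Q01 m n).zeroLocus s, z ≫ (Q01 m n).zeroLocusι s = k := by
  refine exists_lift_subscheme k fun t => ?_
  obtain ⟨V, i, j, hi, hj, htV, hq⟩ := hk t
  have hV : V ≤ k ⁻¹ᵁ prodChart m n i j := fun x hx => ⟨hi hx, hj hx⟩
  refine ⟨prodChart m n i j, isAffineOpen_prodChart i j, V, hV, htV, ?_⟩
  rw [ideal_zeroIdeal_prodChart, Ideal.span_le]
  rintro _ ⟨q, rfl⟩
  rw [SetLike.mem_coe, RingHom.mem_ker, hs, pull_matrixCoord k hV hi hj, hq, sub_self]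

end MatrixSections

/-! ### Lifts to the zero locus of a section -/

section Proportionality

variable {R ι : Type*} [CommRing R] {v y y' : ι → R} {i i' : ι} {a : R}

theorem mem_nonZeroDivisors_of_span_eq {b : R} (ha : a ∈ nonZeroDivisors R)
    (h : Ideal.span {a} = Ideal.span {b}) : b ∈ nonZeroDivisors R := by
  obtain ⟨c, rfl⟩ := Ideal.span_singleton_le_span_singleton.mp h.le
  exact (mul_mem_nonZeroDivisors.mp ha).1

theorem span_range_eq_of_proportional (hv : ∀ q, v q = y q * v i) :
    Ideal.span (Set.range v) = Ideal.span {v i} := by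
  refine le_antisymm (Ideal.span_le.mpr ?_) (Ideal.span_mono ?_)
  · rintro _ ⟨q, rfl⟩
    exact Ideal.mem_span_singleton.mpr ⟨y q, (hv q).trans (mul_comm _ _)⟩
  · exact Set.singleton_subset_iff.mpr ⟨i, rfl⟩

theorem proportional_unique (ha : a ∈ nonZeroDivisors R)
    (hva : Ideal.span (Set.range v) = Ideal.span {a})
    (hv : ∀ q, v q = y q * v i) (hv' : ∀ q, v q = y' q * v i') :
    y i' * y' i = 1 ∧ ∀ q, y q = y i' * y' q := by
  have hi : v i ∈ nonZeroDivisors R :=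
    mem_nonZeroDivisors_of_span_eq ha (hva.symm.trans (span_range_eq_of_proportional hv))
  refine ⟨?_, fun q => ?_⟩ <;> rw [← mul_cancel_right_mem_nonZeroDivisors hi]
  · linear_combination -hv' i - y' i * hv i'
  · linear_combination hv' q - hv q + y' q * hv i'

theorem exists_factor_of_span_eq [Finite ι] (ha : a ∈ nonZeroDivisors R)
    (h : Ideal.span (Set.range v) = Ideal.span {a}) :
    ∃ b : ι → R, (∀ q, v q = a * b q) ∧ Ideal.span (Set.range b) = ⊤ := by
  have := Fintype.ofFinite ι
  have hdvd q : a ∣ v q := Ideal.mem_span_singleton.mp (h ▸ Ideal.subset_span ⟨q, rfl⟩)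
  choose b hb using hdvd
  refine ⟨b, hb, (Ideal.eq_top_iff_one _).mpr (Ideal.mem_span_range_iff_exists_fun.mpr ?_)⟩
  obtain ⟨c, hc⟩ := Ideal.mem_span_range_iff_exists_fun.mp (h ▸ Ideal.mem_span_singleton_self a)
  refine ⟨c, (mul_cancel_right_mem_nonZeroDivisors ha).mp ?_⟩
  rw [one_mul, Finset.sum_mul]
  refine (Finset.sum_congr rfl fun q _ => ?_).trans hc
  rw [hb q, mul_assoc, mul_comm a]

end Proportionality

section Lifts

variable {m n : ℕ} {T : Scheme.{0}}

/-- The vector of functions `v` is a multiple of the homogeneous coordinates of the point `h`. -/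
def Proportional (h : T ⟶ PP m) {V : T.Opens} (v : Fin (m + 1) → Γ(T, V)) : Prop :=
  ∀ (W : T.Opens) (hW : W ≤ V) (i : Fin (m + 1)) (hi : W ≤ h ⁻¹ᵁ chart m i) (q : Fin (m + 1)),
    res hW (v q) = coord h hi q * res hW (v i)

theorem eq_of_proportional {h h' : T ⟶ PP m}
    (hover : h ≫ (PP m ↘ Spec (.of ℂ)) = h' ≫ (PP m ↘ Spec (.of ℂ)))
    (hprop : ∀ t : T, ∃ V : T.Opens, IsAffineOpen V ∧ t ∈ V ∧ ∃ v : Fin (m + 1) → Γ(T, V),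
      Proportional h v ∧ Proportional h' v ∧ ∃ a ∈ nonZeroDivisors Γ(T, V),
        Ideal.span (Set.range v) = Ideal.span {a}) : h = h' := by
  refine hom_ext_of_locally fun t => ?_
  obtain ⟨V, hV, htV, v, hv, hv', a, ha, hva⟩ := hprop t
  obtain ⟨i, hi⟩ := exists_mem_chart h t
  obtain ⟨i', hi'⟩ := exists_mem_chart h' t
  obtain ⟨b, hb, htb⟩ := hV.exists_basicOpen_le
    (V := h ⁻¹ᵁ chart m i ⊓ h' ⁻¹ᵁ chart m i') ⟨t, hi, hi'⟩ htV
  have hWi := hb.trans inf_le_left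
  have hWi' := hb.trans inf_le_right
  have hWV := T.basicOpen_le b
  have hspan := congrArg (Ideal.map (res hWV)) hva
  rw [Ideal.map_span, Ideal.map_span, Set.image_singleton, ← Set.range_comp] at hspan
  obtain ⟨hinv, hcoord⟩ := proportional_unique (v := res hWV ∘ v)
    (res_mem_nonZeroDivisors hV b ha) hspan (hv _ hWV i hWi) (hv' _ hWV i' hWi')
  have hunit : IsUnit (coord h hWi i') := IsUnit.of_mul_eq_one _ hinv
  refine ⟨_, htb, hom_ext_of_coord hover (le_preimage_chart_of_isUnit h hWi hunit) hWi'
    fun p => hunit.mul_right_inj.mp ?_⟩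
  rw [← hcoord p, coord_mul_coord]

variable {A : Matrix (Fin (m + 1)) (Fin (n + 1)) ℂ} {s : (Q01 m n).globalSections}

theorem proportional_formValues (hs : IsMatrixSection A s) (z : T ⟶ (Q01 m n).zeroLocus s)
    {f : T ⟶ PP n} (hz : z ≫ (Q01 m n).zeroLocusι s ≫ pr₂ m n = f) {V : T.Opens}
    {j : Fin (n + 1)} (hj : V ≤ f ⁻¹ᵁ chart n j) :
    Proportional (z ≫ (Q01 m n).zeroLocusι s ≫ pr₁ m n) (formValues A f hj) := by
  subst hz
  intro W hW i hi q
  rw [res_formValues, res_formValues]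
  exact formValues_eq_coord_mul hs z rfl hi (hW.trans hj) q

theorem zeroLocus_hom_ext (hs : IsMatrixSection A s) {f : T ⟶ PP n}
    (hf : IsCartier ((linearSubspaceIdeal n (LinearMap.ker A.mulVecLin)).comap f))
    {z z' : T ⟶ (Q01 m n).zeroLocus s} (hz : z ≫ (Q01 m n).zeroLocusι s ≫ pr₂ m n = f)
    (hz' : z' ≫ (Q01 m n).zeroLocusι s ≫ pr₂ m n = f) : z = z' := by
  have hover (w : T ⟶ (Q01 m n).zeroLocus s) :
      (w ≫ (Q01 m n).zeroLocusι s ≫ pr₁ m n) ≫ (PP m ↘ Spec (.of ℂ)) =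
        (w ≫ (Q01 m n).zeroLocusι s ≫ pr₂ m n) ≫ (PP n ↘ Spec (.of ℂ)) := by
    simp only [Category.assoc, Limits.pullback.condition]
  have hfst : z ≫ (Q01 m n).zeroLocusι s ≫ pr₁ m n = z' ≫ (Q01 m n).zeroLocusι s ≫ pr₁ m n := by
    refine eq_of_proportional (by rw [hover, hover, hz, hz']) fun t => ?_
    obtain ⟨j, hj⟩ := exists_mem_chart f t
    obtain ⟨V, hV, htV, hVj, a, ha, hVa⟩ := hf.exists_le hj
    rw [ideal_comap_ker A _ hV hVj] at hVa
    exact ⟨V, hV, htV, _, proportional_formValues hs z hz hVj,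
      proportional_formValues hs z' hz' hVj, a, ha, hVa⟩
  rw [← cancel_mono ((Q01 m n).zeroLocusι s)]
  apply Limits.pullback.hom_ext
  · simpa only [Category.assoc] using hfst
  · simpa only [Category.assoc] using hz.trans hz'.symm

theorem exists_hom_zeroLocus (hs : IsMatrixSection A s) {f : T ⟶ PP n} {i : Fin (m + 1)}
    {j : Fin (n + 1)} (hj : ⊤ ≤ f ⁻¹ᵁ chart n j) {a : Γ(T, ⊤)} {y : Fin (m + 1) → Γ(T, ⊤)}
    (hy : y i = 1) (h : formValues A f hj = a • y) :
    ∃ z : T ⟶ (Q01 m n).zeroLocus s, z ≫ (Q01 m n).zeroLocusι s ≫ pr₂ m n = f ∧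
      ∃ hi : ⊤ ≤ (z ≫ (Q01 m n).zeroLocusι s ≫ pr₁ m n) ⁻¹ᵁ chart m i, coord _ hi = y := by
  obtain ⟨g, hover, hgi, hg⟩ := exists_hom_of_ratios (f ≫ (PP n ↘ Spec (.of ℂ))) i hy
  let k : T ⟶ PPprod m n := Limits.pullback.lift g f hover
  have hk₁ : k ≫ pr₁ m n = g := Limits.pullback.lift_fst _ _ _
  have hk₂ : k ≫ pr₂ m n = f := Limits.pullback.lift_snd _ _ _
  have hki : ⊤ ≤ (k ≫ pr₁ m n) ⁻¹ᵁ chart m i := by rwa [hk₁]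
  have hkj : ⊤ ≤ (k ≫ pr₂ m n) ⁻¹ᵁ chart n j := by rwa [hk₂]
  have hcoord : coord g hgi = y := funext hg
  obtain ⟨z, hz⟩ := exists_lift_zeroLocus hs k fun _ => ⟨⊤, i, j, hki, hkj, trivial, fun q => by
    rw [formValues_congr A hk₂ hkj hj, formValues_congr A hk₂ hkj hj, coord_congr hk₁ hki hgi, h,
      hcoord, Pi.smul_apply, Pi.smul_apply, hy, smul_eq_mul, smul_eq_mul, mul_one, mul_comm]⟩
  have hz₁ : z ≫ (Q01 m n).zeroLocusι s ≫ pr₁ m n = g := by rw [← Category.assoc, hz, hk₁]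
  refine ⟨z, by rw [← Category.assoc, hz, hk₂], ?_⟩
  rw [hz₁]
  exact ⟨hgi, hcoord⟩

theorem exists_lift_of_formValues_eq (hs : IsMatrixSection A s) {f : T ⟶ PP n} {W : T.Opens}
    {j : Fin (n + 1)} (hj : W ≤ f ⁻¹ᵁ chart n j) {a : Γ(T, W)} {b : Fin (m + 1) → Γ(T, W)}
    (hb : ∀ q, formValues A f hj q = a * b q) {i : Fin (m + 1)} (hu : IsUnit (b i)) :
    ∃ z : W.toScheme ⟶ (Q01 m n).zeroLocus s,
      z ≫ (Q01 m n).zeroLocusι s ≫ pr₂ m n = W.ι ≫ f := by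
  obtain ⟨c, hc⟩ := hu.exists_right_inv
  have hjι : ⊤ ≤ (W.ι ≫ f) ⁻¹ᵁ chart n j :=
    (le_ι_preimage W).trans (Scheme.Hom.preimage_mono _ hj)
  let toW := pull W.ι (le_ι_preimage W)
  obtain ⟨z, hz, -⟩ := exists_hom_zeroLocus hs hjι (i := i) (a := toW (a * b i))
    (y := fun q => toW (b q * c)) (by rw [hc, map_one]) (funext fun q => by
      rw [← pull_formValues f A W.ι hj (le_ι_preimage W), hb, Pi.smul_apply, smul_eq_mul, ← map_mul]
      congr 1
      linear_combination (-a * b q) * hc)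
  exact ⟨z, hz⟩

theorem exists_local_lift (hs : IsMatrixSection A s) {f : T ⟶ PP n}
    (hf : IsCartier ((linearSubspaceIdeal n (LinearMap.ker A.mulVecLin)).comap f)) (t : T) :
    ∃ (W : T.Opens) (_ : t ∈ W) (z : W.toScheme ⟶ (Q01 m n).zeroLocus s),
      z ≫ (Q01 m n).zeroLocusι s ≫ pr₂ m n = W.ι ≫ f := by
  obtain ⟨j, hj⟩ := exists_mem_chart f t
  obtain ⟨V, hV, htV, hVj, a, ha, hVa⟩ := hf.exists_le hj
  rw [ideal_comap_ker A f hV hVj] at hVa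
  obtain ⟨b, hb, hbtop⟩ := exists_factor_of_span_eq ha hVa
  obtain ⟨⟨_, i, rfl⟩, hti⟩ := TopologicalSpace.Opens.mem_iSup.mp
    (hV.self_le_iSup_basicOpen_iff.mpr hbtop htV)
  have hWV : T.basicOpen (b i) ≤ V := T.basicOpen_le _
  exact ⟨_, hti, exists_lift_of_formValues_eq hs (hWV.trans hVj) (a := res hWV a)
    (b := fun q => res hWV (b q)) (fun q => by rw [← map_mul, ← hb, res_formValues])
    (RingedSpace.isUnit_res_basicOpen _ (b i))⟩

end Lifts

/-! ### The zero locus of a section is a blow-up -/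

section GenericSolution

universe u

variable {k : Type u} [CommRing k] {ι κ : Type} [Fintype κ] [DecidableEq ι]
  {A : Matrix ι κ k} {B : Matrix κ ι k}

theorem mulVec_smul_add_sub [Fintype ι] (hAB : A * B = 1) (t : k) (y : ι → k) (z : κ → k) :
    A.mulVec (t • B.mulVec y + (z - B.mulVec (A.mulVec z))) = t • y := by
  rw [Matrix.mulVec_add, Matrix.mulVec_sub, Matrix.mulVec_smul, Matrix.mulVec_mulVec,
    Matrix.mulVec_mulVec, hAB, Matrix.one_mulVec, Matrix.one_mulVec, sub_self, add_zero]

-- The solution is `x = t B y + (z - B A z)` with `y`, `z` and `t` free: every solution arises in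
-- this way, from `z = x`.
theorem exists_generic_solution [Finite ι] (hAB : A * B = 1) (i : ι) :
    ∃ (P : CommRingCat.{u}) (σ : k →+* P) (y : ι → P) (x : κ → P) (t : P),
      y i = 1 ∧ (A.map σ).mulVec x = t • y ∧ t ∈ nonZeroDivisors P ∧
      ∀ (R : CommRingCat.{u}) (ρ : k →+* R) (y' : ι → R) (x' : κ → R) (t' : R),
        y' i = 1 → (A.map ρ).mulVec x' = t' • y' →
        ∃ φ : P →+* R, φ.comp σ = ρ ∧ φ ∘ y = y' ∧ φ ∘ x = x' := by
  have := Fintype.ofFinite ι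
  let P := MvPolynomial (ι ⊕ Option κ) k
  let C : k →+* P := MvPolynomial.C
  let y : ι → P := Function.update (fun q => MvPolynomial.X (Sum.inl q)) i 1
  let t : P := MvPolynomial.X (Sum.inr none)
  let z : κ → P := fun p => MvPolynomial.X (Sum.inr (some p))
  have hABC : A.map C * B.map C = 1 := by
    rw [← Matrix.map_mul, hAB, Matrix.map_one _ (map_zero _) (map_one _)]
  refine ⟨.of P, C, y,
    t • (B.map C).mulVec y + (z - (B.map C).mulVec ((A.map C).mulVec z)), t,
    Function.update_self .., mulVec_smul_add_sub hABC t y z,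
    isRegular_one.monomial.mem_nonZeroDivisors, ?_⟩
  intro R ρ y' x' t' hy' hx'
  let φ : P →+* R := MvPolynomial.eval₂Hom ρ (Sum.elim y' fun o => o.elim t' x')
  have hC : φ.comp C = ρ := RingHom.ext fun c => MvPolynomial.eval₂Hom_C _ _ _
  have hy : φ ∘ y = y' := by
    have hX : (fun q => φ (MvPolynomial.X (Sum.inl q))) = y' :=
      funext fun q => MvPolynomial.eval₂Hom_X' _ _ _
    rw [Function.comp_update, map_one, Function.comp_def, hX, ← hy', Function.update_eq_self]
  have ht : φ t = t' := MvPolynomial.eval₂Hom_X' _ _ _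
  have hz : φ ∘ z = x' := funext fun p => MvPolynomial.eval₂Hom_X' _ _ _
  have hmulVec {α β : Type} [Fintype β] (M : Matrix α β k) (v : β → P) :
      φ ∘ (M.map C).mulVec v = (M.map ρ).mulVec (φ ∘ v) := by
    rw [← hC]
    funext q
    rw [Function.comp_apply, RingHom.map_mulVec, Matrix.map_map]
    rfl
  refine ⟨φ, hC, hy, ?_⟩
  calc
    φ ∘ (t • (B.map C).mulVec y + (z - (B.map C).mulVec ((A.map C).mulVec z))) =
        φ t • (φ ∘ (B.map C).mulVec y) +
          (φ ∘ z - φ ∘ (B.map C).mulVec ((A.map C).mulVec z)) :=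
      funext fun p => by simp
    _ = t' • (B.map ρ).mulVec y' + (x' - (B.map ρ).mulVec (t' • y')) := by
      rw [hmulVec, hmulVec, hmulVec, ht, hz, hy, hx']
    _ = x' := by
      rw [Matrix.mulVec_smul, add_sub_cancel]

theorem exists_generic_normalized_solution [Finite ι] (hAB : A * B = 1) (i : ι) (j : κ) :
    ∃ (D : CommRingCat.{u}) (σ : k →+* D) (y : ι → D) (x : κ → D) (t : D),
      y i = 1 ∧ x j = 1 ∧ (A.map σ).mulVec x = t • y ∧ t ∈ nonZeroDivisors D ∧
      ∀ (R : CommRingCat.{u}) (ρ : k →+* R) (y' : ι → R) (x' : κ → R) (t' : R),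
        y' i = 1 → x' j = 1 → (A.map ρ).mulVec x' = t' • y' →
        ∃ φ : D →+* R, φ.comp σ = ρ ∧ φ ∘ y = y' ∧ φ ∘ x = x' := by
  obtain ⟨P, σ, y, x, t, hy, hx, ht, hP⟩ := exists_generic_solution hAB i
  let D := Localization.Away (x j)
  let a : P →+* D := algebraMap P D
  obtain ⟨u, hu⟩ := (IsLocalization.Away.algebraMap_isUnit (S := D) (x j)).exists_right_inv
  refine ⟨.of D, a.comp σ, a ∘ y, u • (a ∘ x), u * a t, ?_, ?_, ?_, ?_, ?_⟩
  · rw [Function.comp_apply, hy, map_one]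
  · rwa [Pi.smul_apply, smul_eq_mul, mul_comm]
  · have hax : (A.map (a.comp σ)).mulVec (a ∘ x) = a t • (a ∘ y) := by
      funext q
      have hq := congrArg a (congrFun hx q)
      rw [RingHom.map_mulVec, Matrix.map_map] at hq
      exact hq.trans (map_mul a _ _)
    rw [Matrix.mulVec_smul, hax, smul_smul]
  · refine mul_mem (IsUnit.of_mul_eq_one_right _ hu).mem_nonZeroDivisors ?_
    exact IsLocalization.map_nonZeroDivisors_le (Submonoid.powers (x j)) D
      (Submonoid.mem_map_of_mem _ ht)
  · intro R ρ y' x' t' hy' hx' hA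
    obtain ⟨φ₀, hσ, hφy, hφx⟩ := hP R ρ y' x' t' hy' hA
    have hxj : φ₀ (x j) = 1 := (congrFun hφx j).trans hx'
    have hunit : IsUnit (φ₀ (x j)) := hxj ▸ isUnit_one
    let φ : D →+* R := IsLocalization.Away.lift (x j) hunit
    have hφ : φ.comp a = φ₀ := IsLocalization.Away.lift_comp (x j) hunit
    have hφu : φ u = 1 := by
      rw [← map_one φ, ← hu, map_mul, ← RingHom.comp_apply φ a, hφ, hxj, one_mul]
    refine ⟨φ, by rw [← RingHom.comp_assoc, hφ, hσ], ?_, ?_⟩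
    · rw [← Function.comp_assoc, ← RingHom.coe_comp, hφ, hφy]
    · rw [← hφx, ← hφ]
      funext p
      exact (map_mul φ _ _).trans (by rw [hφu, one_mul]; rfl)

end GenericSolution

section Cartier

variable {m n : ℕ} {A : Matrix (Fin (m + 1)) (Fin (n + 1)) ℂ} {s : (Q01 m n).globalSections}

theorem zeroLocus_hom_ext_of_coord {T : Scheme.{0}} {e e' : T ⟶ (Q01 m n).zeroLocus s}
    (hover : (e ≫ (Q01 m n).zeroLocusι s ≫ pr₂ m n) ≫ (PP n ↘ Spec (.of ℂ)) =
      (e' ≫ (Q01 m n).zeroLocusι s ≫ pr₂ m n) ≫ (PP n ↘ Spec (.of ℂ)))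
    {i : Fin (m + 1)} {j : Fin (n + 1)}
    (hi : ⊤ ≤ (e ≫ (Q01 m n).zeroLocusι s ≫ pr₁ m n) ⁻¹ᵁ chart m i)
    (hi' : ⊤ ≤ (e' ≫ (Q01 m n).zeroLocusι s ≫ pr₁ m n) ⁻¹ᵁ chart m i)
    (hj : ⊤ ≤ (e ≫ (Q01 m n).zeroLocusι s ≫ pr₂ m n) ⁻¹ᵁ chart n j)
    (hj' : ⊤ ≤ (e' ≫ (Q01 m n).zeroLocusι s ≫ pr₂ m n) ⁻¹ᵁ chart n j)
    (hy : coord _ hi = coord _ hi') (hx : coord _ hj = coord _ hj') : e = e' := by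
  rw [← cancel_mono ((Q01 m n).zeroLocusι s)]
  apply Limits.pullback.hom_ext
  · simp only [Category.assoc]
    refine hom_ext_of_ratios i ?_ hi hi' (congrFun hy)
    simpa only [Category.assoc, Limits.pullback.condition] using hover
  · simp only [Category.assoc]
    exact hom_ext_of_ratios j hover hj hj' (congrFun hx)

theorem exists_hom_zeroLocus_of_solution (hs : IsMatrixSection A s) {T : Scheme.{0}}
    (τ : T ⟶ Spec (.of ℂ)) {i : Fin (m + 1)} {j : Fin (n + 1)} {y : Fin (m + 1) → Γ(T, ⊤)}
    {x : Fin (n + 1) → Γ(T, ⊤)} {t : Γ(T, ⊤)} (hy : y i = 1) (hx : x j = 1)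
    (h : (A.map (scalar τ ⊤)).mulVec x = t • y) :
    ∃ e : T ⟶ (Q01 m n).zeroLocus s,
      (e ≫ (Q01 m n).zeroLocusι s ≫ pr₂ m n) ≫ (PP n ↘ Spec (.of ℂ)) = τ ∧
      ∃ (hi : ⊤ ≤ (e ≫ (Q01 m n).zeroLocusι s ≫ pr₁ m n) ⁻¹ᵁ chart m i)
        (hj : ⊤ ≤ (e ≫ (Q01 m n).zeroLocusι s ≫ pr₂ m n) ⁻¹ᵁ chart n j),
        coord _ hi = y ∧ coord _ hj = x ∧ formValues A _ hj = t • y := by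
  obtain ⟨f, rfl, hj, hf⟩ := exists_hom_of_ratios τ j hx
  have hcoord : coord f hj = x := funext hf
  have hform : formValues A f hj = t • y := by rw [formValues, hcoord, h]
  obtain ⟨e, rfl, hi, hy⟩ := exists_hom_zeroLocus hs hj hy hform
  exact ⟨e, rfl, hi, hj, hy, hcoord, hform⟩

theorem exists_comp_eq_of_coord {D : CommRingCat.{0}} {σ : ℂ →+* D} {y : Fin (m + 1) → D}
    {x : Fin (n + 1) → D} {e : Spec D ⟶ (Q01 m n).zeroLocus s}
    (he : (e ≫ (Q01 m n).zeroLocusι s ≫ pr₂ m n) ≫ (PP n ↘ Spec (.of ℂ)) =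
      Spec.map (CommRingCat.ofHom σ))
    {i : Fin (m + 1)} {j : Fin (n + 1)}
    {hi : ⊤ ≤ (e ≫ (Q01 m n).zeroLocusι s ≫ pr₁ m n) ⁻¹ᵁ chart m i}
    {hj : ⊤ ≤ (e ≫ (Q01 m n).zeroLocusι s ≫ pr₂ m n) ⁻¹ᵁ chart n j}
    (hy : coord _ hi = specFun D ∘ y) (hx : coord _ hj = specFun D ∘ x)
    {T : Scheme.{0}} {z : T ⟶ (Q01 m n).zeroLocus s}
    {hzi : ⊤ ≤ (z ≫ (Q01 m n).zeroLocusι s ≫ pr₁ m n) ⁻¹ᵁ chart m i}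
    {hzj : ⊤ ≤ (z ≫ (Q01 m n).zeroLocusι s ≫ pr₂ m n) ⁻¹ᵁ chart n j} {φ : D →+* Γ(T, ⊤)}
    (hφσ : φ.comp σ =
      scalar ((z ≫ (Q01 m n).zeroLocusι s ≫ pr₂ m n) ≫ (PP n ↘ Spec (.of ℂ))) ⊤)
    (hφy : φ ∘ y = coord _ hzi) (hφx : φ ∘ x = coord _ hzj) :
    ∃ b : T ⟶ Spec D, b ≫ e = z := by
  obtain ⟨b, hb⟩ := exists_hom_Spec φ
  have htop := le_preimage_top b ⊤
  refine ⟨b, zeroLocus_hom_ext_of_coord (hom_Spec_complex_ext fun c => ?_)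
    (htop.trans (Scheme.Hom.preimage_mono b hi)) hzi
    (htop.trans (Scheme.Hom.preimage_mono b hj)) hzj (funext fun q => ?_) (funext fun p => ?_)⟩
  · rw [← hφσ, Category.assoc, Category.assoc, ← Category.assoc e, he, ← pull_scalar b _ htop,
      scalar_specMap, hb, RingHom.comp_apply]
  · refine (pull_coord _ b hi htop q).symm.trans ?_
    rw [hy, ← hφy]
    exact hb _
  · refine (pull_coord _ b hj htop p).symm.trans ?_
    rw [hx, ← hφx]
    exact hb _

-- The chart is a retract of the spectrum of the ring of the generic solution.
theorem formValues_mem_nonZeroDivisors {B : Matrix (Fin (n + 1)) (Fin (m + 1)) ℂ}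
    (hAB : A * B = 1) (hs : IsMatrixSection A s) (i : Fin (m + 1)) (j : Fin (n + 1)) :
    formValues A (V := (Q01 m n).zeroLocusι s ⁻¹ᵁ prodChart m n i j)
        ((Q01 m n).zeroLocusι s ≫ pr₂ m n) (fun _ hx => hx.2) i ∈
      nonZeroDivisors Γ((Q01 m n).zeroLocus s, (Q01 m n).zeroLocusι s ⁻¹ᵁ prodChart m n i j) := by
  let W := (Q01 m n).zeroLocusι s ⁻¹ᵁ prodChart m n i j
  obtain ⟨D, σ, y, x, t, hy, hx, hyx, ht, hD⟩ := exists_generic_normalized_solution hAB i j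
  obtain ⟨e, he, hei, hej, hey, hex, het⟩ := exists_hom_zeroLocus_of_solution hs
    (Spec.map (CommRingCat.ofHom σ)) (y := specFun D ∘ y) (x := specFun D ∘ x) (t := specFun D t)
    (i := i) (j := j) (by rw [Function.comp_apply, hy, map_one])
    (by rw [Function.comp_apply, hx, map_one]) (funext fun q => by
      have hmap : A.map (scalar (Spec.map (CommRingCat.ofHom σ)) ⊤) = (A.map σ).map (specFun D) :=
        Matrix.ext fun _ _ => scalar_specMap σ _
      rw [hmap, ← RingHom.map_mulVec, hyx]
      exact map_mul _ _ _)
  have hWi : W ≤ ((Q01 m n).zeroLocusι s ≫ pr₁ m n) ⁻¹ᵁ chart m i := fun _ hx => hx.1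
  have hWj : W ≤ ((Q01 m n).zeroLocusι s ≫ pr₂ m n) ⁻¹ᵁ chart n j := fun _ hx => hx.2
  have hιi : ⊤ ≤ (W.ι ≫ (Q01 m n).zeroLocusι s ≫ pr₁ m n) ⁻¹ᵁ chart m i :=
    (le_ι_preimage W).trans (Scheme.Hom.preimage_mono _ hWi)
  have hιj : ⊤ ≤ (W.ι ≫ (Q01 m n).zeroLocusι s ≫ pr₂ m n) ⁻¹ᵁ chart n j :=
    (le_ι_preimage W).trans (Scheme.Hom.preimage_mono _ hWj)
  obtain ⟨φ, hφσ, hφy, hφx⟩ := hD Γ(W.toScheme, ⊤) (scalar (_ ≫ (PP n ↘ Spec (.of ℂ))) ⊤)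
    (coord _ hιi) (coord _ hιj) (formValues A _ hιj i) (coord_self _ _) (coord_self _ _)
    (funext fun q => (formValues_eq_coord_mul hs W.ι rfl hιi hιj q).trans (mul_comm _ _))
  obtain ⟨b, hbe⟩ := exists_comp_eq_of_coord he hey hex hφσ hφy hφx
  have heW : ⊤ ≤ e ⁻¹ᵁ W := fun _ hx => ⟨hei hx, hej hx⟩
  have hvalue : pull e heW (formValues A _ hWj i) = specFun D t := by
    rw [pull_formValues]
    refine (congrFun het i).trans ?_
    rw [Pi.smul_apply, Function.comp_apply, hy, map_one, smul_eq_mul, mul_one]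
  refine mem_nonZeroDivisors_of_injective
    (pull_injective_of_factor e heW b (le_preimage_top b ⊤) hbe) ?_
  rw [hvalue]
  exact map_mem_nonZeroDivisors_of_bijective (specFun_bijective D) ht

theorem isCartier_zeroLocus {B : Matrix (Fin (n + 1)) (Fin (m + 1)) ℂ} (hAB : A * B = 1)
    (hs : IsMatrixSection A s) :
    IsCartier ((linearSubspaceIdeal n (LinearMap.ker A.mulVecLin)).comap
      ((Q01 m n).zeroLocusι s ≫ pr₂ m n)) := by
  intro z
  obtain ⟨i, hi⟩ := exists_mem_chart ((Q01 m n).zeroLocusι s ≫ pr₁ m n) z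
  obtain ⟨j, hj⟩ := exists_mem_chart ((Q01 m n).zeroLocusι s ≫ pr₂ m n) z
  have hW : IsAffineOpen ((Q01 m n).zeroLocusι s ⁻¹ᵁ prodChart m n i j) :=
    (isAffineOpen_prodChart i j).preimage _
  have hWi : (Q01 m n).zeroLocusι s ⁻¹ᵁ prodChart m n i j ≤
      ((Q01 m n).zeroLocusι s ≫ pr₁ m n) ⁻¹ᵁ chart m i := fun _ hx => hx.1
  have hWj : (Q01 m n).zeroLocusι s ⁻¹ᵁ prodChart m n i j ≤
      ((Q01 m n).zeroLocusι s ≫ pr₂ m n) ⁻¹ᵁ chart n j := fun _ hx => hx.2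
  refine ⟨⟨_, hW⟩, ⟨hi, hj⟩, _, formValues_mem_nonZeroDivisors hAB hs i j, ?_⟩
  rw [ideal_comap_ker A _ hW hWj]
  exact span_range_eq_of_proportional fun q =>
    formValues_eq_coord_mul hs (𝟙 _) (Category.id_comp _) hWi hWj q

theorem isBlowUp_zeroLocus {B : Matrix (Fin (n + 1)) (Fin (m + 1)) ℂ} (hAB : A * B = 1)
    (hs : IsMatrixSection A s) :
    IsBlowUp (linearSubspaceIdeal n (LinearMap.ker A.mulVecLin))
      ((Q01 m n).zeroLocusι s ≫ pr₂ m n) :=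
  IsBlowUp.of_locally (isCartier_zeroLocus hAB hs) (fun _ _ hf _ _ => zeroLocus_hom_ext hs hf)
    fun _ _ hf => exists_local_lift hs hf

end Cartier

/-! ### Sections of `Q(0,1)` in local coordinates -/

section

variable {m n : ℕ}

theorem sum_quotientFrame_mul {R : Type*} [CommRing R] (i i' q : Fin (m + 1)) (x y : R)
    (c : Fin (m + 1) → R) (hc : c i' = 0) :
    ∑ d : {d : Fin (m + 1) // d ≠ i'} × Unit,
      (((Pi.single d.1.1 1 : Fin (m + 1) → R) q -
        y * (Pi.single d.1.1 1 : Fin (m + 1) → R) i) * x) * c d.1.1 = x * (c q - y * c i) := by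
  let F : Fin (m + 1) → R := fun d =>
    (((Pi.single d 1 : Fin (m + 1) → R) q - y * (Pi.single d 1 : Fin (m + 1) → R) i) * x) * c d
  have hF : F i' = 0 := by simp only [F, hc, mul_zero]
  calc ∑ d : {d : Fin (m + 1) // d ≠ i'} × Unit, F d.1.1
      = ∑ d : {d : Fin (m + 1) // d ≠ i'}, F d.1 := by
        simp only [Fintype.sum_prod_type, Finset.univ_unique, Finset.sum_singleton]
    _ = ∑ d, F d := by
        rw [← Finset.sum_erase Finset.univ hF]
        exact (Finset.sum_subtype _ (by simp) F).symm
    _ = x * (c q - y * c i) := by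
        simp only [F, Pi.single_apply, sub_mul, mul_assoc, Finset.sum_sub_distrib, ite_mul,
          one_mul, zero_mul, Finset.sum_ite_eq, Finset.mem_univ, if_true, ← Finset.mul_sum]
        ring

/-- The entries of the transition matrices of `Q(0,1)`, as functions on the intersections of the
charts `prodChart m n i j`. -/
def transition (i i' : Fin (m + 1)) (j j' : Fin (n + 1)) (q : {q : Fin (m + 1) // q ≠ i})
    (d : {d : Fin (m + 1) // d ≠ i'} × Unit) :
    Γ(PPprod m n, prodChart m n i j ⊓ prodChart m n i' j') :=
  (Q01 m n).g (i, j) (i', j') (q, ()) d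

theorem transition_eq (i i' : Fin (m + 1)) (j j' : Fin (n + 1)) (q : {q : Fin (m + 1) // q ≠ i})
    (d : {d : Fin (m + 1) // d ≠ i'} × Unit) :
    transition i i' j j' q d =
      ((Pi.single d.1.1 1 : Fin (m + 1) → Γ(PPprod m n, prodChart m n i j ⊓ prodChart m n i' j'))
        q.1 - coord (pr₁ m n) (inf_le_left.trans inf_le_left) q.1 *
          (Pi.single d.1.1 1 :
            Fin (m + 1) → Γ(PPprod m n, prodChart m n i j ⊓ prodChart m n i' j')) i) *
        coord (pr₂ m n) (inf_le_left.trans inf_le_right : _ ≤ pr₂ m n ⁻¹ᵁ chart n j) j' := by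
  change res (U := pr₁ m n ⁻¹ᵁ chart m i ⊓ pr₁ m n ⁻¹ᵁ chart m i')
      (V := prodChart m n i j ⊓ prodChart m n i' j') (inf_le_inf inf_le_left inf_le_left)
      (pull (pr₁ m n) (U := chart m i ⊓ chart m i') (le_preimage_inf (pr₁ m n))
        ((Pi.single d.1.1 1 : Fin (m + 1) → Γ(PP m, chart m i ⊓ chart m i')) q.1 -
          res inf_le_left (ratio m q.1 i) *
            (Pi.single d.1.1 1 : Fin (m + 1) → Γ(PP m, chart m i ⊓ chart m i')) i)) *
    res (U := pr₂ m n ⁻¹ᵁ chart n j ⊓ pr₂ m n ⁻¹ᵁ chart n j')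
      (V := prodChart m n i j ⊓ prodChart m n i' j') (inf_le_inf inf_le_right inf_le_right)
      (pull (pr₂ m n) (U := chart n j ⊓ chart n j') (le_preimage_inf (pr₂ m n))
        (res inf_le_left (ratio n j' j))) = _
  simp only [Pi.single_apply, map_sub, map_mul, apply_ite (pull _ _), apply_ite (res _), map_one,
    map_zero, pull_res, res_pull]
  rfl

/-- The cocycle condition for a section of `Q(0,1)`, for coordinates `c i j q` on the chart
`y_i ≠ 0`, `x_j ≠ 0`. In contrast to the frames of `Q01`, the redundant index `q = i` is allowed;
the coordinate there is meant to be `0`. -/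
def IsCompatible (c : ∀ (i : Fin (m + 1)) (j : Fin (n + 1)), Fin (m + 1) →
    Γ(PPprod m n, prodChart m n i j)) : Prop :=
  ∀ (i i' : Fin (m + 1)) (j j' : Fin (n + 1)) (q : Fin (m + 1)),
    res (inf_le_left : prodChart m n i j ⊓ prodChart m n i' j' ≤ prodChart m n i j) (c i j q) =
      coord (pr₂ m n) (inf_le_left.trans inf_le_right : _ ≤ pr₂ m n ⁻¹ᵁ chart n j) j' *
        (res inf_le_right (c i' j' q) -
          coord (pr₁ m n) (inf_le_left.trans inf_le_left : _ ≤ pr₁ m n ⁻¹ᵁ chart m i) q *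
            res inf_le_right (c i' j' i))

theorem sum_transition_mul (c : ∀ (i : Fin (m + 1)) (j : Fin (n + 1)), Fin (m + 1) →
    Γ(PPprod m n, prodChart m n i j)) {i' : Fin (m + 1)} {j' : Fin (n + 1)} (hc : c i' j' i' = 0)
    (i : Fin (m + 1)) (j : Fin (n + 1)) (q : {q : Fin (m + 1) // q ≠ i}) :
    ∑ d : {d : Fin (m + 1) // d ≠ i'} × Unit, transition i i' j j' q d *
        res (inf_le_right : prodChart m n i j ⊓ prodChart m n i' j' ≤ prodChart m n i' j')
          (c i' j' d.1.1) =
      coord (pr₂ m n) (inf_le_left.trans inf_le_right :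
        prodChart m n i j ⊓ prodChart m n i' j' ≤ pr₂ m n ⁻¹ᵁ chart n j) j' *
        (res inf_le_right (c i' j' q) -
          coord (pr₁ m n) (inf_le_left.trans inf_le_left : _ ≤ pr₁ m n ⁻¹ᵁ chart m i) q *
            res inf_le_right (c i' j' i)) := by
  refine Eq.trans (Finset.sum_congr rfl fun d _ =>
    congrArg (· * _) (transition_eq i i' j j' q d)) ?_
  exact sum_quotientFrame_mul i i' q.1 _ _ (fun d => res inf_le_right (c i' j' d))
    (by rw [hc, map_zero])

theorem exists_globalSection_of_isCompatible {c : ∀ (i : Fin (m + 1)) (j : Fin (n + 1)),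
    Fin (m + 1) → Γ(PPprod m n, prodChart m n i j)} (hc : ∀ i j, c i j i = 0)
    (hcompat : IsCompatible c) :
    ∃ s : (Q01 m n).globalSections, ∀ i j q, localCoord s i j q = c i j q := by
  refine ⟨⟨fun a b => c a.1 a.2 b.1.1, ?_⟩, fun i j q => rfl⟩
  rintro ⟨i, j⟩ ⟨i', j'⟩
  funext ⟨q, _⟩
  exact (hcompat i i' j j' _).trans (sum_transition_mul c (hc i' j') i j q).symm

/-- The coordinates of a section of `Q(0,1)`, extended by zero to the index `q = i`. -/
def extCoord (s : (Q01 m n).globalSections) (i : Fin (m + 1)) (j : Fin (n + 1))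
    (q : Fin (m + 1)) : Γ(PPprod m n, prodChart m n i j) :=
  if h : q ≠ i then localCoord s i j ⟨q, h⟩ else 0

theorem extCoord_self (s : (Q01 m n).globalSections) (i : Fin (m + 1)) (j : Fin (n + 1)) :
    extCoord s i j i = 0 := dif_neg (not_not.mpr rfl)

theorem extCoord_of_ne (s : (Q01 m n).globalSections) (i : Fin (m + 1)) (j : Fin (n + 1))
    (q : {q : Fin (m + 1) // q ≠ i}) : extCoord s i j q = localCoord s i j q :=
  dif_pos q.2

theorem isCompatible_extCoord (s : (Q01 m n).globalSections) : IsCompatible (extCoord s) := by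
  intro i i' j j' q
  by_cases hq : q = i
  · subst hq
    rw [extCoord_self, map_zero, coord_self, one_mul, sub_self, mul_zero]
  · rw [← sum_transition_mul (extCoord s) (extCoord_self s i' j') i j ⟨q, hq⟩,
      extCoord_of_ne s i j ⟨q, hq⟩]
    refine (VecBundle.res_globalSection s (i, j) (i', j') (⟨q, hq⟩, ())).trans ?_
    exact Finset.sum_congr rfl fun d _ =>
      congrArg (fun a => _ * res inf_le_right a) (extCoord_of_ne s i' j' d.1).symm

theorem formValues_sub_coord_mul (A : Matrix (Fin (m + 1)) (Fin (n + 1)) ℂ) {T : Scheme.{0}}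
    (f : T ⟶ PP m) (g : T ⟶ PP n) {V : T.Opens} {i i' : Fin (m + 1)} {j j' : Fin (n + 1)}
    (hi : V ≤ f ⁻¹ᵁ chart m i) (hi' : V ≤ f ⁻¹ᵁ chart m i') (hj : V ≤ g ⁻¹ᵁ chart n j)
    (hj' : V ≤ g ⁻¹ᵁ chart n j') (q : Fin (m + 1)) :
    formValues A g hj q - coord f hi q * formValues A g hj i =
      coord g hj j' * (formValues A g hj' q - coord f hi' q * formValues A g hj' i' -
        coord f hi q * (formValues A g hj' i - coord f hi' i * formValues A g hj' i')) := by
  rw [← coord_mul_formValues g A hj hj' q, ← coord_mul_formValues g A hj hj' i,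
    ← coord_mul_coord f hi' hi q]
  ring

theorem isCompatible_matrixCoord (A : Matrix (Fin (m + 1)) (Fin (n + 1)) ℂ) :
    IsCompatible (matrixCoord A) := by
  intro i i' j j' q
  simp only [matrixCoord, map_sub, map_mul, res_formValues, res_coord]
  exact formValues_sub_coord_mul A (pr₁ m n) (pr₂ m n) _ _ _ _ q

theorem exists_isMatrixSection (A : Matrix (Fin (m + 1)) (Fin (n + 1)) ℂ) :
    ∃ s : (Q01 m n).globalSections, IsMatrixSection A s :=
  exists_globalSection_of_isCompatible
    (fun i j => by rw [matrixCoord, coord_self, one_mul, sub_self]) (isCompatible_matrixCoord A)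

end

/-! ### Linear automorphisms of projective space -/

section

variable {m n : ℕ}

theorem exists_isAffineOpen_le_chart {T : Scheme.{0}} (f : T ⟶ PP m) (f' : T ⟶ PP n) (t : T) :
    ∃ (V : T.Opens) (i : Fin (m + 1)) (j : Fin (n + 1)), IsAffineOpen V ∧ t ∈ V ∧
      V ≤ f ⁻¹ᵁ chart m i ∧ V ≤ f' ⁻¹ᵁ chart n j := by
  obtain ⟨i, hi⟩ := exists_mem_chart f t
  obtain ⟨j, hj⟩ := exists_mem_chart f' t
  obtain ⟨V, hV, htV, hVij⟩ := exists_isAffineOpen_mem_and_subset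
    (U := f ⁻¹ᵁ chart m i ⊓ f' ⁻¹ᵁ chart n j) (x := t) ⟨hi, hj⟩
  exact ⟨V, i, j, hV, htV, le_trans hVij inf_le_left, le_trans hVij inf_le_right⟩

theorem formValues_mul {κ : Type*} (A : Matrix κ (Fin (m + 1)) ℂ)
    (g : Matrix (Fin (m + 1)) (Fin (n + 1)) ℂ) {T : Scheme.{0}} (f : T ⟶ PP n) {V : T.Opens}
    {j : Fin (n + 1)} (h : V ≤ f ⁻¹ᵁ chart n j) :
    formValues (A * g) f h =
      (A.map (scalar (f ≫ (PP n ↘ Spec (.of ℂ))) V)).mulVec (formValues g f h) := by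
  rw [formValues, Matrix.map_mul, ← Matrix.mulVec_mulVec]
  rfl

variable {g g' : Matrix (Fin (n + 1)) (Fin (n + 1)) ℂ} {φ φ' : PP n ⟶ PP n}

theorem span_formValues_eq_top (hg : g' * g = 1) {T : Scheme.{0}} (f : T ⟶ PP n) {V : T.Opens}
    {j : Fin (n + 1)} (h : V ≤ f ⁻¹ᵁ chart n j) :
    Ideal.span (Set.range (formValues g f h)) = ⊤ := by
  rw [Ideal.eq_top_iff_one, ← coord_self f h, ← formValues_one f h, ← hg, formValues_mul,
    Matrix.mulVec, dotProduct]
  exact Ideal.sum_mem _ fun q _ => Ideal.mul_mem_left _ _ (Ideal.subset_span ⟨q, rfl⟩)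

/-- `φ` is the endomorphism `[x] ↦ [g x]` of `ℙⁿ`: it is defined over `ℂ`, and on all `T`-valued
points `f` the linear forms given by the rows of `g` are proportional to the coordinates of
`f ≫ φ`. -/
structure IsLinearEndomorphism (g : Matrix (Fin (n + 1)) (Fin (n + 1)) ℂ) (φ : PP n ⟶ PP n) :
    Prop where
  comp_over : φ ≫ (PP n ↘ Spec (.of ℂ)) = (PP n ↘ Spec (.of ℂ))
  proportional {T : Scheme.{0}} (f : T ⟶ PP n) {V : T.Opens} {j : Fin (n + 1)}
    (hj : V ≤ f ⁻¹ᵁ chart n j) : Proportional (f ≫ φ) (formValues g f hj)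

-- For invertible `g` the centre is empty, so the first projection of the blow-up is `[x] ↦ [g x]`.
theorem exists_isLinearEndomorphism (hg : g' * g = 1) : ∃ φ, IsLinearEndomorphism g φ := by
  obtain ⟨s, hs⟩ := exists_isMatrixSection g
  have hcartier :
      IsCartier ((linearSubspaceIdeal n (LinearMap.ker g.mulVecLin)).comap (𝟙 _)) := by
    intro x
    obtain ⟨j, hj⟩ := exists_mem_chart (𝟙 (PP n)) x
    have hle : chart n j ≤ 𝟙 (PP n) ⁻¹ᵁ chart n j := fun _ h => h
    refine ⟨⟨chart n j, isAffineOpen_chart n j⟩, hj, 1, one_mem _, ?_⟩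
    rw [ideal_comap_ker g (𝟙 _) (isAffineOpen_chart n j) hle, span_formValues_eq_top hg,
      Ideal.span_singleton_one]
  obtain ⟨z, hz, -⟩ :=
    (isBlowUp_zeroLocus (mul_eq_one_comm.mp hg) hs).universal _ (𝟙 _) hcartier
  replace hz : z ≫ (Q01 n n).zeroLocusι s ≫ pr₂ n n = 𝟙 _ := hz
  refine ⟨z ≫ (Q01 n n).zeroLocusι s ≫ pr₁ n n, ?_, fun {T} f V j hj => ?_⟩
  · simp only [Category.assoc, Limits.pullback.condition]
    rw [reassoc_of% hz]
  · have hfz : (f ≫ z) ≫ (Q01 n n).zeroLocusι s ≫ pr₂ n n = f := by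
      rw [Category.assoc, hz, Category.comp_id]
    simpa only [Category.assoc] using proportional_formValues hs (f ≫ z) hfz hj

namespace IsLinearEndomorphism

variable {V : (PP n).Opens} {i j : Fin (n + 1)}

theorem proportional_id (hφ : IsLinearEndomorphism g φ) (hj : V ≤ 𝟙 (PP n) ⁻¹ᵁ chart n j) :
    Proportional φ (formValues g (𝟙 _) hj) := by
  simpa only [Category.id_comp] using hφ.proportional (𝟙 _) hj

theorem formValues_eq_coord_mul (hφ : IsLinearEndomorphism g φ) (hi : V ≤ φ ⁻¹ᵁ chart n i)
    (hj : V ≤ 𝟙 (PP n) ⁻¹ᵁ chart n j) (q : Fin (n + 1)) :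
    formValues g (𝟙 _) hj q = coord φ hi q * formValues g (𝟙 _) hj i := by
  simpa only [res_self] using hφ.proportional_id hj V le_rfl i hi q

theorem isUnit_formValues (hφ : IsLinearEndomorphism g φ) (hg : g' * g = 1)
    (hi : V ≤ φ ⁻¹ᵁ chart n i) (hj : V ≤ 𝟙 (PP n) ⁻¹ᵁ chart n j) :
    IsUnit (formValues g (𝟙 _) hj i) := by
  rw [← Ideal.span_singleton_eq_top,
    ← span_range_eq_of_proportional (hφ.formValues_eq_coord_mul hi hj)]
  exact span_formValues_eq_top hg _ hj

theorem formValues_mul_eq_smul {κ : Type*} (hφ : IsLinearEndomorphism g φ)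
    (A : Matrix κ (Fin (n + 1)) ℂ) (hi : V ≤ φ ⁻¹ᵁ chart n i)
    (hj : V ≤ 𝟙 (PP n) ⁻¹ᵁ chart n j) :
    formValues (A * g) (𝟙 _) hj = formValues g (𝟙 _) hj i • formValues A φ hi := by
  have hvalues : formValues g (𝟙 _) hj = formValues g (𝟙 _) hj i • coord φ hi :=
    funext fun q => (hφ.formValues_eq_coord_mul hi hj q).trans (mul_comm _ _)
  rw [formValues_mul]
  nth_rw 1 [hvalues]
  rw [Matrix.mulVec_smul, Category.id_comp, ← hφ.comp_over]
  rfl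

theorem comp_eq_id (hg : g' * g = 1) (hφ : IsLinearEndomorphism g φ)
    (hφ' : IsLinearEndomorphism g' φ') : φ ≫ φ' = 𝟙 _ := by
  have hover : (φ ≫ φ') ≫ (PP n ↘ Spec (.of ℂ)) = 𝟙 _ ≫ (PP n ↘ Spec (.of ℂ)) := by
    rw [Category.assoc, hφ'.comp_over, hφ.comp_over, Category.id_comp]
  refine eq_of_proportional hover fun t => ?_
  obtain ⟨V, i, j, hV, htV, hi, hj⟩ := exists_isAffineOpen_le_chart φ (𝟙 (PP n)) t
  refine ⟨V, hV, htV, coord (𝟙 _) hj, ?_, ?_, 1, one_mem _, ?_⟩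
  · have hcoord : coord (𝟙 _) hj = formValues g (𝟙 _) hj i • formValues g' φ hi := by
      rw [← formValues_one, ← hg, hφ.formValues_mul_eq_smul g' hi hj]
    intro W hW k hk q
    simp only [hcoord, Pi.smul_apply, smul_eq_mul, map_mul, hφ'.proportional φ hi W hW k hk q]
    ring
  · intro W hW k hk q
    rw [res_coord, res_coord, mul_comm, coord_mul_coord]
  · rw [← formValues_one, span_formValues_eq_top (mul_one 1), Ideal.span_singleton_one]

open scoped Pointwise in
theorem comap_linearSubspaceIdeal_ker {κ : Type*} [Finite κ] (hg : g' * g = 1)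
    (hφ : IsLinearEndomorphism g φ) (A : Matrix κ (Fin (n + 1)) ℂ) :
    (linearSubspaceIdeal n (LinearMap.ker A.mulVecLin)).comap φ =
      linearSubspaceIdeal n (LinearMap.ker (A * g).mulVecLin) := by
  choose V i j hV htV hi hj using exists_isAffineOpen_le_chart φ (𝟙 (PP n))
  refine Scheme.IdealSheafData.ext_of_iSup_eq_top (fun t => ⟨V t, hV t⟩)
    (eq_top_iff.mpr fun t _ => TopologicalSpace.Opens.mem_iSup.mpr ⟨t, htV t⟩) fun t => ?_
  rw [← Scheme.IdealSheafData.comap_id (linearSubspaceIdeal n (LinearMap.ker (A * g).mulVecLin)),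
    ideal_comap_ker A φ (hV t) (hi t), ideal_comap_ker (A * g) (𝟙 _) (hV t) (hj t),
    hφ.formValues_mul_eq_smul A (hi t) (hj t)]
  have hrange : Set.range (formValues g (𝟙 _) (hj t) (i t) • formValues A φ (hi t)) =
      formValues g (𝟙 _) (hj t) (i t) • Set.range (formValues A φ (hi t)) :=
    Set.range_smul (formValues g (𝟙 (PP n)) (hj t) (i t)) (formValues A φ (hi t))
  rw [hrange]
  exact (Submodule.span_smul_eq_of_isUnit _ _ (hφ.isUnit_formValues hg (hi t) (hj t))).symm

end IsLinearEndomorphism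

theorem exists_iso_of_isBlowUp {κ : Type*} [Finite κ] {A : Matrix κ (Fin (n + 1)) ℂ}
    (hg : g' * g = 1) {B B' : Scheme.{0}} {π : B ⟶ PP n} {π' : B' ⟶ PP n}
    (hπ : IsBlowUp (linearSubspaceIdeal n (LinearMap.ker (A * g).mulVecLin)) π)
    (hπ' : IsBlowUp (linearSubspaceIdeal n (LinearMap.ker A.mulVecLin)) π') :
    Nonempty (Over.mk (π ≫ (PP n ↘ Spec (.of ℂ))) ≅ Over.mk (π' ≫ (PP n ↘ Spec (.of ℂ)))) := by
  obtain ⟨φ, hφ⟩ := exists_isLinearEndomorphism hg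
  obtain ⟨φ', hφ'⟩ := exists_isLinearEndomorphism (mul_eq_one_comm.mp hg)
  let e : PP n ≅ PP n := ⟨φ', φ, hφ'.comp_eq_id (mul_eq_one_comm.mp hg) hφ, hφ.comp_eq_id hg hφ'⟩
  have hπ'e : IsBlowUp (linearSubspaceIdeal n (LinearMap.ker (A * g).mulVecLin)) (π' ≫ φ') :=
    hφ.comap_linearSubspaceIdeal_ker hg A ▸ hπ'.comp_iso e
  obtain ⟨b, hb⟩ := hπ.exists_iso hπ'e
  refine ⟨Over.isoMk b ?_⟩
  change b.hom ≫ π' ≫ (PP n ↘ Spec (.of ℂ)) = π ≫ (PP n ↘ Spec (.of ℂ))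
  rw [← hb, Category.assoc, Category.assoc, hφ'.comp_over]

end

theorem exists_linearEquiv_mem_iff {K V : Type*} [Field K] [AddCommGroup V] [Module K V]
    {W W' : Submodule K V} [FiniteDimensional K W] [FiniteDimensional K W']
    (h : Module.finrank K W = Module.finrank K W') : ∃ g : V ≃ₗ[K] V, ∀ x, g x ∈ W' ↔ x ∈ W := by
  let f := LinearEquiv.ofFinrankEq W W' h
  obtain ⟨g, hg⟩ := Submodule.exists_linearEquiv_restrict_eq f
  refine ⟨g, fun x => ⟨fun hx => ?_, fun hx => hg ⟨x, hx⟩ ▸ (f ⟨x, hx⟩).2⟩⟩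
  have hpre : g (f.symm ⟨g x, hx⟩) = g x := by rw [← hg, LinearEquiv.apply_symm_apply]
  exact g.injective hpre ▸ (f.symm ⟨g x, hx⟩).2

theorem exists_matrix_of_submodule {K : Type*} [Field K] {n r : ℕ} (hr : r ≤ n)
    (L : Submodule K (Fin (n + 1) → K)) (hL : Module.finrank K L = r) :
    ∃ (A : Matrix (Fin (n - r + 1)) (Fin (n + 1)) K) (B : Matrix (Fin (n + 1)) (Fin (n - r + 1)) K),
      A * B = 1 ∧ LinearMap.ker A.mulVecLin = L := by
  have hrank : Module.finrank K ((Fin (n + 1) → K) ⧸ L) =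
      Module.finrank K (Fin (n - r + 1) → K) := by
    have := L.finrank_quotient_add_finrank
    simp only [Module.finrank_fin_fun] at this ⊢
    omega
  let e := LinearEquiv.ofFinrankEq _ _ hrank
  let f : (Fin (n + 1) → K) →ₗ[K] (Fin (n - r + 1) → K) := e.toLinearMap ∘ₗ L.mkQ
  obtain ⟨k, hk⟩ := f.exists_rightInverse_of_surjective
    (LinearMap.range_eq_top.mpr (e.surjective.comp L.mkQ_surjective))
  refine ⟨LinearMap.toMatrix' f, LinearMap.toMatrix' k, ?_, ?_⟩
  · rw [← LinearMap.toMatrix'_comp, hk, LinearMap.toMatrix'_id]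
  · rw [← Matrix.toLin'_apply', Matrix.toLin'_toMatrix', LinearEquiv.ker_comp, Submodule.ker_mkQ]

theorem exists_matrix_mul_ker_eq {K ι κ : Type*} [Field K] [Fintype ι] [DecidableEq ι] [Fintype κ]
    [DecidableEq κ] {A : Matrix κ ι K} {B : Matrix ι κ K} (hAB : A * B = 1)
    (L : Submodule K (ι → K)) (hL : Module.finrank K L + Fintype.card κ = Fintype.card ι) :
    ∃ g g' : Matrix ι ι K, g' * g = 1 ∧ LinearMap.ker (A * g).mulVecLin = L := by
  have hsurj : Function.Surjective A.mulVecLin := fun v => ⟨B.mulVec v, by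
    rw [Matrix.mulVecLin_apply, Matrix.mulVec_mulVec, hAB, Matrix.one_mulVec]⟩
  have hrank : Module.finrank K L = Module.finrank K (LinearMap.ker A.mulVecLin) := by
    have := A.mulVecLin.finrank_range_add_finrank_ker
    rw [LinearMap.range_eq_top.mpr hsurj, finrank_top, Module.finrank_fintype_fun_eq_card,
      Module.finrank_fintype_fun_eq_card] at this
    omega
  obtain ⟨g, hg⟩ := exists_linearEquiv_mem_iff hrank
  refine ⟨LinearMap.toMatrix' g.toLinearMap, LinearMap.toMatrix' g.symm.toLinearMap, ?_, ?_⟩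
  · rw [← LinearMap.toMatrix'_comp, LinearEquiv.symm_comp, LinearMap.toMatrix'_id]
  · have hg' : (LinearMap.toMatrix' g.toLinearMap).mulVecLin = g.toLinearMap := by
      rw [← Matrix.toLin'_apply', Matrix.toLin'_toMatrix']
    ext x
    rw [Matrix.mulVecLin_mul, hg', LinearMap.mem_ker, LinearMap.comp_apply]
    exact hg x

/-! ### Supports of Laurent polynomials -/

theorem exists_eq_single_of_sum_eq_one {ι : Type*} [Fintype ι] [DecidableEq ι] {c : ι → ℤ}
    (hc : ∀ k, 0 ≤ c k) (hsum : ∑ k, c k = 1) : ∃ k, c = Pi.single k 1 := by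
  obtain ⟨k, -, hk⟩ := Finset.exists_ne_zero_of_sum_ne_zero (hsum.trans_ne one_ne_zero)
  have hrest : 0 ≤ ∑ l ∈ Finset.univ.erase k, c l := Finset.sum_nonneg fun l _ => hc l
  have hsplit := Finset.add_sum_erase Finset.univ c (Finset.mem_univ k)
  have hk_pos := (hc k).lt_of_ne' hk
  have hrest_zero : ∑ l ∈ Finset.univ.erase k, c l = 0 := by omega
  rw [Finset.sum_eq_zero_iff_of_nonneg fun l _ => hc l] at hrest_zero
  refine ⟨k, funext fun l => ?_⟩
  obtain rfl | hl := eq_or_ne l k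
  · rw [Pi.single_eq_same]
    omega
  · rw [Pi.single_eq_of_ne hl, hrest_zero l (Finset.mem_erase.mpr ⟨hl, Finset.mem_univ l⟩)]

/-- The exponents of the Laurent monomials that are regular on the chart `yᵢ ≠ 0` of a projective
space: those of degree zero with `yᵢ` the only variable that may occur in the denominator. -/
def chartCone {ι : Type*} [Fintype ι] (i : ι) : AddSubmonoid (ι → ℤ) where
  carrier := {a | (∀ k, k ≠ i → 0 ≤ a k) ∧ ∑ k, a k = 0}
  add_mem' ha hb := ⟨fun k hk => add_nonneg (ha.1 k hk) (hb.1 k hk), by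
    simp only [Pi.add_apply, Finset.sum_add_distrib, ha.2, hb.2, add_zero]⟩
  zero_mem' := ⟨fun _ _ => le_rfl, Finset.sum_const_zero⟩

theorem single_sub_single_mem_chartCone {ι : Type*} [Fintype ι] [DecidableEq ι] (i q : ι) :
    Pi.single q 1 - Pi.single i 1 ∈ chartCone i := by
  refine ⟨fun k hk => ?_, by simp⟩
  rw [Pi.sub_apply, Pi.single_eq_of_ne hk, sub_zero]
  rw [Pi.single_apply]
  split_ifs <;> simp

theorem exists_eq_single_of_forall_mem_chartCone {ι : Type*} [Fintype ι] [DecidableEq ι]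
    [Nontrivial ι] {b : ι → ℤ} (hb : ∀ j, b - Pi.single j 1 ∈ chartCone j) :
    ∃ l, b = Pi.single l 1 := by
  refine exists_eq_single_of_sum_eq_one (fun p => ?_) ?_
  · obtain ⟨j, hj⟩ := exists_ne p
    simpa [hj.symm] using (hb j).1 p hj.symm
  · obtain ⟨j⟩ := Nontrivial.to_nonempty (α := ι)
    simpa [Finset.sum_sub_distrib, sub_eq_zero] using (hb j).2

/-- The coefficients `d i q a` of Laurent polynomials `f i q = ∑ a, d i q a • y ^ a` with exponents
in the cones `chartCone i` such that `f i i = 0` and `f i q = f i' q - (y_q / yᵢ) f i' i`: the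
coordinates of a section of the quotient bundle. -/
structure IsQuotientCoefficients {ι M : Type*} [Fintype ι] [DecidableEq ι] [AddCommGroup M]
    (d : ι → ι → (ι → ℤ) → M) : Prop where
  self : ∀ i a, d i i a = 0
  mem_chartCone : ∀ {i q a}, d i q a ≠ 0 → a ∈ chartCone i
  change_chart : ∀ i i' q a, d i q a = d i' q a - d i' i (a - Pi.single q 1 + Pi.single i 1)

namespace IsQuotientCoefficients

variable {ι M : Type*} [Fintype ι] [DecidableEq ι] [AddCommGroup M] {d : ι → ι → (ι → ℤ) → M}
  {i q : ι}

theorem eq_zero_of_neg (hd : IsQuotientCoefficients d) {k : ι} (hk : k ≠ i) {a : ι → ℤ}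
    (ha : a k < 0) : d i q a = 0 := by
  by_contra h
  exact ha.not_ge ((hd.mem_chartCone h).1 k hk)

theorem eq_neg_swap (hd : IsQuotientCoefficients d) (i q : ι) (a : ι → ℤ) :
    d i q a = -d q i (a - Pi.single q 1 + Pi.single i 1) := by
  rw [hd.change_chart i q q, hd.self, zero_sub]

theorem apply_zero_eq_zero (hd : IsQuotientCoefficients d) (hiq : i ≠ q)
    (h : ∃ l, l ≠ q ∧ d l q 0 = 0) : d i q 0 = 0 := by
  obtain ⟨l, hlq, hl⟩ := h
  rw [hd.change_chart i l q, hl, hd.eq_zero_of_neg hlq.symm (by simp [hiq.symm]), sub_zero]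

theorem exists_eq_single_sub_single (hd : IsQuotientCoefficients d) (hiq : i ≠ q) {a : ι → ℤ}
    (ha : d i q a ≠ 0) : ∃ k, a = Pi.single k 1 - Pi.single i 1 := by
  have hi : 0 ≤ a i + 1 := by
    have hswap := ha
    rw [hd.eq_neg_swap, neg_ne_zero] at hswap
    simpa [hiq] using (hd.mem_chartCone hswap).1 i hiq
  obtain ⟨k, hk⟩ := exists_eq_single_of_sum_eq_one (c := a + Pi.single i 1)
    (fun k => by
      obtain rfl | hki := eq_or_ne k i
      · simpa using hi
      · simpa [hki] using (hd.mem_chartCone ha).1 k hki)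
    (by simp [Finset.sum_add_distrib, (hd.mem_chartCone ha).2])
  exact ⟨k, by rw [← hk, add_sub_cancel_right]⟩

theorem eq_zero (hd : IsQuotientCoefficients d) (h : ∀ q, ∃ i, i ≠ q ∧ d i q 0 = 0) (i q : ι)
    (a : ι → ℤ) : d i q a = 0 := by
  obtain rfl | hiq := eq_or_ne i q
  · exact hd.self i a
  by_contra hne
  obtain ⟨k, rfl⟩ := hd.exists_eq_single_sub_single hiq hne
  refine hne ?_
  obtain rfl | hki := eq_or_ne k i
  · rw [sub_self, hd.apply_zero_eq_zero hiq (h q)]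
  obtain rfl | hkq := eq_or_ne k q
  · rw [hd.eq_neg_swap, sub_right_comm, sub_self, zero_sub, neg_add_cancel,
      hd.apply_zero_eq_zero hiq.symm (h i), neg_zero]
  · rw [hd.change_chart i k q, hd.eq_zero_of_neg hki.symm (by simp [hki.symm]),
      hd.eq_zero_of_neg hkq.symm (by simp [hkq.symm, hiq.symm]), sub_zero]

end IsQuotientCoefficients

/-! ### Affine coordinates on `ℙᵐ × ℙⁿ` -/

/-- The `T`-valued point `k` of `ℙᵐ × ℙⁿ` lies in the chart `yᵢ ≠ 0`, `xⱼ ≠ 0` and has the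
coordinates `y` and `x`, normalized to `yᵢ = xⱼ = 1`. -/
structure HasProdCoords {m n : ℕ} {T : Scheme.{0}} (k : T ⟶ PPprod m n) (i : Fin (m + 1))
    (j : Fin (n + 1)) (y : Fin (m + 1) → Γ(T, ⊤)) (x : Fin (n + 1) → Γ(T, ⊤)) : Prop where
  le_fst : ⊤ ≤ (k ≫ pr₁ m n) ⁻¹ᵁ chart m i
  le_snd : ⊤ ≤ (k ≫ pr₂ m n) ⁻¹ᵁ chart n j
  coord_fst : coord (k ≫ pr₁ m n) le_fst = y
  coord_snd : coord (k ≫ pr₂ m n) le_snd = x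

theorem snd_comp_over {m n : ℕ} {T : Scheme.{0}} (k : T ⟶ PPprod m n) :
    (k ≫ pr₂ m n) ≫ (PP n ↘ Spec (.of ℂ)) = k ≫ (PPprod m n ↘ Spec (.of ℂ)) := by
  rw [Category.assoc, ← Limits.pullback.condition]
  rfl

theorem exists_coord_eq {n : ℕ} {T : Scheme.{0}} {f : T ⟶ PP n} {V : T.Opens}
    {u : Fin (n + 1) → Fin (n + 1) → Γ(T, V)} (hone : ∀ i, u i i = 1)
    (hmul : ∀ i j p, u i j * u j p = u i p) {i : Fin (n + 1)} (hi : V ≤ f ⁻¹ᵁ chart n i)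
    (hu : coord f hi = u i) (j : Fin (n + 1)) :
    ∃ hj : V ≤ f ⁻¹ᵁ chart n j, coord f hj = u j := by
  have hunit : IsUnit (u i j) := .of_mul_eq_one (u j i) (by rw [hmul, hone])
  have hj := le_preimage_chart_of_isUnit f hi (j := j) (by rwa [hu])
  refine ⟨hj, funext fun p => hunit.mul_left_cancel ?_⟩
  rw [hmul, ← hu, coord_mul_coord]

namespace HasProdCoords

variable {m n : ℕ} {T T' : Scheme.{0}} {k k' : T ⟶ PPprod m n} {i : Fin (m + 1)} {j : Fin (n + 1)}
  {y : Fin (m + 1) → Γ(T, ⊤)} {x : Fin (n + 1) → Γ(T, ⊤)}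

theorem hom_ext (h : HasProdCoords k i j y x) (h' : HasProdCoords k' i j y x)
    (hover : k ≫ (PPprod m n ↘ Spec (.of ℂ)) = k' ≫ (PPprod m n ↘ Spec (.of ℂ))) : k = k' := by
  refine Limits.pullback.hom_ext ?_ ?_
  · refine hom_ext_of_ratios i ?_ h.le_fst h'.le_fst fun q => ?_
    · rw [Category.assoc, Category.assoc]
      exact hover
    · exact congrFun (h.coord_fst.trans h'.coord_fst.symm) q
  · refine hom_ext_of_ratios j ?_ h.le_snd h'.le_snd fun p => ?_
    · rw [snd_comp_over, snd_comp_over, hover]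
    · exact congrFun (h.coord_snd.trans h'.coord_snd.symm) p

theorem comp (h : HasProdCoords k i j y x) (g : T' ⟶ T) :
    HasProdCoords (g ≫ k) i j (pull g (le_preimage_top g ⊤) ∘ y)
      (pull g (le_preimage_top g ⊤) ∘ x) where
  le_fst := (le_preimage_top g ⊤).trans (Scheme.Hom.preimage_mono g h.le_fst)
  le_snd := (le_preimage_top g ⊤).trans (Scheme.Hom.preimage_mono g h.le_snd)
  coord_fst := funext fun q =>
    (pull_coord _ g h.le_fst _ q).symm.trans (congrArg (pull g _) (congrFun h.coord_fst q))
  coord_snd := funext fun p =>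
    (pull_coord _ g h.le_snd _ p).symm.trans (congrArg (pull g _) (congrFun h.coord_snd p))

theorem change_chart {y : Fin (m + 1) → Fin (m + 1) → Γ(T, ⊤)}
    {x : Fin (n + 1) → Fin (n + 1) → Γ(T, ⊤)} (h : HasProdCoords k i j (y i) (x j))
    (hy : ∀ i, y i i = 1) (hymul : ∀ i j p, y i j * y j p = y i p)
    (hx : ∀ j, x j j = 1) (hxmul : ∀ i j p, x i j * x j p = x i p) (i' : Fin (m + 1))
    (j' : Fin (n + 1)) : HasProdCoords k i' j' (y i') (x j') := by
  obtain ⟨hi', hy'⟩ := exists_coord_eq hy hymul h.le_fst h.coord_fst i'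
  obtain ⟨hj', hx'⟩ := exists_coord_eq hx hxmul h.le_snd h.coord_snd j'
  exact ⟨hi', hj', hy', hx'⟩

theorem fst_self (h : HasProdCoords k i j y x) : y i = 1 := by rw [← h.coord_fst, coord_self]

theorem snd_self (h : HasProdCoords k i j y x) : x j = 1 := by rw [← h.coord_snd, coord_self]

theorem le_preimage (h : HasProdCoords k i j y x) : ⊤ ≤ k ⁻¹ᵁ prodChart m n i j :=
  fun _ ht => ⟨h.le_fst ht, h.le_snd ht⟩

end HasProdCoords

section

variable {m n : ℕ} (i : Fin (m + 1)) (j : Fin (n + 1))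

theorem exists_hasProdCoords {T : Scheme.{0}} (τ : T ⟶ Spec (.of ℂ))
    {y : Fin (m + 1) → Γ(T, ⊤)} {x : Fin (n + 1) → Γ(T, ⊤)} (hy : y i = 1) (hx : x j = 1) :
    ∃ k : T ⟶ PPprod m n, k ≫ (PPprod m n ↘ Spec (.of ℂ)) = τ ∧ HasProdCoords k i j y x := by
  obtain ⟨Y, hYτ, hYi, hY⟩ := exists_hom_of_ratios τ i hy
  obtain ⟨X, hXτ, hXj, hX⟩ := exists_hom_of_ratios τ j hx
  let k : T ⟶ PPprod m n := Limits.pullback.lift Y X (hYτ.trans hXτ.symm)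
  have hk₁ : k ≫ pr₁ m n = Y := Limits.pullback.lift_fst _ _ _
  have hk₂ : k ≫ pr₂ m n = X := Limits.pullback.lift_snd _ _ _
  refine ⟨k, by rw [← snd_comp_over, hk₂, hXτ], by rwa [hk₁], by rwa [hk₂], ?_, ?_⟩
  · exact funext fun q => (coord_congr hk₁ _ hYi q).trans (hY q)
  · exact funext fun p => (coord_congr hk₂ _ hXj p).trans (hX p)

theorem exists_hasProdCoords_prodChartι :
    ∃ y x, HasProdCoords (prodChart m n i j).ι i j y x :=
  ⟨_, _, (le_ι_preimage _).trans (Scheme.Hom.preimage_mono _ inf_le_left),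
    (le_ι_preimage _).trans (Scheme.Hom.preimage_mono _ inf_le_right), rfl, rfl⟩

end

/-! ### Laurent polynomials on `ℙᵐ × ℙⁿ` -/

section Cones

variable {ι : Type*} [Fintype ι] {i : ι} {R : Type*} [CommRing R] {y : ι → R}

/-- The values of the Laurent monomials with exponents in `chartCone i` at a point `y` with
`yᵢ = 1`. The exponent of `yᵢ` may be negative, but then is truncated to zero. -/
def monomialEval (hy : y i = 1) : chartCone i →+ Additive R where
  toFun a := .ofMul (∏ q, y q ^ (a.1 q).toNat)
  map_zero' := by simp
  map_add' a b := by
    refine congrArg Additive.ofMul (Eq.trans ?_ Finset.prod_mul_distrib)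
    refine Finset.prod_congr rfl fun q _ => ?_
    obtain rfl | hq := eq_or_ne q i
    · rw [hy, one_pow, one_pow, one_pow, one_mul]
    · rw [← pow_add, ← Int.toNat_add (a.2.1 q hq) (b.2.1 q hq)]
      rfl

theorem monomialEval_single [DecidableEq ι] (hy : y i = 1) (q : ι) :
    (monomialEval hy ⟨_, single_sub_single_mem_chartCone i q⟩).toMul = y q := by
  change ∏ p, y p ^ ((Pi.single q 1 - Pi.single i 1 : ι → ℤ) p).toNat = y q
  rw [Finset.prod_eq_single q _ fun hq => (hq (Finset.mem_univ q)).elim]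
  · obtain rfl | hq := eq_or_ne q i
    · rw [hy, one_pow]
    · simp [hq]
  · intro p _ hp
    obtain rfl | hi := eq_or_ne p i
    · rw [hy, one_pow]
    · simp [hp, hi]

end Cones

section

variable {m n : ℕ} (i : Fin (m + 1)) (j : Fin (n + 1))

/-- The monoid algebra of the Laurent monomials in `y₀, …, yₘ` and `x₀, …, xₙ` that are regular on
the chart `yᵢ ≠ 0`, `xⱼ ≠ 0`. -/
abbrev ConeRing : CommRingCat.{0} := .of (AddMonoidAlgebra ℂ (chartCone i × chartCone j))

/-- The function `y_q / yᵢ`. -/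
def coneFst (q : Fin (m + 1)) : ConeRing i j :=
  AddMonoidAlgebra.single (⟨_, single_sub_single_mem_chartCone i q⟩, 0) (1 : ℂ)

/-- The function `xₚ / xⱼ`. -/
def coneSnd (p : Fin (n + 1)) : ConeRing i j :=
  AddMonoidAlgebra.single (0, ⟨_, single_sub_single_mem_chartCone j p⟩) (1 : ℂ)

theorem coneFst_self : coneFst i j i = 1 :=
  congrArg (fun a => AddMonoidAlgebra.single a (1 : ℂ))
    (Prod.ext (Subtype.ext (sub_self _)) rfl)

theorem coneSnd_self : coneSnd i j j = 1 :=
  congrArg (fun a => AddMonoidAlgebra.single a (1 : ℂ))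
    (Prod.ext rfl (Subtype.ext (sub_self _)))

variable {i j} in
theorem exists_coneRing_hom {R : Type*} [CommRing R] (ρ : ℂ →+* R) {y : Fin (m + 1) → R}
    {x : Fin (n + 1) → R} (hy : y i = 1) (hx : x j = 1) :
    ∃ φ : ConeRing i j →+* R, φ.comp AddMonoidAlgebra.singleZeroRingHom = ρ ∧
      φ ∘ coneFst i j = y ∧ φ ∘ coneSnd i j = x := by
  let g : Multiplicative (chartCone i × chartCone j) →* R :=
    ((monomialEval hy).coprod (monomialEval hx)).toMultiplicativeLeft
  have hcomm (c : ℂ) (e) : Commute (ρ c) (g e) := Commute.all _ _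
  refine ⟨AddMonoidAlgebra.liftNCRingHom ρ g hcomm,
    RingHom.ext fun c => ?_, funext fun q => ?_, funext fun p => ?_⟩
  · refine (AddMonoidAlgebra.liftNCRingHom_single ρ g hcomm 0 c).trans ?_
    exact (congrArg (ρ c * ·) (map_one g)).trans (mul_one _)
  · refine (AddMonoidAlgebra.liftNCRingHom_single ρ g hcomm _ 1).trans ?_
    rw [map_one, one_mul]
    refine Eq.trans ?_ (monomialEval_single hy q)
    exact congrArg Additive.toMul (by simp)
  · refine (AddMonoidAlgebra.liftNCRingHom_single ρ g hcomm _ 1).trans ?_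
    rw [map_one, one_mul]
    refine Eq.trans ?_ (monomialEval_single hx p)
    exact congrArg Additive.toMul (by simp)

/-- The structure morphism of `Spec ℂ[S]`, for a monoid `S`. -/
def monoidAlgebraStr (S : Type) [AddCommMonoid S] :
    Spec (.of (AddMonoidAlgebra ℂ S)) ⟶ Spec (.of ℂ) :=
  Spec.map (CommRingCat.ofHom AddMonoidAlgebra.singleZeroRingHom)

theorem scalar_monoidAlgebraStr (S : Type) [AddCommMonoid S] (c : ℂ) :
    scalar (monoidAlgebraStr S) ⊤ c =
      specFun (.of (AddMonoidAlgebra ℂ S)) (AddMonoidAlgebra.single 0 c) :=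
  scalar_specMap (R := .of (AddMonoidAlgebra ℂ S)) _ c

theorem exists_coneChart : ∃ k : Spec (ConeRing i j) ⟶ PPprod m n,
    k ≫ (PPprod m n ↘ Spec (.of ℂ)) = monoidAlgebraStr _ ∧
      HasProdCoords k i j (specFun _ ∘ coneFst i j) (specFun _ ∘ coneSnd i j) :=
  exists_hasProdCoords i j _ (by rw [Function.comp_apply, coneFst_self, map_one])
    (by rw [Function.comp_apply, coneSnd_self, map_one])

/-- The inclusion of the chart `yᵢ ≠ 0`, `xⱼ ≠ 0` into `ℙᵐ × ℙⁿ`. -/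
def coneChart : Spec (ConeRing i j) ⟶ PPprod m n := (exists_coneChart i j).choose

theorem coneChart_over :
    coneChart i j ≫ (PPprod m n ↘ Spec (.of ℂ)) = monoidAlgebraStr _ :=
  (exists_coneChart i j).choose_spec.1

theorem hasProdCoords_coneChart :
    HasProdCoords (coneChart i j) i j (specFun _ ∘ coneFst i j) (specFun _ ∘ coneSnd i j) :=
  (exists_coneChart i j).choose_spec.2

variable {i j} in
theorem HasProdCoords.exists_factor {T : Scheme.{0}} {k : T ⟶ PPprod m n}
    {y : Fin (m + 1) → Γ(T, ⊤)} {x : Fin (n + 1) → Γ(T, ⊤)} (h : HasProdCoords k i j y x) :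
    ∃ b : T ⟶ Spec (ConeRing i j), b ≫ coneChart i j = k := by
  obtain ⟨φ, hφ, hφy, hφx⟩ := exists_coneRing_hom (scalar (k ≫ (PPprod m n ↘ Spec (.of ℂ))) ⊤)
    h.fst_self h.snd_self
  obtain ⟨b, hb⟩ := exists_hom_Spec φ
  have hcomp {κ : Type} (u : κ → ConeRing i j) :
      pull b (le_preimage_top b ⊤) ∘ (specFun _ ∘ u) = φ ∘ u := funext fun q => hb (u q)
  have hcoords := (hasProdCoords_coneChart i j).comp b
  rw [hcomp, hcomp, hφy, hφx] at hcoords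
  refine ⟨b, hcoords.hom_ext h (hom_Spec_complex_ext fun c => ?_)⟩
  rw [Category.assoc, coneChart_over, ← pull_scalar b _ (le_preimage_top b ⊤),
    scalar_monoidAlgebraStr, hb, ← hφ]
  rfl

theorem pull_coneChart_injective : Function.Injective
    (pull (coneChart i j) (hasProdCoords_coneChart i j).le_preimage) := by
  obtain ⟨_, _, hι⟩ := exists_hasProdCoords_prodChartι i j
  obtain ⟨b, hb⟩ := hι.exists_factor
  exact pull_injective_of_factor _ _ b (le_preimage_top b ⊤) hb

end

section Torus

variable {m n : ℕ}

/-- Exponents of Laurent monomials in `y₀, …, yₘ` and `x₀, …, xₙ`. -/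
abbrev Exponent (m n : ℕ) : Type := (Fin (m + 1) → ℤ) × (Fin (n + 1) → ℤ)

/-- The ring of Laurent polynomials in `y₀, …, yₘ` and `x₀, …, xₙ`. -/
abbrev laurent (m n : ℕ) : CommRingCat.{0} := .of (AddMonoidAlgebra ℂ (Exponent m n))

/-- Laurent monomials. -/
def monomial (e : Exponent m n) : laurent m n := AddMonoidAlgebra.single e (1 : ℂ)

/-- The exponent of `y_q / yᵢ`. -/
def yExp (i q : Fin (m + 1)) : Exponent m n := (Pi.single q 1 - Pi.single i 1, 0)

/-- The exponent of `xₚ / xⱼ`. -/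
def xExp (j p : Fin (n + 1)) : Exponent m n := (0, Pi.single p 1 - Pi.single j 1)

theorem monomial_mul (e e' : Exponent m n) : monomial e * monomial e' = monomial (e + e') :=
  (AddMonoidAlgebra.single_mul_single _ _ _ _).trans
    (congrArg (AddMonoidAlgebra.single (e + e')) (mul_one (1 : ℂ)))

theorem monomial_yExp_self (i : Fin (m + 1)) : monomial (yExp i i : Exponent m n) = 1 :=
  congrArg monomial (Prod.ext (sub_self _) rfl)

theorem monomial_xExp_self (j : Fin (n + 1)) : monomial (xExp j j : Exponent m n) = 1 :=
  congrArg monomial (Prod.ext rfl (sub_self _))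

theorem monomial_yExp_mul (i k q : Fin (m + 1)) :
    monomial (yExp i k : Exponent m n) * monomial (yExp k q) = monomial (yExp i q) := by
  rw [monomial_mul, yExp, yExp, Prod.mk_add_mk, sub_add_sub_cancel', add_zero, yExp]

theorem monomial_xExp_mul (j k p : Fin (n + 1)) :
    monomial (xExp j k : Exponent m n) * monomial (xExp k p) = monomial (xExp j p) := by
  rw [monomial_mul, xExp, xExp, Prod.mk_add_mk, sub_add_sub_cancel', add_zero, xExp]

theorem coeff_monomial_mul (e₀ e : Exponent m n) (x : laurent m n) :
    AddMonoidAlgebra.coeff (monomial e₀ * x : laurent m n) e =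
      AddMonoidAlgebra.coeff x (-e₀ + e) :=
  (AddMonoidAlgebra.coeff_single_mul_apply _ _ _ _).trans (one_mul _)

/-- The inclusion into the Laurent polynomials of those that are regular on the chart `yᵢ ≠ 0`,
`xⱼ ≠ 0`. -/
def coneToLaurent (i : Fin (m + 1)) (j : Fin (n + 1)) : ConeRing i j →+* laurent m n :=
  AddMonoidAlgebra.mapDomainRingHom ℂ ((chartCone i).subtype.prodMap (chartCone j).subtype)

theorem coneToLaurent_injective (i : Fin (m + 1)) (j : Fin (n + 1)) :
    Function.Injective (coneToLaurent i j) :=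
  AddMonoidAlgebra.mapDomain_injective
    (Function.Injective.prodMap Subtype.val_injective Subtype.val_injective)

theorem coneToLaurent_comp_coneFst (i : Fin (m + 1)) (j : Fin (n + 1)) :
    coneToLaurent i j ∘ coneFst i j = monomial ∘ yExp i :=
  funext fun _ => AddMonoidAlgebra.mapDomain_single

theorem coneToLaurent_comp_coneSnd (i : Fin (m + 1)) (j : Fin (n + 1)) :
    coneToLaurent i j ∘ coneSnd i j = monomial ∘ xExp j :=
  funext fun _ => AddMonoidAlgebra.mapDomain_single

theorem coeff_coneToLaurent_eq_zero {i : Fin (m + 1)} {j : Fin (n + 1)} (f : ConeRing i j)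
    {e : Exponent m n} (he : ¬(e.1 ∈ chartCone i ∧ e.2 ∈ chartCone j)) :
    AddMonoidAlgebra.coeff (coneToLaurent i j f) e = 0 := by
  refine Finsupp.mapDomain_of_notMem_range _ _ ?_
  rintro ⟨a, rfl⟩
  exact he ⟨a.1.2, a.2.2⟩

theorem specMap_coneToLaurent_over (i : Fin (m + 1)) (j : Fin (n + 1)) :
    Spec.map (CommRingCat.ofHom (coneToLaurent i j)) ≫ monoidAlgebraStr _ =
      monoidAlgebraStr (Exponent m n) := by
  refine hom_Spec_complex_ext fun c => ?_
  rw [← pull_scalar _ _ (le_preimage_top _ ⊤), scalar_monoidAlgebraStr, scalar_monoidAlgebraStr,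
    pull_specMap]
  exact congrArg (specFun (laurent m n)) AddMonoidAlgebra.mapDomain_single

theorem hasProdCoords_specMap_comp_coneChart (i : Fin (m + 1)) (j : Fin (n + 1)) :
    HasProdCoords (Spec.map (CommRingCat.ofHom (coneToLaurent i j)) ≫ coneChart i j) i j
      (specFun (laurent m n) ∘ monomial ∘ yExp i) (specFun (laurent m n) ∘ monomial ∘ xExp j) := by
  have hpull {κ : Type} (u : κ → ConeRing i j) :
      pull (Spec.map (CommRingCat.ofHom (coneToLaurent i j))) (le_preimage_top _ ⊤) ∘
        (specFun _ ∘ u) = specFun (laurent m n) ∘ coneToLaurent i j ∘ u :=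
    funext fun q => pull_specMap _ (u q)
  have hcoords := (hasProdCoords_coneChart i j).comp
    (Spec.map (CommRingCat.ofHom (coneToLaurent i j)))
  rwa [hpull, hpull, coneToLaurent_comp_coneFst, coneToLaurent_comp_coneSnd] at hcoords

/-- The map `(ℂˣ)ᵐ⁺¹ × (ℂˣ)ⁿ⁺¹ → ℙᵐ × ℙⁿ` given by the homogeneous coordinates. -/
def torus (m n : ℕ) : Spec (laurent m n) ⟶ PPprod m n :=
  Spec.map (CommRingCat.ofHom (coneToLaurent 0 0)) ≫ coneChart 0 0

theorem hasProdCoords_torus (i : Fin (m + 1)) (j : Fin (n + 1)) :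
    HasProdCoords (torus m n) i j (specFun (laurent m n) ∘ monomial ∘ yExp i)
      (specFun (laurent m n) ∘ monomial ∘ xExp j) := by
  refine (hasProdCoords_specMap_comp_coneChart 0 0).change_chart
    (y := fun i => specFun (laurent m n) ∘ monomial ∘ yExp i)
    (x := fun j => specFun (laurent m n) ∘ monomial ∘ xExp j) ?_ ?_ ?_ ?_ i j
  · intro i
    simp only [Function.comp_apply, monomial_yExp_self, map_one]
  · intro i k q
    exact (map_mul _ _ _).symm.trans (congrArg _ (monomial_yExp_mul i k q))
  · intro j
    simp only [Function.comp_apply, monomial_xExp_self, map_one]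
  · intro j k p
    exact (map_mul _ _ _).symm.trans (congrArg _ (monomial_xExp_mul j k p))

theorem torus_over :
    torus m n ≫ (PPprod m n ↘ Spec (.of ℂ)) = monoidAlgebraStr (Exponent m n) := by
  rw [torus, Category.assoc, coneChart_over, specMap_coneToLaurent_over]

theorem specMap_comp_coneChart (i : Fin (m + 1)) (j : Fin (n + 1)) :
    Spec.map (CommRingCat.ofHom (coneToLaurent i j)) ≫ coneChart i j = torus m n := by
  refine (hasProdCoords_specMap_comp_coneChart i j).hom_ext (hasProdCoords_torus i j) ?_
  rw [Category.assoc, coneChart_over, specMap_coneToLaurent_over, torus_over]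

end Torus

section Coefficients

variable {m n : ℕ} (i : Fin (m + 1)) (j : Fin (n + 1))

theorem exists_coneToLaurent_eq (a : Γ(PPprod m n, prodChart m n i j)) :
    ∃ f : ConeRing i j, specFun _ f = pull (coneChart i j)
      (hasProdCoords_coneChart i j).le_preimage a ∧ specFun (laurent m n) (coneToLaurent i j f) =
        pull (torus m n) (hasProdCoords_torus i j).le_preimage a := by
  obtain ⟨f, hf⟩ := (specFun_bijective (ConeRing i j)).2
    (pull (coneChart i j) (hasProdCoords_coneChart i j).le_preimage a)
  refine ⟨f, hf, ?_⟩
  rw [← pull_specMap, hf, pull_pull]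
  exact pull_congr (specMap_comp_coneChart i j) _ _ a

/-- The Laurent polynomial of a function on a chart of `ℙᵐ × ℙⁿ`. -/
def toLaurent : Γ(PPprod m n, prodChart m n i j) →+* laurent m n :=
  (RingEquiv.ofBijective _ (specFun_bijective (laurent m n))).symm.toRingHom.comp
    (pull (torus m n) (hasProdCoords_torus i j).le_preimage)

theorem specFun_toLaurent (a : Γ(PPprod m n, prodChart m n i j)) :
    specFun (laurent m n) (toLaurent i j a) =
      pull (torus m n) (hasProdCoords_torus i j).le_preimage a :=
  (RingEquiv.ofBijective _ (specFun_bijective (laurent m n))).apply_symm_apply _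

variable {i j}

theorem toLaurent_eq_iff {a : Γ(PPprod m n, prodChart m n i j)} {x : laurent m n} :
    toLaurent i j a = x ↔
      pull (torus m n) (hasProdCoords_torus i j).le_preimage a = specFun (laurent m n) x := by
  rw [← specFun_toLaurent]
  exact (specFun_bijective (laurent m n)).1.eq_iff.symm

theorem eq_zero_of_toLaurent_eq_zero {a : Γ(PPprod m n, prodChart m n i j)}
    (ha : toLaurent i j a = 0) : a = 0 := by
  obtain ⟨f, hf, hfa⟩ := exists_coneToLaurent_eq i j a
  have hf_zero : f = 0 := (map_eq_zero_iff _ (coneToLaurent_injective i j)).mp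
    ((toLaurent_eq_iff.mpr hfa.symm).symm.trans ha)
  rw [hf_zero, map_zero] at hf
  exact (map_eq_zero_iff _ (pull_coneChart_injective i j)).mp hf.symm

theorem toLaurent_smul (c : ℂ) (a : Γ(PPprod m n, prodChart m n i j)) :
    toLaurent i j (c • a) =
      (AddMonoidAlgebra.single 0 c : AddMonoidAlgebra ℂ (Exponent m n)) * toLaurent i j a := by
  rw [toLaurent_eq_iff, smul_eq_scalar_mul, map_mul, pull_scalar, map_mul, specFun_toLaurent,
    torus_over, scalar_monoidAlgebraStr]

variable (i j) in
/-- The coefficient of a Laurent monomial in a function on a chart of `ℙᵐ × ℙⁿ`. -/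
def coefficient (e : Exponent m n) : Module.Dual ℂ Γ(PPprod m n, prodChart m n i j) where
  toFun a := AddMonoidAlgebra.coeff (toLaurent i j a) e
  map_add' a b := by
    rw [map_add]
    rfl
  map_smul' c a := by
    rw [toLaurent_smul]
    exact AddMonoidAlgebra.coeff_single_zero_mul _ _ _

theorem eq_zero_of_coefficient {a : Γ(PPprod m n, prodChart m n i j)}
    (h : ∀ e, coefficient i j e a = 0) : a = 0 :=
  eq_zero_of_toLaurent_eq_zero (AddMonoidAlgebra.coeff_injective (Finsupp.ext h))

theorem mem_chartCone_of_coefficient_ne_zero {a : Γ(PPprod m n, prodChart m n i j)}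
    {e : Exponent m n} (h : coefficient i j e a ≠ 0) : e.1 ∈ chartCone i ∧ e.2 ∈ chartCone j := by
  obtain ⟨f, -, hf⟩ := exists_coneToLaurent_eq i j a
  by_contra he
  refine h ?_
  rw [coefficient, LinearMap.coe_mk, AddHom.coe_mk, toLaurent_eq_iff.mpr hf.symm,
    coeff_coneToLaurent_eq_zero f he]

end Coefficients

section Compatible

variable {m n : ℕ} {c : ∀ (i : Fin (m + 1)) (j : Fin (n + 1)),
  Fin (m + 1) → Γ(PPprod m n, prodChart m n i j)}

theorem toLaurent_of_isCompatible (hc : IsCompatible c) (i i' : Fin (m + 1)) (j j' : Fin (n + 1))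
    (q : Fin (m + 1)) : toLaurent i j (c i j q) = monomial (xExp j j') *
      (toLaurent i' j' (c i' j' q) - monomial (yExp i q) * toLaurent i' j' (c i' j' i)) := by
  have hO : ⊤ ≤ torus m n ⁻¹ᵁ (prodChart m n i j ⊓ prodChart m n i' j') :=
    fun t ht => ⟨(hasProdCoords_torus i j).le_preimage ht,
      (hasProdCoords_torus i' j').le_preimage ht⟩
  have hpull := congrArg (pull (torus m n) hO) (hc i i' j j' q)
  rw [map_mul, map_sub, map_mul, pull_res, pull_res, pull_res, pull_coord, pull_coord] at hpull
  rw [toLaurent_eq_iff, map_mul, map_sub, map_mul, specFun_toLaurent, specFun_toLaurent, hpull]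
  exact congrArg₂ (fun u v => v * (_ - u * _))
    (congrFun (hasProdCoords_torus i j).coord_fst q)
    (congrFun (hasProdCoords_torus i j).coord_snd j')

theorem coefficient_of_isCompatible (hc : IsCompatible c) (i i' : Fin (m + 1))
    (j j' : Fin (n + 1)) (q : Fin (m + 1)) (a : Fin (m + 1) → ℤ) (b : Fin (n + 1) → ℤ) :
    coefficient i j (a, b - Pi.single j 1) (c i j q) =
      coefficient i' j' (a, b - Pi.single j' 1) (c i' j' q) - coefficient i' j'
        (a - Pi.single q 1 + Pi.single i 1, b - Pi.single j' 1) (c i' j' i) := by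
  have hx : -xExp j j' + (a, b - Pi.single j 1) = (a, b - Pi.single j' 1) :=
    Prod.ext (by simp [xExp]) (by simp only [xExp, Prod.snd_add, Prod.snd_neg]; abel)
  have hy : -yExp i q + (a, b - Pi.single j' 1) =
      (a - Pi.single q 1 + Pi.single i 1, b - Pi.single j' 1) :=
    Prod.ext (by simp only [yExp, Prod.fst_add, Prod.fst_neg]; abel) (by simp [yExp])
  change AddMonoidAlgebra.coeff (toLaurent i j (c i j q)) _ = _
  rw [toLaurent_of_isCompatible hc i i' j j' q, coeff_monomial_mul, hx, ← hy]
  exact congrArg (coefficient i' j' (a, b - Pi.single j' 1) (c i' j' q) - ·)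
    (coeff_monomial_mul _ _ _)

theorem coefficient_change_snd (hc : IsCompatible c) (hself : ∀ i j, c i j i = 0)
    (i : Fin (m + 1)) (j j' : Fin (n + 1)) (q : Fin (m + 1)) (a : Fin (m + 1) → ℤ)
    (b : Fin (n + 1) → ℤ) : coefficient i j (a, b - Pi.single j 1) (c i j q) =
      coefficient i j' (a, b - Pi.single j' 1) (c i j' q) := by
  rw [coefficient_of_isCompatible hc i i j j', hself, map_zero, sub_zero]

theorem isQuotientCoefficients_coefficient (hc : IsCompatible c) (hself : ∀ i j, c i j i = 0)
    (j : Fin (n + 1)) (b : Fin (n + 1) → ℤ) :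
    IsQuotientCoefficients fun i q a => coefficient i j (a, b - Pi.single j 1) (c i j q) where
  self i a := by rw [hself, map_zero]
  mem_chartCone h := (mem_chartCone_of_coefficient_ne_zero h).1
  change_chart i i' q a := coefficient_of_isCompatible hc i i' j j q a b

/-- Linear forms in `x` have only the coefficients at `xₗ`, and `IsQuotientCoefficients.eq_zero`
applies to each of them. -/
theorem eq_zero_of_isCompatible (hn : 0 < n) (hc : IsCompatible c) (hself : ∀ i j, c i j i = 0)
    (hcoeff : ∀ q l, ∃ i, i ≠ q ∧ coefficient i 0 (xExp 0 l) (c i 0 q) = 0)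
    (i : Fin (m + 1)) (j : Fin (n + 1)) (q : Fin (m + 1)) : c i j q = 0 := by
  have : Nontrivial (Fin (n + 1)) := Fin.nontrivial_iff_two_le.mpr (by omega)
  refine eq_zero_of_coefficient ?_
  rintro ⟨a, b⟩
  obtain ⟨b, rfl⟩ : ∃ b', b = b' - Pi.single j 1 := ⟨b + Pi.single j 1, by simp⟩
  by_contra hne
  obtain ⟨l, rfl⟩ := exists_eq_single_of_forall_mem_chartCone (b := b) fun j' =>
    (mem_chartCone_of_coefficient_ne_zero
      (coefficient_change_snd hc hself i j j' q a b ▸ hne)).2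
  refine hne ?_
  rw [coefficient_change_snd hc hself i j 0 q]
  exact (isQuotientCoefficients_coefficient hc hself 0 (Pi.single l 1)).eq_zero
    (fun q => hcoeff q l) i q a

end Compatible

/-! ### The global sections of `Q(0,1)` -/

section

variable {m n : ℕ}

theorem extCoord_add (s t : (Q01 m n).globalSections) (i : Fin (m + 1)) (j : Fin (n + 1))
    (q : Fin (m + 1)) : extCoord (s + t) i j q = extCoord s i j q + extCoord t i j q := by
  unfold extCoord
  split_ifs
  · rfl
  · rw [add_zero]

theorem extCoord_smul (c : ℂ) (s : (Q01 m n).globalSections) (i : Fin (m + 1)) (j : Fin (n + 1))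
    (q : Fin (m + 1)) : extCoord (c • s) i j q = c • extCoord s i j q := by
  unfold extCoord
  split_ifs
  · rfl
  · rw [smul_zero]

/-- The entries of the matrix of a section of `Q(0,1)`, read off on the chart `y_{q+1} ≠ 0`,
`x₀ ≠ 0`; any chart `yᵢ ≠ 0` with `i ≠ q` would do, as long as there is one. -/
def matrixEntry (q : Fin (m + 1)) (l : Fin (n + 1)) : Module.Dual ℂ (Q01 m n).globalSections where
  toFun s := coefficient (q + 1) 0 (xExp 0 l) (extCoord s (q + 1) 0 q)
  map_add' s t := by rw [extCoord_add, map_add]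
  map_smul' c s := by
    rw [extCoord_smul, map_smul]
    rfl

theorem toLaurent_coord_fst (i q : Fin (m + 1)) (j : Fin (n + 1)) :
    toLaurent i j (coord (pr₁ m n) inf_le_left q) = monomial (yExp i q) := by
  rw [toLaurent_eq_iff, pull_coord]
  exact congrFun (hasProdCoords_torus i j).coord_fst q

theorem toLaurent_formValues (A : Matrix (Fin (m + 1)) (Fin (n + 1)) ℂ) (i : Fin (m + 1))
    (j : Fin (n + 1)) (q : Fin (m + 1)) :
    toLaurent i j (formValues A (pr₂ m n) inf_le_right q) =
      (∑ p, AddMonoidAlgebra.single (xExp j p) (A q p) :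
        AddMonoidAlgebra ℂ (Exponent m n)) := by
  rw [toLaurent_eq_iff, pull_formValues, formValues, snd_comp_over, torus_over, Matrix.mulVec,
    dotProduct, map_sum]
  refine Finset.sum_congr rfl fun p _ => ?_
  rw [Matrix.map_apply, scalar_monoidAlgebraStr, (hasProdCoords_torus i j).coord_snd]
  refine (map_mul _ _ _).symm.trans (congrArg _ ?_)
  refine (AddMonoidAlgebra.single_mul_single _ _ _ _).trans ?_
  rw [zero_add, mul_one]

theorem single_one_injective {ι : Type*} [DecidableEq ι] :
    Function.Injective fun k : ι => (Pi.single k 1 : ι → ℤ) :=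
  fun k l h => by simpa [Pi.single_apply] using congrFun h k

theorem coeff_toLaurent_formValues (A : Matrix (Fin (m + 1)) (Fin (n + 1)) ℂ) (i : Fin (m + 1))
    (q : Fin (m + 1)) (j l : Fin (n + 1)) (a : Fin (m + 1) → ℤ) :
    AddMonoidAlgebra.coeff (toLaurent i j (formValues A (pr₂ m n) inf_le_right q))
      (a, Pi.single l 1 - Pi.single j 1) = if a = 0 then A q l else 0 := by
  rw [toLaurent_formValues, AddMonoidAlgebra.coeff_sum, Finsupp.finsetSum_apply]
  simp only [AddMonoidAlgebra.coeff_single, Finsupp.single_apply, xExp, Prod.mk.injEq,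
    sub_left_inj, single_one_injective.eq_iff]
  obtain rfl | ha := eq_or_ne a 0
  · simp
  · simp [ha, ha.symm]

theorem coefficient_matrixCoord (A : Matrix (Fin (m + 1)) (Fin (n + 1)) ℂ) {i q : Fin (m + 1)}
    (hiq : i ≠ q) (j l : Fin (n + 1)) :
    coefficient i j (xExp j l) (matrixCoord A i j q) = A q l := by
  have hexp : -yExp i q + xExp j l = ((Pi.single i 1 - Pi.single q 1,
      Pi.single l 1 - Pi.single j 1) : Exponent m n) := by
    simp [yExp, xExp]
  have hne : (Pi.single i 1 - Pi.single q 1 : Fin (m + 1) → ℤ) ≠ 0 :=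
    sub_ne_zero.mpr (single_one_injective.ne hiq)
  change AddMonoidAlgebra.coeff (toLaurent i j (_ - _ * _)) _ = _
  rw [map_sub, map_mul, toLaurent_coord_fst, AddMonoidAlgebra.coeff_sub, Finsupp.sub_apply,
    coeff_monomial_mul, hexp, coeff_toLaurent_formValues, if_neg hne, xExp,
    coeff_toLaurent_formValues, if_pos rfl, sub_zero]

theorem add_one_ne_self (hm : 0 < m) (q : Fin (m + 1)) : q + 1 ≠ q := by
  rw [Ne, add_eq_left, Fin.one_eq_zero_iff]
  omega

theorem matrixEntry_eq (hm : 0 < m) {A : Matrix (Fin (m + 1)) (Fin (n + 1)) ℂ}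
    {s : (Q01 m n).globalSections} (hs : IsMatrixSection A s) (q : Fin (m + 1))
    (l : Fin (n + 1)) : matrixEntry q l s = A q l := by
  have hq := add_one_ne_self hm q
  have hcoord : extCoord s (q + 1) 0 q = matrixCoord A (q + 1) 0 q :=
    (extCoord_of_ne s _ 0 ⟨q, hq.symm⟩).trans (hs _ _ _)
  change coefficient _ _ _ (extCoord s (q + 1) 0 q) = _
  rw [hcoord, coefficient_matrixCoord A hq]

theorem isMatrixSection_matrixEntry (hm : 0 < m) (hn : 0 < n) (s : (Q01 m n).globalSections) :
    IsMatrixSection (.of fun q l => matrixEntry q l s) s := by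
  obtain ⟨t, ht⟩ := exists_isMatrixSection (.of fun q l => matrixEntry q l s)
  have hentry (q l) : matrixEntry q l (s - t) = 0 := by
    rw [map_sub, matrixEntry_eq hm ht, Matrix.of_apply, sub_self]
  have hcoord := eq_zero_of_isCompatible hn (isCompatible_extCoord (s - t)) (extCoord_self _)
    fun q l => ⟨q + 1, add_one_ne_self hm q, hentry q l⟩
  intro i j q
  rw [← ht i j q, ← sub_eq_zero]
  exact (extCoord_of_ne (s - t) i j q).symm.trans (hcoord i j q)

end

/-! ### General sections -/

section

variable {m n : ℕ}

theorem exists_iso_zeroLocus {A : Matrix (Fin (m + 1)) (Fin (n + 1)) ℂ}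
    {B : Matrix (Fin (n + 1)) (Fin (m + 1)) ℂ} (hAB : A * B = 1)
    {s : (Q01 m n).globalSections} (hs : IsMatrixSection A s)
    (L : Submodule ℂ (Fin (n + 1) → ℂ)) (hL : Module.finrank ℂ L + m = n) {Y : Scheme.{0}}
    {π : Y ⟶ PP n} (hπ : IsBlowUp (linearSubspaceIdeal n L) π) :
    Nonempty (Over.mk (π ≫ (PP n ↘ Spec (.of ℂ))) ≅
      Over.mk ((Q01 m n).zeroLocusι s ≫ (PPprod m n ↘ Spec (.of ℂ)))) := by
  have hcard : Module.finrank ℂ L + Fintype.card (Fin (m + 1)) = Fintype.card (Fin (n + 1)) := by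
    simp only [Fintype.card_fin]
    omega
  obtain ⟨g, g', hg, rfl⟩ := exists_matrix_mul_ker_eq hAB L hcard
  rw [← snd_comp_over]
  exact exists_iso_of_isBlowUp hg hπ (isBlowUp_zeroLocus hAB hs)

theorem exists_mul_eq_one_of_isUnit_det {ι κ R : Type*} [CommRing R] [Fintype ι] [DecidableEq ι]
    [Fintype κ] {A : Matrix ι κ R} {f : ι → κ}
    (h : IsUnit (A.submatrix id f).det) : ∃ B : Matrix κ ι R, A * B = 1 := by
  classical
  refine ⟨(1 : Matrix κ κ R).submatrix id f * (A.submatrix id f)⁻¹, ?_⟩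
  have hsub : A * (1 : Matrix κ κ R).submatrix id f = A.submatrix id f := by
    exact Matrix.mul_submatrix_one (Equiv.refl κ) f A
  rw [← Matrix.mul_assoc, hsub, Matrix.mul_nonsing_inv _ h]

theorem isMatrixSection_zero (A : Matrix (Fin 1) (Fin (n + 1)) ℂ)
    (s : (Q01 0 n).globalSections) : IsMatrixSection A s :=
  fun _ _ q => (q.2 (Subsingleton.elim (α := Fin 1) _ _)).elim

/-- The determinant of the columns `f` of the matrix of a section of `Q(0,1)`, as a polynomial
function of the section. -/
def minorPolynomial (f : Fin (m + 1) → Fin (n + 1)) :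
    MvPolynomial (Module.Dual ℂ (Q01 m n).globalSections) ℂ :=
  (Matrix.of fun q p => MvPolynomial.X (matrixEntry q (f p))).det

theorem eval_minorPolynomial (f : Fin (m + 1) → Fin (n + 1)) (s : (Q01 m n).globalSections) :
    MvPolynomial.eval (fun φ => φ s) (minorPolynomial f) =
      ((Matrix.of fun q l => matrixEntry q l s).submatrix id f).det := by
  rw [minorPolynomial, RingHom.map_det]
  congr 1
  ext q p
  simp

theorem holdsForGeneral_exists_matrix (h : m ≤ n) :
    HoldsForGeneral fun s : (Q01 m n).globalSections =>
      ∃ (A : Matrix (Fin (m + 1)) (Fin (n + 1)) ℂ) (B : Matrix (Fin (n + 1)) (Fin (m + 1)) ℂ),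
        A * B = 1 ∧ IsMatrixSection A s := by
  let f : Fin (m + 1) → Fin (n + 1) := Fin.castLE (Nat.succ_le_succ h)
  let A₀ : Matrix (Fin (m + 1)) (Fin (n + 1)) ℂ := (1 : Matrix _ _ ℂ).submatrix f id
  have hA₀ : (A₀.submatrix id f).det = 1 := by
    rw [Matrix.submatrix_submatrix, Function.comp_id, Function.id_comp,
      Matrix.submatrix_one _ (Fin.castLE_injective _), Matrix.det_one]
  obtain rfl | hm := Nat.eq_zero_or_pos m
  · refine ⟨1, ⟨0, by simp⟩, fun s _ => ?_⟩
    obtain ⟨B, hB⟩ := exists_mul_eq_one_of_isUnit_det (hA₀ ▸ isUnit_one)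
    exact ⟨A₀, B, hB, isMatrixSection_zero A₀ s⟩
  refine ⟨minorPolynomial f, ?_, fun s hs => ?_⟩
  · obtain ⟨s, hs⟩ := exists_isMatrixSection A₀
    have hentries : (Matrix.of fun q l => matrixEntry q l s) = A₀ :=
      Matrix.ext (matrixEntry_eq hm hs)
    refine ⟨s, ?_⟩
    rw [eval_minorPolynomial, hentries, hA₀]
    exact one_ne_zero
  · rw [eval_minorPolynomial] at hs
    obtain ⟨B, hB⟩ := exists_mul_eq_one_of_isUnit_det hs.isUnit
    exact ⟨_, B, hB, isMatrixSection_matrixEntry hm (hm.trans_le h) s⟩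

end

end BlowUpLinear

end

theorem lemma2p1 (n r : ℕ) (hr : r ≤ n) :
    (∀ L : Submodule ℂ (Fin (n + 1) → ℂ), Module.finrank ℂ L = r →
      ∃ (B : Scheme.{0}) (π : B ⟶ PP n), IsBlowUp (linearSubspaceIdeal n L) π) ∧
    HoldsForGeneral fun s : (Q01 (n - r) n).globalSections =>
      ∀ L : Submodule ℂ (Fin (n + 1) → ℂ), Module.finrank ℂ L = r →
        ∀ (B : Scheme.{0}) (π : B ⟶ PP n), IsBlowUp (linearSubspaceIdeal n L) π →
          Nonempty (Over.mk (π ≫ (PP n ↘ Spec (.of ℂ))) ≅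
            Over.mk ((Q01 (n - r) n).zeroLocusι s ≫ (PPprod (n - r) n ↘ Spec (.of ℂ)))) := by
  refine ⟨fun L hL => ?_, ?_⟩
  · obtain ⟨A, B, hAB, rfl⟩ := exists_matrix_of_submodule hr L hL
    obtain ⟨s, hs⟩ := exists_isMatrixSection A
    exact ⟨_, _, isBlowUp_zeroLocus hAB hs⟩
  · obtain ⟨p, hp, h⟩ := holdsForGeneral_exists_matrix (Nat.sub_le n r)
    refine ⟨p, hp, fun s hs L hL B π hπ => ?_⟩
    obtain ⟨A, C, hAC, hA⟩ := h s hs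
    exact exists_iso_zeroLocus hAC hA L (by omega) hπ
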